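/- Let $r\ge 2$ and $n,m\ge 1$. An $r$-uniform hypergraph is a structure with one symmetric $r$-ary relation $R$ holding only of tuples of distinct points; $R[X]$ denotes the set of hyperedges contained in $X$. For a finite set $X$ of vertices put $\delta(X)=n|X|-m|R[X]|$. In a hypergraph all of whose finite subsets have non-negative $\delta$, let $d(X)=\min\{\delta(Y): X\subseteq Y \text{ finite}\}$ for finite $X$. Let $d(X/Z)=\min\{d(X\cup Y)-d(Y): Y\subseteq Z\text{ finite}\}$ for arbitrary $Z$, and ${\rm cl}^d(Z)=\{a: d(a/Z)=0\}$. Write $B\le_d A$ if $B\subseteq A$ and $B$ is $d$-closed in $A$, that is, its $d$-closure computed in $A$ is $B$. For $f:\mathbb R^{\ge0}\to\mathbb R^{\ge0}$ let $\mathcal C_f$ be the class of finite $r$-uniform hypergraphs $A$ with $\delta(X)\ge 0$ and $\delta(X)\ge f(|X|)$ for all $X\subseteq A$. A generic structure $M_f$ for $(\mathcal C_f,\le_d)$ is a countable $r$-uniform hypergraph whose finite substructures all lie in $\mathcal C_f$ and such that, whenever $A\le_d B\in\mathcal C_f$ and $g:A\to M_f$ is an embedding with $d$-closed image, $g$ extends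 to an embedding $B\to M_f$ with $d$-closed image. Let $M=M_f$, $G={\rm Aut}(M_f)$ and $\mathcal X=\{{\rm cl}^d(X): X\subseteq M\text{ finite}\}$. For $A\in\mathcal X$ let ${\rm orb}(b/A)$ be the orbit of $b$ under the pointwise stabilizer of $A$ in $G$. A point $b$ is basic over $A\in\mathcal X$ if $b\notin A$ and, for all $C\in\mathcal X$ with $A\subseteq C$ and $d(b/C)<d(b/A)$, we have $b\in C$. The structure $M$ is monodimensional if for every $A\in\mathcal X$ and every $b$ basic over $A$ there is $B\in\mathcal X$ with $A\subseteq B$ and $M={\rm cl}^d(B\cup{\rm orb}(b/A))$. For $x_0>0$, say that $f$ is a logarithmic control function from $x_0$ if $f:\mathbb R^{\ge0}\to\mathbb R^{\ge0}$ is continuous and increasing, $f(0)=0$, $f(x)\to\infty$ as $x\to\infty$, and $f$ has at every $x\ge x_0$ a right derivative $f'(x)$, with $f'$ non-increasing on $[x_0,\infty)$ and $f'(x)\le 1/x$ for $x\ge x_0$. (1) Let $r\ge3$, $m=n=1$, and let $f$ be a logarithmic control function from $x_0=1$ with $f(1)=1$. Then a generic structure $M_f$ exists, and every such $M_f$ is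 monodimensional. If moreover $f(r)\le r-1$, that is, if a single hyperedge on $r$ points belongs to $\mathcal C_f$ (which is automatic for $r\ge4$), then ${\rm Aut}(M_f)$ is a simple group. (2) Let $r=2$, $n=2$, $m=1$, and let $f$ be a logarithmic control function from $x_0=2$ with $f(1)=2$ and $f(2)=3$. Then a generic structure $M_f$ exists, every such $M_f$ is monodimensional, and ${\rm Aut}(M_f)$ is a simple group. -/

import Mathlib

open Set Filter Topology

/-- An `r`-uniform hypergraph on `V`: a structure with one symmetric `r`-ary relation that holds
only of tuples of distinct elements, given by its set of hyperedges (the `r`-subsets on which the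
relation holds). -/
structure UniformHypergraph (r : ℕ) (V : Type*) where
  /-- the set `R[V]` of hyperedges -/
  edges : Set (Finset V)
  card_of_mem : ∀ e ∈ edges, e.card = r

namespace UniformHypergraph

/-- The induced substructure on a subset. -/
def induce {r : ℕ} {V : Type*} (H : UniformHypergraph r V) (S : Set V) :
    UniformHypergraph r S where
  edges := {e | e.map (Function.Embedding.subtype _) ∈ H.edges}
  card_of_mem := by
    intro e he
    simpa using H.card_of_mem _ he

/-- `g` is an embedding of structures (an isomorphism onto an induced substructure). -/
def IsEmbedding {r : ℕ} {W V : Type*} (G : UniformHypergraph r W) (H : UniformHypergraph r V)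
    (g : W ↪ V) : Prop :=
  ∀ e : Finset W, e ∈ G.edges ↔ e.map g ∈ H.edges

/-- The automorphism group, as a group of permutations of the vertices. -/
def aut {r : ℕ} {V : Type*} (H : UniformHypergraph r V) : Subgroup (Equiv.Perm V) where
  carrier := {σ | IsEmbedding H H σ.toEmbedding}
  one_mem' := by
    intro e
    have h : (1 : Equiv.Perm V).toEmbedding = Function.Embedding.refl V := rfl
    rw [h, Finset.map_refl]
  mul_mem' := by
    intro σ τ hσ hτ e
    have h : (σ * τ).toEmbedding = τ.toEmbedding.trans σ.toEmbedding := rfl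
    rw [h, ← Finset.map_map, ← hσ, ← hτ]
  inv_mem' := by
    intro σ hσ e
    have h : (σ⁻¹ : Equiv.Perm V).toEmbedding.trans σ.toEmbedding =
        Function.Embedding.refl V := by
      ext x
      exact σ.apply_symm_apply x
    rw [hσ (e.map _), Finset.map_map, h, Finset.map_refl]

/-- The orbit `orb(b/A)` of `b` under the pointwise stabilizer of `A` in the automorphism group. -/
def orb {r : ℕ} {V : Type*} (H : UniformHypergraph r V) (b : V) (A : Set V) : Set V :=
  {b' | ∃ σ ∈ H.aut, (∀ a ∈ A, σ a = a) ∧ σ b = b'}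

open Classical in
/-- The predimension `δ(X) = n |X| - m |R[X]|` of a finite set `X`. -/
noncomputable def predim (n m : ℕ) {r : ℕ} {V : Type*} (H : UniformHypergraph r V)
    (X : Finset V) : ℤ :=
  n * X.card - m * (X.powerset.filter (fun e => e ∈ H.edges)).card

/-- The dimension `d(X)`: the least predimension of a finite set containing `X`. -/
noncomputable def dim (n m : ℕ) {r : ℕ} {V : Type*} (H : UniformHypergraph r V)
    (X : Finset V) : ℤ :=
  sInf {k | ∃ Y : Finset V, X ⊆ Y ∧ k = H.predim n m Y}

open Classical in
/-- The dimension `d(X/Z)` of a finite set over an arbitrary set: the least value of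
`d(X ∪ Y) - d(Y)` for finite subsets `Y` of `Z`. -/
noncomputable def dimOver (n m : ℕ) {r : ℕ} {V : Type*} (H : UniformHypergraph r V)
    (X : Finset V) (Z : Set V) : ℤ :=
  sInf {k | ∃ Y : Finset V, (Y : Set V) ⊆ Z ∧ k = H.dim n m (X ∪ Y) - H.dim n m Y}

/-- The `d`-closure `clᵈ(Z) = {a : d(a/Z) = 0}`. -/
def dcl (n m : ℕ) {r : ℕ} {V : Type*} (H : UniformHypergraph r V) (Z : Set V) : Set V :=
  {a | H.dimOver n m {a} Z = 0}

/-- `B` is `d`-closed in the structure, that is, `B ≤_d H`. -/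
def DClosed (n m : ℕ) {r : ℕ} {V : Type*} (H : UniformHypergraph r V) (B : Set V) : Prop :=
  H.dcl n m B = B

/-- The set `𝒳` of `d`-closures of finite sets. -/
def closures (n m : ℕ) {r : ℕ} {V : Type*} (H : UniformHypergraph r V) : Set (Set V) :=
  {A | ∃ X : Finset V, A = H.dcl n m X}

/-- `b` is basic over `A`. -/
def IsBasic (n m : ℕ) {r : ℕ} {V : Type*} (H : UniformHypergraph r V) (b : V) (A : Set V) :
    Prop :=
  b ∉ A ∧ ∀ C ∈ H.closures n m, A ⊆ C → H.dimOver n m {b} C < H.dimOver n m {b} A → b ∈ C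

/-- Monodimensionality: for every `A ∈ 𝒳` and every basic orbit `D` over `A` there is `B ∈ 𝒳`
containing `A` such that `clᵈ(B, D)` is everything. -/
def Monodimensional (n m : ℕ) {r : ℕ} {V : Type*} (H : UniformHypergraph r V) : Prop :=
  ∀ A ∈ H.closures n m, ∀ b : V, H.IsBasic n m b A →
    ∃ B ∈ H.closures n m, A ⊆ B ∧ H.dcl n m (B ∪ H.orb b A) = univ

/-- Every finite substructure of `H` lies in `𝒞_f`, that is, every finite set `X` satisfies
`δ(X) ≥ 0` and `δ(X) ≥ f(|X|)`. For finite `H` this says `H ∈ 𝒞_f`. -/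
def InClass (n m : ℕ) (f : ℝ → ℝ) {r : ℕ} {V : Type*} (H : UniformHypergraph r V) : Prop :=
  ∀ X : Finset V, 0 ≤ H.predim n m X ∧ f X.card ≤ H.predim n m X

/-- `H` is the generic structure `M_f` of the class `(𝒞_f, ≤_d)`: it is countable, its finite
substructures are in `𝒞_f`, and whenever `A ≤_d B ∈ 𝒞_f` and `g` is an embedding of `A` into `H`
with `d`-closed image, `g` extends to an embedding of `B` with `d`-closed image. (The finite
structures `B` are taken, up to isomorphism, on the sets `Fin k`.) -/
structure IsGeneric (n m : ℕ) (f : ℝ → ℝ) {r : ℕ} {V : Type*} (H : UniformHypergraph r V) :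
    Prop where
  countable : Countable V
  inClass : H.InClass n m f
  extend : ∀ (k : ℕ) (B : UniformHypergraph r (Fin k)), B.InClass n m f →
    ∀ A : Set (Fin k), B.DClosed n m A →
    ∀ g : A ↪ V, IsEmbedding (B.induce A) H g → H.DClosed n m (range g) →
    ∃ h : Fin k ↪ V, IsEmbedding B H h ∧ (∀ a : A, h a = g a) ∧ H.DClosed n m (range h)

end UniformHypergraph

/-- A continuous, increasing, unbounded control function `f` on `[0, ∞)` with `f(0) = 0`, which
has a right derivative `f'` on `[x₀, ∞)` that is non-increasing and satisfies `f'(x) ≤ 1/x`. -/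
structure IsLogControl (f : ℝ → ℝ) (x₀ : ℝ) : Prop where
  zero : f 0 = 0
  continuousOn : ContinuousOn f (Ici 0)
  monotoneOn : MonotoneOn f (Ici 0)
  tendsto : Tendsto f atTop atTop
  rightDeriv : ∃ f' : ℝ → ℝ, (∀ x ∈ Ici x₀, HasDerivWithinAt f (f' x) (Ici x) x) ∧
    AntitoneOn f' (Ici x₀) ∧ ∀ x ∈ Ici x₀, f' x ≤ 1 / x

open scoped Pointwise

set_option linter.unusedSectionVars false

/-! The predimension δ is submodular and bounded below by the unbounded `f`, so every finite set has
a finite closure, on which δ realizes `dim`. A finite set is d-closed exactly when every proper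
finite extension has larger δ. The slope bound gives f(x + y) ≤ f(x) + 1 for y ≤ x, and a proper
extension of a closed set raises the integer δ by at least 1. Hence free amalgams over d-closed
parts stay in the class (`NoCross.good`). This yields the generic structure
(`Control.exists_isGeneric`) and its homogeneity (`IsGeneric.exists_aut`). Call A and B independent
over C if cl(A ∪ C) and cl(B ∪ C) form a free amalgam over cl C with closed union. This relation is
symmetric and transitive, has extensions (`IsGeneric.exists_ind`) and is stationary
(`IsGeneric.stationary`).

Monodimensionality comes from a stronger fact, valid when a single hyperedge lies in the class: the
orbit of any point b outside a closed finite A generates everything together with A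
(`IsGeneric.dcl_orb_eq_univ`). A point attached algebraically to independent conjugates of b has
full dimension over A. Attaching a point to conjugates of that one gives a free point
(`IsGeneric.exists_point_over_orbit`), and all free points over A are conjugate. Free points reach
all others through pendant hyperedges: the new points of an edge freely attached at c are free or of
larger dimension than c, and n such edges put c into the closure of their other points. If no
hyperedge is allowed, the structure is a bare set.

For simplicity, let g ≠ 1. If g kept each conjugate of some point over Z in the closure of that
conjugate and Z, then, since orbits generate, g would fix all free points over a suitable finite set
and hence be 1 (`IsGeneric.exists_fix_apply_notMem_cl`). So g moves special points to points whose
closures meet theirs only in the base. A product of two suitable conjugates of g improves this to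
dimension independence, and a second such product to free independence (`rel_succ_of_rel`,
`Moves.exists_succ`). The resulting h, a product of four conjugates of g, moves finite sets freely
(`movesFreely_of_moves`). Stationarity then lets a product of two conjugates of h realize prescribed
finite maps with free image. A back-and-forth along two chains of four conjugates writes every
automorphism as a product of eight conjugates of h and its inverse (`mem_of_movesAll`). -/

/-- A countable cofinality argument: an increasing sequence meeting countably many cofinal
conditions. -/
theorem exists_monotone_seq_meeting {P : Type*} [Preorder P] {ι : Type*} [Countable ι] (p : P)
    (D : ι → P → Prop) (hD : ∀ i s, ∃ t, s ≤ t ∧ D i t) :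
    ∃ u : ℕ → P, Monotone u ∧ u 0 = p ∧ ∀ i, ∃ k, D i (u k) := by
  have := Encodable.ofCountable ι
  let 𝒟 : ι → Order.Cofinal P := fun i => ⟨{t | D i t}, fun s => by
    obtain ⟨t, h1, h2⟩ := hD i s
    exact ⟨t, h2, h1⟩⟩
  exact ⟨Order.sequenceOfCofinals p 𝒟, Order.sequenceOfCofinals.monotone p 𝒟, rfl,
    fun i => ⟨_, Order.sequenceOfCofinals.encode_mem p 𝒟 i⟩⟩

/-! ### Submodular dimensions, finite closures and free independence -/

/-- A submodular integer dimension on the finite subsets of `V` with finite closures, together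
with a group of permutations preserving it. -/
structure DimGeometry (V : Type*) [DecidableEq V] where
  /-- the dimension of a finite set -/
  d : Finset V → ℤ
  mono : ∀ X Y, X ⊆ Y → d X ≤ d Y
  submod : ∀ X Y, d (X ∪ Y) + d (X ∩ Y) ≤ d X + d Y
  finite : ∀ X, {a | d (insert a X) = d X}.Finite
  /-- the group of symmetries -/
  G : Subgroup (Equiv.Perm V)
  smul_d : ∀ σ ∈ G, ∀ X : Finset V, d (σ • X) = d X

namespace DimGeometry

variable {V : Type*} [DecidableEq V] (S : DimGeometry V)

/-- The closure of a finite set. -/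
noncomputable def cl (X : Finset V) : Finset V := (S.finite X).toFinset

variable {S} {A B C D A' B' C' X Y : Finset V} {a b : V} {σ τ : Equiv.Perm V}

theorem mem_cl : a ∈ S.cl X ↔ S.d (insert a X) = S.d X := by simp [cl]

theorem subset_cl : X ⊆ S.cl X := fun a ha => by
  rw [mem_cl, Finset.insert_eq_of_mem ha]

theorem subset_cl_of (h : X ⊆ Y) : X ⊆ S.cl Y := h.trans subset_cl

/-- By submodularity a point adds no more dimension to Y than to its subset X. -/
theorem cl_mono (h : X ⊆ Y) : S.cl X ⊆ S.cl Y := by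
  intro a ha
  rw [mem_cl] at ha ⊢
  have h1 := S.submod (insert a X) Y
  have h2 := S.mono X (insert a X ∩ Y) (Finset.subset_inter (Finset.subset_insert _ _) h)
  have h3 := S.mono Y (insert a Y) (Finset.subset_insert _ _)
  have h4 : insert a X ∪ Y = insert a Y := by
    rw [Finset.insert_union, Finset.union_eq_right.2 h]
  rw [h4] at h1
  omega

theorem d_union_of_subset_cl (h : Y ⊆ S.cl X) : S.d (X ∪ Y) = S.d X := by
  induction Y using Finset.induction_on with
  | empty => simp
  | insert a Y _ ih =>
    rw [Finset.insert_subset_iff] at h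
    have h1 := cl_mono (S := S) (Finset.subset_union_left (s₁ := X) (s₂ := Y)) h.1
    rw [mem_cl] at h1
    rw [Finset.union_insert, h1, ih h.2]

theorem d_cl (X : Finset V) : S.d (S.cl X) = S.d X := by
  have := d_union_of_subset_cl (S := S) (Finset.Subset.refl (S.cl X))
  rwa [Finset.union_eq_right.2 subset_cl] at this

theorem subset_cl_of_d_le (h : X ⊆ Y) (hd : S.d Y ≤ S.d X) : Y ⊆ S.cl X := by
  intro a ha
  rw [mem_cl]
  exact le_antisymm ((S.mono _ _ (Finset.insert_subset ha h)).trans hd)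
    (S.mono _ _ (Finset.subset_insert _ _))

theorem cl_subset_cl (h : X ⊆ S.cl Y) : S.cl X ⊆ S.cl Y := by
  refine (cl_mono (Finset.subset_union_right (s₁ := Y))).trans
    (subset_cl_of_d_le (Finset.subset_union_left.trans subset_cl) ?_)
  rw [d_cl, d_union_of_subset_cl h]

theorem cl_cl (X : Finset V) : S.cl (S.cl X) = S.cl X :=
  (cl_subset_cl (Finset.Subset.refl _)).antisymm subset_cl

theorem d_le_of_subset_cl (h : X ⊆ S.cl Y) : S.d X ≤ S.d Y :=
  (S.mono _ _ h).trans (d_cl Y).le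

theorem cl_eq_of_subset (h : X ⊆ S.cl Y) (h' : Y ⊆ S.cl X) : S.cl X = S.cl Y :=
  (cl_subset_cl h).antisymm (cl_subset_cl h')

theorem d_eq_of_cl_eq (h : S.cl X = S.cl Y) : S.d X = S.d Y := by
  rw [← d_cl X, h, d_cl]

theorem cl_eq_of_subset_of_d (h : X ⊆ S.cl Y) (hd : S.d Y ≤ S.d X) : S.cl X = S.cl Y := by
  refine cl_eq_of_subset h (subset_cl.trans (subset_cl_of_d_le h ?_))
  rwa [d_cl]

theorem d_insert_of_notMem (h : a ∉ S.cl X) : S.d X + 1 ≤ S.d (insert a X) := by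
  rw [mem_cl] at h
  have := S.mono _ _ (Finset.subset_insert a X)
  omega

theorem union_subset_cl (hX : X ⊆ S.cl C) (hY : Y ⊆ S.cl C) : X ∪ Y ⊆ S.cl C :=
  Finset.union_subset hX hY

theorem smul_cl (hσ : σ ∈ S.G) (X : Finset V) : S.cl (σ • X) = σ • S.cl X := by
  ext a
  rw [mem_cl, ← Finset.inv_smul_mem_iff, mem_cl, S.smul_d σ hσ,
    ← S.smul_d σ hσ (insert _ X), Finset.smul_finset_insert, smul_inv_smul]

/-- Free independence of `A` and `B` over `C`. -/
def Ind (S : DimGeometry V) (A C B : Finset V) : Prop :=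
  S.cl (A ∪ B ∪ C) ⊆ S.cl (A ∪ C) ∪ S.cl (B ∪ C) ∧
    S.d (A ∪ B ∪ C) + S.d C = S.d (A ∪ C) + S.d (B ∪ C)

theorem Ind.symm (h : S.Ind A C B) : S.Ind B C A := by
  unfold Ind at *
  rw [Finset.union_comm B A, Finset.union_comm (S.cl _)]
  exact ⟨h.1, by rw [h.2]; ring⟩

/-- Independence sees only three closures, because cl(A ∪ B ∪ C) is generated by cl(A ∪ C) and cl(B
∪ C). -/
theorem ind_congr (hC : S.cl C = S.cl C') (hA : S.cl (A ∪ C) = S.cl (A' ∪ C'))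
    (hB : S.cl (B ∪ C) = S.cl (B' ∪ C')) : S.Ind A C B ↔ S.Ind A' C' B' := by
  have key : ∀ A B C : Finset V, S.cl (A ∪ B ∪ C) = S.cl (S.cl (A ∪ C) ∪ S.cl (B ∪ C)) := by
    intro A B C
    apply cl_eq_of_subset
    · intro x hx
      apply subset_cl
      simp only [Finset.mem_union] at hx ⊢
      rcases hx with (h | h) | h
      · exact Or.inl (subset_cl (by simp [h]))
      · exact Or.inr (subset_cl (by simp [h]))
      · exact Or.inl (subset_cl (by simp [h]))
    · exact union_subset_cl (cl_mono (by grind)) (cl_mono (by grind))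
  have h : S.cl (A ∪ B ∪ C) = S.cl (A' ∪ B' ∪ C') := by rw [key, key A', hA, hB]
  unfold Ind
  rw [h, hA, hB, d_eq_of_cl_eq h, d_eq_of_cl_eq hA, d_eq_of_cl_eq hB, d_eq_of_cl_eq hC]

/-- The dimension part of independence implies that the closures meet in the closure of the
base. -/
theorem inter_cl_of_d (h : S.d (A ∪ B ∪ C) + S.d C = S.d (A ∪ C) + S.d (B ∪ C)) :
    S.cl (A ∪ C) ∩ S.cl (B ∪ C) = S.cl C := by
  apply Finset.Subset.antisymm
  · intro x hx
    rw [Finset.mem_inter] at hx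
    rw [mem_cl]
    -- Adding x changes neither d(A ∪ C) nor d(B ∪ C), so by submodularity it cannot raise the
    -- dimension of C, which lies in both.
    have h1 := S.submod (insert x (A ∪ C)) (insert x (B ∪ C))
    have h2 := S.mono (insert x C) (insert x (A ∪ C) ∩ insert x (B ∪ C)) (by grind)
    have h3 := S.mono (A ∪ B ∪ C) (insert x (A ∪ C) ∪ insert x (B ∪ C)) (by grind)
    have h4 := S.mono C (insert x C) (by grind)
    rw [mem_cl.1 hx.1, mem_cl.1 hx.2] at h1
    omega
  · exact Finset.subset_inter (cl_mono (by grind)) (cl_mono (by grind))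

theorem Ind.inter (h : S.Ind A C B) : S.cl (A ∪ C) ∩ S.cl (B ∪ C) = S.cl C :=
  inter_cl_of_d h.2

theorem Ind.cl_eq (h : S.Ind A C B) : S.cl (A ∪ B ∪ C) = S.cl (A ∪ C) ∪ S.cl (B ∪ C) :=
  h.1.antisymm (Finset.union_subset (cl_mono (by grind)) (cl_mono (by grind)))

/-- Going from C to B ∪ C and then to B ∪ D ∪ C, submodularity makes both drops in the relative
dimension of A non-negative. The hypothesis says that their sum is zero. -/
theorem d_base_change (h : S.d (A ∪ (B ∪ D) ∪ C) + S.d C = S.d (A ∪ C) + S.d (B ∪ D ∪ C)) :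
    S.d (A ∪ B ∪ C) + S.d C = S.d (A ∪ C) + S.d (B ∪ C) ∧
    S.d (A ∪ D ∪ (B ∪ C)) + S.d (B ∪ C) = S.d (A ∪ (B ∪ C)) + S.d (D ∪ (B ∪ C)) := by
  have e1 : A ∪ D ∪ (B ∪ C) = A ∪ (B ∪ D) ∪ C := by grind
  have e2 : D ∪ (B ∪ C) = B ∪ D ∪ C := by grind
  have e3 : A ∪ (B ∪ C) = A ∪ B ∪ C := by grind
  rw [e1, e2, e3]
  have h1 := S.submod (A ∪ B ∪ C) (B ∪ D ∪ C)
  have h2 := S.mono (B ∪ C) ((A ∪ B ∪ C) ∩ (B ∪ D ∪ C)) (by grind)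
  have h3 : (A ∪ B ∪ C) ∪ (B ∪ D ∪ C) = A ∪ (B ∪ D) ∪ C := by grind
  have h4 := S.submod (A ∪ C) (B ∪ C)
  have h5 := S.mono C ((A ∪ C) ∩ (B ∪ C)) (by grind)
  have h6 : (A ∪ C) ∪ (B ∪ C) = A ∪ B ∪ C := by grind
  rw [h3] at h1
  rw [h6] at h4
  constructor <;> omega

theorem Ind.decompose (h : S.Ind A C (B ∪ D)) : S.Ind A C B ∧ S.Ind A (B ∪ C) D := by
  obtain ⟨hd1, hd2⟩ := d_base_change h.2
  refine ⟨⟨?_, hd1⟩, ⟨?_, hd2⟩⟩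
  · intro x hx
    have hx1 : x ∈ S.cl (A ∪ (B ∪ D) ∪ C) := cl_mono (by grind) hx
    have hx2 := h.1 hx1
    rw [Finset.mem_union] at hx2 ⊢
    rcases hx2 with hx2 | hx2
    · exact Or.inl hx2
    · right
      -- The point lies in cl(A ∪ B ∪ C) and in cl(B ∪ D ∪ C), and the dimension equality over B ∪ C
      -- already makes these meet in cl(B ∪ C).
      rw [← inter_cl_of_d hd2]
      rw [Finset.mem_inter]
      refine ⟨?_, ?_⟩
      · convert hx using 2; grind
      · convert hx2 using 2; grind
  · have e1 : A ∪ D ∪ (B ∪ C) = A ∪ (B ∪ D) ∪ C := by grind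
    have e2 : D ∪ (B ∪ C) = B ∪ D ∪ C := by grind
    rw [e1, e2]
    exact h.1.trans (Finset.union_subset_union (cl_mono (by grind)) (Finset.Subset.refl _))

theorem Ind.compose (h1 : S.Ind A C B) (h2 : S.Ind A (B ∪ C) D) : S.Ind A C (B ∪ D) := by
  have e1 : A ∪ D ∪ (B ∪ C) = A ∪ (B ∪ D) ∪ C := by grind
  have e2 : D ∪ (B ∪ C) = B ∪ D ∪ C := by grind
  have e3 : A ∪ (B ∪ C) = A ∪ B ∪ C := by grind
  obtain ⟨h2a, h2b⟩ := h2
  rw [e1, e2, e3] at h2a h2b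
  refine ⟨?_, ?_⟩
  · refine h2a.trans ?_
    rw [h1.cl_eq]
    refine Finset.union_subset (Finset.union_subset_union (Finset.Subset.refl _)
      (cl_mono (by grind))) Finset.subset_union_right
  · have := h1.2
    omega

theorem Ind.mono_right (h : S.Ind A C B) (hB : B' ⊆ S.cl (B ∪ C)) : S.Ind A C B' := by
  have : S.Ind A C (B' ∪ B) := by
    refine (ind_congr rfl rfl (cl_eq_of_subset (Finset.Subset.trans ?_ subset_cl) ?_)).1 h
    · grind
    · refine union_subset_cl (union_subset_cl hB ?_) ?_ <;>
      exact Finset.Subset.trans (by grind) subset_cl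
  exact this.decompose.1

theorem Ind.mono_left (h : S.Ind A C B) (hA : A' ⊆ S.cl (A ∪ C)) : S.Ind A' C B :=
  (h.symm.mono_right hA).symm

/-- Independence is preserved when the base is enlarged inside the right-hand side. -/
theorem Ind.base_mono (h : S.Ind A C B) (h1 : C ⊆ S.cl C') (h2 : C' ⊆ S.cl (B ∪ C)) :
    S.Ind A C' B := by
  have h3 : S.Ind A C (C' ∪ B) := h.mono_right
    (union_subset_cl h2 (Finset.Subset.trans (by grind) subset_cl))
  have hs : ∀ X : Finset V, X ⊆ S.cl (X ∪ C') := fun X =>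
    Finset.Subset.trans (by grind) subset_cl
  have hc : ∀ X : Finset V, C' ⊆ S.cl (X ∪ C') := fun X =>
    Finset.Subset.trans (by grind) subset_cl
  have hcc : ∀ X : Finset V, C ⊆ S.cl (X ∪ C') := fun X =>
    h1.trans (cl_mono (by grind))
  have hr : ∀ X Z : Finset V, X ⊆ S.cl (X ∪ Z) := fun X Z =>
    Finset.Subset.trans (by grind) subset_cl
  refine (ind_congr ?_ ?_ ?_).1 h3.decompose.2
  · exact cl_eq_of_subset (union_subset_cl subset_cl h1) (hr _ _)
  · exact cl_eq_of_subset (union_subset_cl (hs _) (union_subset_cl (hc _) (hcc _)))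
      (cl_mono (S := S) (by grind) |> subset_cl.trans)
  · exact cl_eq_of_subset (union_subset_cl (hs _) (union_subset_cl (hc _) (hcc _)))
      (cl_mono (S := S) (by grind) |> subset_cl.trans)

/-- Since C' lies in cl(B ∪ C), A is independent from C' over C; composition then adds D. -/
theorem Ind.trans (h1 : S.Ind A C B) (h2 : S.Ind A C' D) (hC : C ⊆ S.cl C')
    (hC' : C' ⊆ S.cl (B ∪ C)) : S.Ind A C D := by
  have h1' : S.Ind A C C' := h1.mono_right hC'
  have h2' : S.Ind A (C' ∪ C) D := by
    have e : S.cl (C' ∪ C) = S.cl C' := cl_eq_of_subset (union_subset_cl subset_cl hC)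
      (Finset.Subset.trans (by grind) subset_cl)
    have e' : ∀ X : Finset V, S.cl (X ∪ C') = S.cl (X ∪ (C' ∪ C)) := fun X =>
      cl_eq_of_subset (Finset.Subset.trans (by grind) subset_cl)
        (union_subset_cl (Finset.Subset.trans (by grind) subset_cl)
          (union_subset_cl (Finset.Subset.trans (by grind) subset_cl) (hC.trans (cl_mono (by grind)))))
    exact (ind_congr e.symm (e' _) (e' _)).1 h2
  exact (h1'.compose h2').mono_right (Finset.Subset.trans (by grind) subset_cl)

theorem Ind.smul (hσ : σ ∈ S.G) (h : S.Ind A C B) : S.Ind (σ • A) (σ • C) (σ • B) := by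
  unfold Ind at *
  simp only [← Finset.smul_finset_union, smul_cl hσ, S.smul_d σ hσ]
  exact ⟨Finset.smul_finset_subset_smul_finset h.1, h.2⟩

theorem ind_of_subset_right (h : B ⊆ S.cl C) : S.Ind A C B := by
  have e : S.cl (B ∪ C) = S.cl C := cl_eq_of_subset (union_subset_cl h subset_cl)
      (Finset.Subset.trans (by grind) subset_cl)
  have e' : S.cl (A ∪ B ∪ C) = S.cl (A ∪ C) := cl_eq_of_subset
      (union_subset_cl (union_subset_cl (Finset.Subset.trans (by grind) subset_cl)
        (h.trans (cl_mono (by grind)))) (Finset.Subset.trans (by grind) subset_cl))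
      (Finset.Subset.trans (by grind) subset_cl)
  refine ⟨?_, ?_⟩
  · rw [e']; exact Finset.subset_union_left
  · rw [d_eq_of_cl_eq e, d_eq_of_cl_eq e']

/-- The subgroup fixing the closure of `C` pointwise. -/
def fix (S : DimGeometry V) (C : Finset V) : Subgroup (Equiv.Perm V) where
  carrier := {σ | σ ∈ S.G ∧ ∀ c ∈ S.cl C, σ c = c}
  one_mem' := ⟨S.G.one_mem, fun _ _ => rfl⟩
  mul_mem' := by
    rintro σ τ ⟨h1, h2⟩ ⟨h3, h4⟩
    refine ⟨S.G.mul_mem h1 h3, fun c hc => ?_⟩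
    rw [Equiv.Perm.mul_apply, h4 c hc, h2 c hc]
  inv_mem' := by
    rintro σ ⟨h1, h2⟩
    refine ⟨S.G.inv_mem h1, fun c hc => ?_⟩
    rw [Equiv.Perm.inv_eq_iff_eq, h2 c hc]

theorem fix_mono (h : C ⊆ S.cl C') : S.fix C' ≤ S.fix C :=
  fun _ hσ => ⟨hσ.1, fun c hc => hσ.2 c (cl_subset_cl h hc)⟩

theorem fix_mono' (h : C ⊆ C') : S.fix C' ≤ S.fix C := fix_mono (h.trans subset_cl)

theorem smul_eq_of_forall (h : ∀ x ∈ X, σ x = x) : σ • X = X := by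
  rw [← Finset.image_smul]
  conv_rhs => rw [← Finset.image_id (s := X)]
  exact Finset.image_congr fun x hx => h x hx

theorem smul_congr (h : ∀ x ∈ X, σ x = τ x) : σ • X = τ • X := by
  rw [← Finset.image_smul, ← Finset.image_smul]
  exact Finset.image_congr fun x hx => h x hx

theorem smul_of_mem_fix (hσ : σ ∈ S.fix C) (h : X ⊆ S.cl C) : σ • X = X :=
  smul_eq_of_forall fun x hx => hσ.2 x (h hx)

theorem smul_of_mem_fix' (hσ : σ ∈ S.fix C) (h : X ⊆ C) : σ • X = X :=
  smul_of_mem_fix hσ (h.trans subset_cl)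

theorem conj_mem_fix (hσ : σ ∈ S.fix C) (hτ : τ ∈ S.G) : τ * σ * τ⁻¹ ∈ S.fix (τ • C) := by
  refine ⟨S.G.mul_mem (S.G.mul_mem hτ hσ.1) (S.G.inv_mem hτ), fun c hc => ?_⟩
  rw [smul_cl hτ, ← Finset.inv_smul_mem_iff] at hc
  change τ (σ (τ⁻¹ • c)) = c
  rw [hσ.2 _ hc]
  exact τ.apply_symm_apply c

theorem smul_singleton_apply : σ • ({a} : Finset V) = {σ a} := Finset.smul_finset_singleton a

end DimGeometry

/-! ### Free geometries and the three degrees of independence -/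

/-- A dimension geometry whose independence relation is stationary and has free extensions. -/
structure FreeGeometry (V : Type*) [DecidableEq V] extends DimGeometry V where
  exists_ind : ∀ A C B : Finset V, ∃ σ ∈ toDimGeometry.fix C, toDimGeometry.Ind (σ • A) C B
  stationary : ∀ (A C B : Finset V), ∀ τ ∈ toDimGeometry.fix C, toDimGeometry.Ind A C B →
    toDimGeometry.Ind (τ • A) C B → ∃ σ ∈ toDimGeometry.fix (B ∪ C), ∀ a ∈ A, σ a = τ a
  modular : ∀ A C B X : Finset V, toDimGeometry.Ind A C B → toDimGeometry.cl X = X →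
    X ⊆ toDimGeometry.cl (A ∪ B ∪ C) →
    d X + d (X ∩ toDimGeometry.cl C) =
      d (X ∩ toDimGeometry.cl (A ∪ C)) + d (X ∩ toDimGeometry.cl (B ∪ C))
  d_insert_le : ∀ a X, d (insert a X) ≤ d X + 2
  cl_empty : toDimGeometry.cl ∅ = ∅
  cl_singleton : ∀ a, toDimGeometry.cl {a} = {a}
  mem_of_forall : ∀ σ : Equiv.Perm V,
    (∀ X : Finset V, ∃ τ ∈ G, ∀ x ∈ X, σ x = τ x) → σ ∈ G

namespace DimGeometry

variable {V : Type*} [DecidableEq V] {S : DimGeometry V}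
  {A B C D X Y Z Z' : Finset V} {a b c : V} {σ τ g : Equiv.Perm V}

/-- `b` has relative dimension one over `X`, or is a free point over `X`. -/
def Special (S : DimGeometry V) (X : Finset V) (b : V) : Prop :=
  b ∉ S.cl X ∧ (S.d ({b} ∪ X) = S.d X + 1 ∨ S.Ind {b} ∅ X)

theorem Special.smul (hσ : σ ∈ S.G) (h : S.Special X b) : S.Special (σ • X) (σ b) := by
  refine ⟨?_, ?_⟩
  · rw [smul_cl hσ]
    intro h'
    exact h.1 ((Finset.smul_mem_smul_finset_iff σ).1 h')
  · rcases h.2 with h | h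
    · left
      rw [← smul_singleton_apply, ← Finset.smul_finset_union, S.smul_d σ hσ, S.smul_d σ hσ, h]
    · right
      have := h.smul hσ
      rwa [smul_singleton_apply, Finset.smul_finset_empty] at this

/-- Three degrees of independence of two points over `Z`: closures meeting only in the closure of
`Z`, dimension independence, and free independence. -/
def Rel (S : DimGeometry V) : ℕ → Finset V → V → V → Prop
  | 0, Z, b, c => S.cl ({b} ∪ Z) ∩ S.cl ({c} ∪ Z) ⊆ S.cl Z
  | 1, Z, b, c => S.d ({b} ∪ {c} ∪ Z) + S.d Z = S.d ({b} ∪ Z) + S.d ({c} ∪ Z)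
  | _, Z, b, c => S.Ind {b} Z {c}

theorem Rel.smul (hσ : σ ∈ S.G) {j : ℕ} (h : S.Rel j Z b c) :
    S.Rel j (σ • Z) (σ b) (σ c) := by
  rcases j with _ | _ | j
  · simp only [Rel, ← smul_singleton_apply, ← Finset.smul_finset_union, smul_cl hσ,
      ← Finset.smul_finset_inter] at h ⊢
    exact Finset.smul_finset_subset_smul_finset h
  · simp only [Rel, ← smul_singleton_apply, ← Finset.smul_finset_union, S.smul_d σ hσ] at h ⊢
    exact h
  · simp only [Rel, ← smul_singleton_apply] at h ⊢
    exact h.smul hσ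

/-- Independence of the pair from Z' makes each closure over Z' the union of the closure over Z with
cl Z', and preserves all relative dimensions. -/
theorem Rel.base_up {j : ℕ} (h : S.Rel j Z b c) (hZ : Z ⊆ Z')
    (hi : S.Ind ({b} ∪ {c}) Z Z') : S.Rel j Z' b c := by
  have hb : S.Ind {b} Z Z' := hi.mono_left (Finset.Subset.trans (by grind) subset_cl)
  have hc : S.Ind {c} Z Z' := hi.mono_left (Finset.Subset.trans (by grind) subset_cl)
  have hZ' : Z' ∪ Z = Z' := Finset.union_eq_left.2 hZ
  have eb : {b} ∪ Z' ∪ Z = {b} ∪ Z' := by grind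
  have ec : {c} ∪ Z' ∪ Z = {c} ∪ Z' := by grind
  have ebc : {b} ∪ {c} ∪ Z' ∪ Z = {b} ∪ {c} ∪ Z' := by grind
  rcases j with _ | _ | j
  · have h1 := hb.cl_eq
    have h2 := hc.cl_eq
    rw [hZ', eb] at h1
    rw [hZ', ec] at h2
    simp only [Rel] at h ⊢
    intro x hx
    rw [h1, h2] at hx
    by_cases hx' : x ∈ S.cl Z'
    · exact hx'
    · apply cl_mono hZ
      apply h
      simp only [Finset.mem_inter, Finset.mem_union, hx', or_false] at hx ⊢
      exact hx
  · have h1 := hb.2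
    have h2 := hc.2
    have h3 := hi.2
    rw [hZ', eb] at h1
    rw [hZ', ec] at h2
    rw [hZ', ebc] at h3
    simp only [Rel] at h ⊢
    omega
  · simp only [Rel] at h ⊢
    have h1 : S.Ind Z' Z ({c} ∪ {b}) := by
      rw [Finset.union_comm]
      exact hi.symm
    have h2 : S.Ind {b} Z (Z' ∪ {c}) := by
      rw [Finset.union_comm]
      exact h.compose h1.decompose.2.symm
    have h3 := h2.decompose.2
    rwa [hZ'] at h3

/-- Separate independence of b and c from Z' is enough: their relative dimensions are the same over
Z and Z', while that of the pair can only drop when the base grows. -/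
theorem Rel.base_down {j : ℕ} (h : S.Rel j Z' b c) (hZ : Z ⊆ Z')
    (hb : S.Ind {b} Z Z') (hc : S.Ind {c} Z Z') : S.Rel j Z b c := by
  have hZ' : Z' ∪ Z = Z' := Finset.union_eq_left.2 hZ
  have eb : {b} ∪ Z' ∪ Z = {b} ∪ Z' := by grind
  have ec : {c} ∪ Z' ∪ Z = {c} ∪ Z' := by grind
  rcases j with _ | _ | j
  · simp only [Rel] at h ⊢
    intro x hx
    rw [← hb.inter, hZ']
    rw [Finset.mem_inter] at hx ⊢
    exact ⟨hx.1, h (Finset.mem_inter.2 ⟨cl_mono (by grind) hx.1, cl_mono (by grind) hx.2⟩)⟩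
  · have h1 := hb.2
    have h2 := hc.2
    rw [hZ', eb] at h1
    rw [hZ', ec] at h2
    simp only [Rel] at h ⊢
    have h3 := S.submod ({b} ∪ {c} ∪ Z) Z'
    have h4 := S.mono Z (({b} ∪ {c} ∪ Z) ∩ Z') (by grind)
    have h5 : ({b} ∪ {c} ∪ Z) ∪ Z' = {b} ∪ {c} ∪ Z' := by grind
    have h6 := S.submod ({b} ∪ Z) ({c} ∪ Z)
    have h7 := S.mono Z (({b} ∪ Z) ∩ ({c} ∪ Z)) (by grind)
    have h8 : ({b} ∪ Z) ∪ ({c} ∪ Z) = {b} ∪ {c} ∪ Z := by grind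
    rw [h5] at h3
    rw [h8] at h6
    omega
  · simp only [Rel] at h ⊢
    exact hb.trans h (subset_cl_of hZ) (subset_cl_of (by grind))

end DimGeometry

namespace FreeGeometry

open DimGeometry

variable {V : Type*} [DecidableEq V] {F : FreeGeometry V}
  {A B C D X Y Z Z' : Finset V} {a b c b₀ b₂ : V} {σ τ g : Equiv.Perm V}

/-- Two points related to a middle point, and free from each other over it, are related to a
higher degree. -/
theorem rel_succ_of_rel {j : ℕ} (h₀ : F.Rel j Z b₀ c) (h₂ : F.Rel j Z c b₂)
    (hi : F.Ind {b₀} ({c} ∪ Z) {b₂}) : F.Rel (j + 1) Z b₀ b₂ := by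
  -- Closed subsets of a free amalgam split along it: d(Y) + d(W) = d(Y₁) + d(Y₂). The three cases
  -- differ only in what is known about W, the trace of Y on cl(c, Z).
  set Y := F.cl ({b₀} ∪ {b₂} ∪ Z) with hY
  have hmod := F.modular {b₀} ({c} ∪ Z) {b₂} Y hi (cl_cl _) (cl_mono (by grind))
  set Y₁ := Y ∩ F.cl ({b₀} ∪ ({c} ∪ Z)) with hY₁
  set Y₂ := Y ∩ F.cl ({b₂} ∪ ({c} ∪ Z)) with hY₂
  set W := Y ∩ F.cl ({c} ∪ Z) with hW
  have hdY : F.d Y = F.d ({b₀} ∪ {b₂} ∪ Z) := d_cl _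
  have hsub := F.submod ({b₀} ∪ Z) ({b₂} ∪ Z)
  have hZle := F.mono Z (({b₀} ∪ Z) ∩ ({b₂} ∪ Z)) (by grind)
  have hun : ({b₀} ∪ Z) ∪ ({b₂} ∪ Z) = {b₀} ∪ {b₂} ∪ Z := by grind
  rw [hun] at hsub
  have hZW : Z ⊆ W := Finset.subset_inter (subset_cl_of (by grind)) (subset_cl_of (by grind))
  have h1 : {b₀} ∪ W ⊆ Y₁ := by
    refine Finset.union_subset (Finset.subset_inter (subset_cl_of (by grind))
      (subset_cl_of (by grind))) (Finset.inter_subset_inter_left (cl_mono (by grind)))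
  have h2 : {b₂} ∪ W ⊆ Y₂ := by
    refine Finset.union_subset (Finset.subset_inter (subset_cl_of (by grind))
      (subset_cl_of (by grind))) (Finset.inter_subset_inter_left (cl_mono (by grind)))
  have hd1 := F.mono _ _ h1
  have hd2 := F.mono _ _ h2
  have hclW : F.cl W = W := by
    refine Finset.Subset.antisymm (Finset.subset_inter ?_ ?_) subset_cl
    · exact cl_subset_cl Finset.inter_subset_left
    · exact cl_subset_cl Finset.inter_subset_right
  rcases j with _ | _ | j
  · simp only [DimGeometry.Rel] at h₀ h₂ ⊢
    by_cases hWZ : W ⊆ F.cl Z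
    · have e1 := d_le_of_subset_cl hWZ
      have e2 := F.mono ({b₀} ∪ Z) ({b₀} ∪ W) (by grind)
      have e3 := F.mono ({b₂} ∪ Z) ({b₂} ∪ W) (by grind)
      omega
    -- A point of W outside cl Z gives d(Y₁) ≥ d(b₀, Z) + 1, and b₂ ∉ W gives d(Y₂) ≥ d(W) + 1. So
    -- d(Y) ≥ d(b₀, Z) + 2, which suffices because a single point adds at most 2.
    · obtain ⟨x, hxW, hxZ⟩ := Finset.not_subset.1 hWZ
      have hx0 : x ∉ F.cl ({b₀} ∪ Z) := fun hx =>
        hxZ (h₀ (Finset.mem_inter.2 ⟨hx, (Finset.mem_inter.1 hxW).2⟩))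
      have e1 := d_insert_of_notMem hx0
      have e2 := F.mono (insert x ({b₀} ∪ Z)) ({b₀} ∪ W) (by grind)
      by_cases hb : b₂ ∈ F.cl Z
      · have e3 : F.d ({b₂} ∪ Z) = F.d Z := mem_cl.1 hb
        have e4 : F.d ({b₀} ∪ {b₂} ∪ Z) = F.d ({b₀} ∪ Z) := by
          have : b₂ ∈ F.cl ({b₀} ∪ Z) := cl_mono (by grind) hb
          rw [← mem_cl.1 this]
          congr 1; grind
        omega
      · have hbW : b₂ ∉ F.cl W := by
          rw [hclW]
          intro hbW
          exact hb (h₂ (Finset.mem_inter.2 ⟨(Finset.mem_inter.1 hbW).2,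
            subset_cl (by grind)⟩))
        have e3 := d_insert_of_notMem hbW
        rw [Finset.insert_eq] at e3
        have e4 := F.d_insert_le b₂ Z
        rw [Finset.insert_eq] at e4
        omega
  · simp only [DimGeometry.Rel] at h₀ h₂
    -- As W lies in cl(c, Z), the point b keeps its relative dimension over W. Used for b₀ and b₂ in
    -- the modular equation, this forces d(W) = d(Z). Then Y₁ and Y₂ shrink to cl(b₀, Z) and cl(b₂,
    -- Z), which is freeness.
    have key : ∀ b, F.d ({b} ∪ {c} ∪ Z) + F.d Z = F.d ({b} ∪ Z) + F.d ({c} ∪ Z) →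
        F.d ({b} ∪ Z) + F.d W ≤ F.d ({b} ∪ W) + F.d Z := by
      intro b hb
      have e1 := F.submod ({b} ∪ W) (F.cl ({c} ∪ Z))
      have e2 := F.mono W (({b} ∪ W) ∩ F.cl ({c} ∪ Z))
        (Finset.subset_inter (by grind) Finset.inter_subset_right)
      have e3 := F.mono ({b} ∪ {c} ∪ Z) (({b} ∪ W) ∪ F.cl ({c} ∪ Z)) (by
        have := subset_cl (S := F.toDimGeometry) (X := {c} ∪ Z)
        grind)
      rw [d_cl] at e1
      omega
    have k0 := key b₀ h₀
    have k2 := key b₂ (by rw [Finset.union_comm {b₂} {c}, h₂, add_comm])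
    have kZ := F.mono _ _ hZW
    have hWd : F.d W = F.d Z := by omega
    have hWZ : W ⊆ F.cl Z := subset_cl_of_d_le hZW hWd.le
    have l1 : Y₁ ⊆ F.cl ({b₀} ∪ Z) := subset_cl_of_d_le (by grind) (by omega)
    have l2 : Y₂ ⊆ F.cl ({b₂} ∪ Z) := subset_cl_of_d_le (by grind) (by omega)
    refine ⟨fun x hx => ?_, by omega⟩
    have hx' : x ∈ F.cl ({b₀} ∪ {b₂} ∪ ({c} ∪ Z)) := cl_mono (by grind) hx
    rw [hi.cl_eq, Finset.mem_union] at hx'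
    rw [Finset.mem_union]
    exact hx'.imp (fun h => l1 (Finset.mem_inter.2 ⟨hx, h⟩))
      (fun h => l2 (Finset.mem_inter.2 ⟨hx, h⟩))
  · simp only [DimGeometry.Rel] at h₀ h₂ ⊢
    have e1 : F.Ind {b₀} Z {c} := h₀
    exact e1.trans hi (subset_cl_of (by grind)) (subset_cl_of (by grind))

/-- `g` moves special points: over every base, some conjugate position of a special point is moved
to a point related to it to degree `j`. -/
def Moves (F : FreeGeometry V) (j : ℕ) (g : Equiv.Perm V) : Prop :=
  ∀ X b, F.Special X b → ∀ Z, X ⊆ Z → g • X ⊆ Z → F.Ind {b} X Z →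
    ∃ σ ∈ F.fix Z, F.Ind {g (σ b)} (g • X) Z ∧ F.Rel j Z (σ b) (g (σ b))

/-- The limit of a sequence of elements of the group that stabilizes on larger and larger
finite sets. -/
theorem exists_limit (α : ℕ → Equiv.Perm V) (T : ℕ → Finset V) (hG : ∀ k, α k ∈ F.G)
    (hα : ∀ k l, k ≤ l → ∀ x ∈ T k, α l x = α k x ∧ (α l)⁻¹ x = (α k)⁻¹ x)
    (hT : Monotone T) (hcov : ∀ v, ∃ k, v ∈ T k) :
    ∃ β ∈ F.G, ∀ k, ∀ x ∈ T k, β x = α k x ∧ β⁻¹ x = (α k)⁻¹ x := by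
  choose K hK using hcov
  have h1 : ∀ v k, v ∈ T k → α (K v) v = α k v ∧ (α (K v))⁻¹ v = (α k)⁻¹ v := by
    intro v k hv
    have e1 := hα (K v) (max (K v) k) (le_max_left _ _) v (hK v)
    have e2 := hα k (max (K v) k) (le_max_right _ _) v hv
    exact ⟨e1.1.symm.trans e2.1, e1.2.symm.trans e2.2⟩
  -- The inverses stabilize as well, and this is what makes the limit surjective.
  let β : Equiv.Perm V :=
    { toFun := fun v => α (K v) v
      invFun := fun v => (α (K v))⁻¹ v
      left_inv := by
        intro v
        set w := α (K v) v with hw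
        set m := max (K v) (K w)
        have e1 := h1 v m (hT (le_max_left _ _) (hK v))
        have e2 := h1 w m (hT (le_max_right _ _) (hK w))
        change (α (K w))⁻¹ w = v
        rw [e2.2, hw, e1.1]
        exact (α m).symm_apply_apply v
      right_inv := by
        intro v
        set w := (α (K v))⁻¹ v with hw
        set m := max (K v) (K w)
        have e1 := h1 v m (hT (le_max_left _ _) (hK v))
        have e2 := h1 w m (hT (le_max_right _ _) (hK w))
        change α (K w) w = v
        rw [e2.1, hw, e1.2]
        exact (α m).apply_symm_apply v }
  refine ⟨β, ?_, fun k x hx => h1 x k hx⟩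
  apply F.mem_of_forall
  intro X
  obtain ⟨k, hk⟩ : ∃ k, X ⊆ T k := by
    refine ⟨X.sup K, fun x hx => hT (Finset.le_sup (f := K) hx) (hK x)⟩
  exact ⟨α k, hG k, fun x hx => (h1 x k (hk hx)).1⟩

end FreeGeometry

/-! ### Raising the degree of independence by products of conjugates -/

namespace FreeGeometry

open DimGeometry

variable {V : Type*} [DecidableEq V] {F : FreeGeometry V}
  {A B C D X Y Z Z' : Finset V} {a b c : V} {σ τ g : Equiv.Perm V}

theorem ind_smul_of_fix (h : F.Ind {b} C B) (hσ : σ ∈ F.fix D) (hC : C ⊆ D) (hB : B ⊆ D) :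
    F.Ind {σ b} C B := by
  have := h.smul hσ.1
  rwa [smul_of_mem_fix' hσ hC, smul_of_mem_fix' hσ hB, smul_singleton_apply] at this

theorem exists_ind_singleton (b : V) (C B : Finset V) : ∃ σ ∈ F.fix C, F.Ind {σ b} C B := by
  obtain ⟨σ, h1, h2⟩ := F.exists_ind {b} C B
  rw [smul_singleton_apply] at h2
  exact ⟨σ, h1, h2⟩

/-- One step in the construction of the conjugating element. -/
theorem exists_extension_moves {j : ℕ} (hg : g ∈ F.G) (h : F.Moves j g) (T : Finset V)
    (ha : σ ∈ F.G) (hb : F.Special X b) (hXZ : X ⊆ Z)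
    (hgX : (σ * g * σ⁻¹ * g) • X ⊆ Z) (hi : F.Ind {b} X Z) :
    ∃ α ∈ F.G, (∀ x ∈ T, α x = σ x ∧ α⁻¹ x = σ⁻¹ x) ∧
      (∀ x ∈ g • X, α⁻¹ x = σ⁻¹ x) ∧ (∀ x ∈ (g * σ⁻¹ * g) • X, α x = σ x) ∧
      ∃ τ ∈ F.fix Z, F.Ind {(α * g * α⁻¹ * g) (τ b)} ((σ * g * σ⁻¹ * g) • X) Z ∧
        F.Rel (j + 1) Z (τ b) ((α * g * α⁻¹ * g) (τ b)) := by
  have ha' := F.G.inv_mem ha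
  set X₁ := g • X with hX₁
  set X₂ := σ⁻¹ • X₁ with hX₂
  set X₃ := g • X₂ with hX₃
  have hX₃' : (g * σ⁻¹ * g) • X = X₃ := by simp only [mul_smul, hX₃, hX₂, hX₁]
  have hX₄ : (σ * g * σ⁻¹ * g) • X = σ • X₃ := by simp only [mul_smul, hX₃, hX₂, hX₁]
  rw [hX₄] at hgX ⊢
  rw [hX₃']
  -- Agreement of α with σ on D decides α and α⁻¹ on T and the whole path X, X₁, X₂, X₃, σ • X₃ of
  -- the base, and leaves α free outside cl D.
  set D := T ∪ σ⁻¹ • T ∪ X₂ ∪ X₃ with hD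
  set Zs := Z ∪ D ∪ σ • D ∪ X₁ with hZs
  obtain ⟨σ₀, hσ₀, hi₀⟩ := F.exists_ind_singleton b Z Zs
  have hi₀X : F.Ind {σ₀ b} X Zs :=
    (ind_smul_of_fix hi hσ₀ hXZ subset_rfl).trans hi₀ (subset_cl_of hXZ) (subset_cl_of (by grind))
  have hσ₀X : σ₀ • X = X := smul_of_mem_fix' hσ₀ hXZ
  have hs₀ : F.Special X (σ₀ b) := by
    have := hb.smul hσ₀.1
    rwa [hσ₀X] at this
  obtain ⟨σ₃, hσ₃, hi₃, hr₃⟩ := h X (σ₀ b) hs₀ Zs (by grind) (by grind) hi₀X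
  set b₀ := σ₃ (σ₀ b) with hb₀
  set c := g b₀ with hc
  have hsc : F.Special X₁ c := by
    have h1 := hs₀.smul hσ₃.1
    rw [smul_of_mem_fix' hσ₃ (show X ⊆ Zs by grind)] at h1
    exact h1.smul hg
  set Zss := Zs ∪ {b₀} ∪ {c} with hZss
  -- The value e of α⁻¹ at c may be any conjugate of σ⁻¹ c over D. It is taken independent from
  -- everything used so far, and then adjusted so that g moves it to degree j.
  obtain ⟨σ₁, hσ₁, hi₁⟩ := F.exists_ind_singleton (σ⁻¹ c) D Zss
  have hse₀ : F.Special X₂ (σ⁻¹ c) := hsc.smul ha'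
  have hi₁' : F.Ind {σ₁ (σ⁻¹ c)} X₂ Zss := by
    have h1 := hi₃.smul ha'
    rw [smul_singleton_apply] at h1
    have h2 : F.Ind {σ⁻¹ c} X₂ D := by
      refine h1.mono_right (subset_cl_of ?_)
      refine Finset.Subset.trans ?_ Finset.subset_union_left
      rw [← Finset.smul_finset_subset_smul_finset_iff (a := σ), smul_inv_smul]
      grind
    exact (ind_smul_of_fix h2 hσ₁ (by grind) subset_rfl).trans hi₁ (subset_cl_of (by grind))
      (subset_cl_of (by grind))
  have hse₁ : F.Special X₂ (σ₁ (σ⁻¹ c)) := by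
    have h1 := hse₀.smul hσ₁.1
    rwa [smul_of_mem_fix' hσ₁ (show X₂ ⊆ D by grind)] at h1
  obtain ⟨σ₂, hσ₂, hi₂, hr₂⟩ := h X₂ _ hse₁ Zss (by grind) (by grind) hi₁'
  set e := σ₂ (σ₁ (σ⁻¹ c)) with he
  have hμ : σ₂ * σ₁ ∈ F.fix D := (F.fix D).mul_mem (fix_mono' (by grind) hσ₂) hσ₁
  set α₁ := σ * (σ₂ * σ₁)⁻¹ with hα₁
  have hα₁G : α₁ ∈ F.G := F.G.mul_mem ha (F.G.inv_mem hμ.1)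
  have hα₁e : α₁ e = c := by
    simp [hα₁, he, Equiv.Perm.mul_apply]
  -- A last correction over c and σ • D keeps α e = c and makes b₂ = α (g e) independent from Zss
  -- over these.
  obtain ⟨ρ, hρ, hi₄⟩ := F.exists_ind_singleton (α₁ (g e)) ({c} ∪ σ • D) Zss
  set α := ρ * α₁ with hα
  have hαG : α ∈ F.G := F.G.mul_mem hρ.1 hα₁G
  have hαD : ∀ x ∈ D, α x = σ x := by
    intro x hx
    have h1 : (σ₂ * σ₁)⁻¹ x = x := ((F.fix D).inv_mem hμ).2 x (subset_cl hx)
    have h2 : ρ (σ x) = σ x :=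
      hρ.2 _ (subset_cl (Finset.mem_union_right _ (Finset.smul_mem_smul_finset hx)))
    rw [hα, hα₁, Equiv.Perm.mul_apply, Equiv.Perm.mul_apply, h1, h2]
  have hαD' : ∀ x ∈ σ • D, α⁻¹ x = σ⁻¹ x := by
    intro x hx
    rw [← Finset.inv_smul_mem_iff, Equiv.Perm.smul_def] at hx
    rw [Equiv.Perm.inv_eq_iff_eq, hαD _ hx]
    exact (σ.apply_symm_apply x).symm
  have hαe : α e = c := by
    rw [hα, Equiv.Perm.mul_apply, hα₁e, hρ.2 c (subset_cl (by grind))]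
  have hTσ : T ⊆ σ • D := by
    rw [← Finset.smul_finset_subset_smul_finset_iff (a := σ⁻¹), inv_smul_smul]
    grind
  have hX₁σ : X₁ ⊆ σ • D := by
    rw [← Finset.smul_finset_subset_smul_finset_iff (a := σ⁻¹), inv_smul_smul]
    grind
  refine ⟨α, hαG, fun x hx => ⟨hαD x (by grind), hαD' x (hTσ hx)⟩,
    fun x hx => hαD' x (hX₁σ hx), fun x hx => hαD x (by grind),
    σ₃ * σ₀, (F.fix Z).mul_mem (fix_mono' (by grind) hσ₃) hσ₀, ?_⟩
  have hαc : α⁻¹ c = e := by rw [Equiv.Perm.inv_eq_iff_eq, hαe]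
  have hh : (α * g * α⁻¹ * g) ((σ₃ * σ₀) b) = α (g e) := by
    simp only [Equiv.Perm.mul_apply]
    rw [← hb₀, ← hc, hαc]
  rw [hh, show (σ₃ * σ₀) b = b₀ from rfl]
  set b₂ := α (g e) with hb₂
  have f1 : F.Ind {b₂} ({c} ∪ σ • D) Zss := hi₄
  have hαDs : α • D = σ • D := smul_congr hαD
  have f2 : F.Rel j (σ • D) c b₂ := by
    have e1 : F.Ind {e} D Zss := ind_smul_of_fix hi₁ hσ₂ (by grind) subset_rfl
    have e2 : F.Ind {g e} D Zss := hi₂.base_mono (subset_cl_of (by grind)) (subset_cl_of (by grind))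
    have e3 := (hr₂.base_down (by grind) e1 e2).smul hαG
    rwa [hαDs, hαe] at e3
  have f3 : F.Ind {b₂} (σ • X₃) (σ • D) := by
    have e1 := (hi₂.mono_right (B' := D) (subset_cl_of (by grind))).smul hαG
    rw [smul_singleton_apply, hαDs] at e1
    rwa [smul_congr (fun x hx => hαD x (by grind) : ∀ x ∈ X₃, α x = σ x)] at e1
  have f4 : F.Ind {c} (σ • D) Zs := hi₃.base_mono (subset_cl_of hX₁σ) (subset_cl_of (by grind))
  have f5 : F.Ind ({c} ∪ {b₂}) (σ • D) Zs :=
    (f4.symm.compose (f1.symm.mono_left (subset_cl_of (by grind)))).symm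
  have f6 : F.Ind {b₂} (σ • D) Zs := f5.mono_left (subset_cl_of (by grind))
  have f7 : F.Ind {b₂} (σ • X₃) Zs :=
    f3.trans f6 (subset_cl_of (Finset.smul_finset_subset_smul_finset (by grind)))
      (subset_cl_of (by grind))
  have f8 : F.Rel j Zs c b₂ := f2.base_up (by grind) f5
  have f9 : F.Ind {b₀} ({c} ∪ Zs) {b₂} :=
    (f1.base_mono (C' := {c} ∪ Zs) (subset_cl_of (by grind)) (subset_cl_of (by grind))).symm.mono_left
      (subset_cl_of (by grind))
  -- Over Zs both steps of the path b₀, c, b₂ have degree j, and its ends are independent over c and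
  -- Zs.
  have f10 := rel_succ_of_rel hr₃ f8 f9
  refine ⟨f7.mono_right (subset_cl_of (by grind)), f10.base_down (by grind) ?_ ?_⟩
  · exact ind_smul_of_fix hi₀ hσ₃ (by grind) subset_rfl
  · exact f7.base_mono (subset_cl_of hgX) (subset_cl_of (by grind))

/-- A suitable product of two conjugates moves special points to a higher degree. -/
theorem Moves.exists_succ [Countable V] {j : ℕ} (hg : g ∈ F.G) (h : F.Moves j g) :
    ∃ α ∈ F.G, F.Moves (j + 1) (α * g * α⁻¹ * g) := by
  let P := {p : Equiv.Perm V × Finset V // p.1 ∈ F.G}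
  let le : P → P → Prop := fun p q =>
    p.1.2 ⊆ q.1.2 ∧ ∀ x ∈ p.1.2, q.1.1 x = p.1.1 x ∧ q.1.1⁻¹ x = p.1.1⁻¹ x
  let _ : Preorder P :=
    { le := le
      le_refl := fun p => ⟨subset_rfl, fun _ _ => ⟨rfl, rfl⟩⟩
      le_trans := fun p q s h1 h2 => ⟨h1.1.trans h2.1, fun x hx =>
        ⟨(h2.2 x (h1.1 hx)).1.trans (h1.2 x hx).1, (h2.2 x (h1.1 hx)).2.trans (h1.2 x hx).2⟩⟩ }
  let Q : Equiv.Perm V → Finset V × V × Finset V → Prop := fun α t =>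
    t.1 ⊆ t.2.2 → (α * g * α⁻¹ * g) • t.1 ⊆ t.2.2 → F.Ind {t.2.1} t.1 t.2.2 →
      F.Special t.1 t.2.1 → ∃ τ ∈ F.fix t.2.2,
        F.Ind {(α * g * α⁻¹ * g) (τ t.2.1)} ((α * g * α⁻¹ * g) • t.1) t.2.2 ∧
        F.Rel (j + 1) t.2.2 (τ t.2.1) ((α * g * α⁻¹ * g) (τ t.2.1))
  -- The condition at a triple quantifies over all permutations that agree with the finite
  -- approximation, so it passes to the limit. The second kind of condition makes the approximations
  -- exhaust V.
  let D : (Finset V × V × Finset V) ⊕ V → P → Prop := fun i p => match i with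
    | .inl t => ∀ α, (∀ x ∈ p.1.2, α x = p.1.1 x ∧ α⁻¹ x = p.1.1⁻¹ x) → Q α t
    | .inr v => v ∈ p.1.2
  have hD : ∀ i s, ∃ t, s ≤ t ∧ D i t := by
    rintro (⟨X, b, Z⟩ | v) ⟨⟨σ, T⟩, hσ⟩
    · have hval : ∀ α : Equiv.Perm V, (∀ x ∈ g • X, α⁻¹ x = σ⁻¹ x) →
          (∀ x ∈ (g * σ⁻¹ * g) • X, α x = σ x) →
          (α * g * α⁻¹ * g) • X = (σ * g * σ⁻¹ * g) • X := by
        intro α h1 h2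
        have e1 : α⁻¹ • g • X = σ⁻¹ • g • X := smul_congr h1
        rw [mul_smul, mul_smul, mul_smul, mul_smul, mul_smul, mul_smul, e1]
        apply smul_congr
        simpa only [mul_smul] using h2
      by_cases hyp : X ⊆ Z ∧ (σ * g * σ⁻¹ * g) • X ⊆ Z ∧ F.Ind {b} X Z ∧ F.Special X b
      · obtain ⟨α, hα, h1, h2, h3, τ, hτ, h4, h5⟩ :=
          exists_extension_moves hg h T hσ hyp.2.2.2 hyp.1 hyp.2.1 hyp.2.2.1
        refine ⟨⟨⟨α, T ∪ g • X ∪ (g * σ⁻¹ * g) • X ∪ {g (τ b)} ∪ {g (α⁻¹ (g (τ b)))}⟩, hα⟩,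
          ⟨by grind, h1⟩, ?_⟩
        intro β hβ _ _ _ _
        have e1 : (β * g * β⁻¹ * g) • X = (σ * g * σ⁻¹ * g) • X := by
          apply hval
          · intro x hx
            rw [(hβ x (by grind)).2]
            exact h2 x hx
          · intro x hx
            rw [(hβ x (by grind)).1]
            exact h3 x hx
        have e2 : (β * g * β⁻¹ * g) (τ b) = (α * g * α⁻¹ * g) (τ b) := by
          simp only [Equiv.Perm.mul_apply]
          rw [(hβ (g (τ b)) (by grind)).2, (hβ (g (α⁻¹ (g (τ b)))) (by grind)).1]
        dsimp only
        rw [e1]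
        refine ⟨τ, hτ, ?_⟩
        rw [e2]
        exact ⟨h4, h5⟩
      -- Here the hypotheses fail; recording the path of X keeps them false for every later
      -- permutation.
      · refine ⟨⟨⟨σ, T ∪ g • X ∪ (g * σ⁻¹ * g) • X⟩, hσ⟩,
          ⟨by grind, fun _ _ => ⟨rfl, rfl⟩⟩, ?_⟩
        intro β hβ h1 h2 h3 h4
        dsimp only at h1 h2 h3 h4
        rw [hval β (fun x hx => (hβ x (by grind)).2) (fun x hx => (hβ x (by grind)).1)] at h2
        exact absurd ⟨h1, h2, h3, h4⟩ hyp
    · exact ⟨⟨⟨σ, T ∪ {v}⟩, hσ⟩, ⟨by grind, fun _ _ => ⟨rfl, rfl⟩⟩, by simp [D]⟩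
  obtain ⟨u, hu, -, huD⟩ := exists_monotone_seq_meeting (P := P) ⟨⟨1, ∅⟩, F.G.one_mem⟩ D hD
  obtain ⟨β, hβ, hβu⟩ := F.exists_limit (fun k => (u k).1.1) (fun k => (u k).1.2)
    (fun k => (u k).2) (fun k l hkl => (hu hkl).2) (fun k l hkl => (hu hkl).1)
    (fun v => huD (.inr v))
  refine ⟨β, hβ, fun X b hb Z hXZ hgX hi => ?_⟩
  obtain ⟨k, hk⟩ := huD (.inl ⟨X, b, Z⟩)
  exact hk β (hβu k) hXZ hgX hi hb

end FreeGeometry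

/-! ### Moving finite sets freely and prescribing the product of two conjugates -/

namespace FreeGeometry

open DimGeometry

variable {V : Type*} [DecidableEq V] {F : FreeGeometry V}
  {A B B' C D X Y Z Z' : Finset V} {a b c : V} {σ τ g h : Equiv.Perm V}

/-- The set `B` can be moved freely over `X` by `h`. -/
def MovesFreely (F : FreeGeometry V) (h : Equiv.Perm V) (X B : Finset V) : Prop :=
  ∃ σ ∈ F.fix (X ∪ h • X), F.Ind (h • σ • B) (h • X) (X ∪ σ • B)

theorem MovesFreely.mono (hh : h ∈ F.G) (hB : F.MovesFreely h X B')
    (hsub : B ⊆ F.cl (B' ∪ X)) : F.MovesFreely h X B := by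
  obtain ⟨σ, hσ, hi⟩ := hB
  have hX : σ • X = X := smul_of_mem_fix' hσ (by grind)
  have e1 : σ • B ⊆ F.cl (σ • B' ∪ X) := by
    have := Finset.smul_finset_subset_smul_finset (a := σ) hsub
    rwa [← smul_cl hσ.1, Finset.smul_finset_union, hX] at this
  have e2 : h • σ • B ⊆ F.cl (h • σ • B' ∪ h • X) := by
    have := Finset.smul_finset_subset_smul_finset (a := h) e1
    rwa [← smul_cl hh, Finset.smul_finset_union] at this
  refine ⟨σ, hσ, (hi.mono_left e2).mono_right (Finset.union_subset (subset_cl_of (by grind)) ?_)⟩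
  exact e1.trans (cl_mono (by grind))

/-- Once B sits in a good position B₁, the new point is placed over X ∪ B₁. There `Moves 2` gives
freeness of the point from its own image, and transitivity combines this with the freeness of B₁. -/
theorem movesFreely_insert (hm : F.Moves 2 h)
    (hB : F.Ind B X (h • X) → F.MovesFreely h X B) (hb : F.Special (X ∪ B) b)
    (hi : F.Ind ({b} ∪ B) X (h • X)) : F.MovesFreely h X ({b} ∪ B) := by
  obtain ⟨σ₁, hσ₁, hi₁⟩ := hB (hi.mono_left (subset_cl_of (by grind)))
  set B₁ := σ₁ • B with hB₁
  have hX₁ : σ₁ • X = X := smul_of_mem_fix' hσ₁ (by grind)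
  have hs₁ : F.Special (X ∪ B₁) (σ₁ b) := by
    have := hb.smul hσ₁.1
    rwa [Finset.smul_finset_union, hX₁] at this
  have hj₁ : F.Ind {σ₁ b} (X ∪ B₁) (h • X) := by
    have := hi.smul hσ₁.1
    rw [Finset.smul_finset_union, smul_singleton_apply, hX₁,
      smul_of_mem_fix' hσ₁ (show h • X ⊆ _ by grind), Finset.union_comm] at this
    rw [Finset.union_comm]
    exact this.symm.decompose.2.symm
  set Z := X ∪ B₁ ∪ h • X ∪ h • B₁ with hZ
  obtain ⟨σ₂, hσ₂, hi₂⟩ := F.exists_ind_singleton (σ₁ b) (X ∪ B₁ ∪ h • X) Z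
  have hj₂ : F.Ind {σ₂ (σ₁ b)} (X ∪ B₁) Z :=
    (ind_smul_of_fix hj₁ hσ₂ (by grind) (by grind)).trans hi₂ (subset_cl_of (by grind))
      (subset_cl_of (by grind))
  have hs₂ : F.Special (X ∪ B₁) (σ₂ (σ₁ b)) := by
    have := hs₁.smul hσ₂.1
    rwa [smul_of_mem_fix' hσ₂ (show X ∪ B₁ ⊆ _ by grind)] at this
  obtain ⟨σ₃, hσ₃, hi₃, hr₃⟩ := hm (X ∪ B₁) _ hs₂ Z (by grind)
    (by rw [Finset.smul_finset_union]; grind) hj₂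
  set b₃ := σ₃ (σ₂ (σ₁ b)) with hb₃
  rw [Finset.smul_finset_union] at hi₃
  have hr₃' : F.Ind {b₃} Z {h b₃} := hr₃
  have hσ : σ₃ * σ₂ * σ₁ ∈ F.fix (X ∪ h • X) :=
    (F.fix _).mul_mem ((F.fix _).mul_mem (fix_mono' (by grind) hσ₃) (fix_mono' (by grind) hσ₂)) hσ₁
  have hσB : (σ₃ * σ₂ * σ₁) • ({b} ∪ B) = {b₃} ∪ B₁ := by
    rw [mul_smul, mul_smul, Finset.smul_finset_union, ← hB₁, Finset.smul_finset_union,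
      Finset.smul_finset_union, smul_of_mem_fix' hσ₂ (show B₁ ⊆ _ by grind),
      smul_of_mem_fix' hσ₃ (show B₁ ⊆ _ by grind)]
    simp only [smul_singleton_apply, hb₃]
  refine ⟨_, hσ, ?_⟩
  rw [hσB, Finset.smul_finset_union, smul_singleton_apply]
  have hj₃ : F.Ind {b₃} (X ∪ B₁) Z := ind_smul_of_fix hj₂ hσ₃ (by grind) subset_rfl
  have f1 : F.Ind (h • B₁) (h • X) ((X ∪ B₁) ∪ {b₃}) := by
    refine hi₁.compose ?_
    exact ((hj₃.base_mono (C' := X ∪ B₁ ∪ h • X) (subset_cl_of (by grind))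
      (subset_cl_of (by grind))).mono_right (subset_cl_of (by grind))).symm
  have f2 : F.Ind {h b₃} (h • X ∪ h • B₁) (Z ∪ {b₃}) := by
    refine hi₃.compose ?_
    rw [show Z ∪ (h • X ∪ h • B₁) = Z by grind]
    exact hr₃'.symm
  have f3 : F.Ind ((X ∪ B₁) ∪ {b₃}) (h • X) (h • B₁ ∪ {h b₃}) := by
    refine f1.symm.compose ?_
    rw [Finset.union_comm (h • B₁)]
    exact f2.symm.mono_left (subset_cl_of (by grind))
  exact (f3.mono_left (subset_cl_of (by grind))).symm.mono_left (subset_cl_of (by grind))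

/-- An automorphism moving special points freely moves all finite sets freely. -/
theorem movesFreely_of_moves (hh : h ∈ F.G) (hm : F.Moves 2 h)
    (hdec : ∀ X b, b ∉ F.cl X → F.Special X b ∨ ∃ c, F.Special X c ∧ F.Special ({c} ∪ X) b)
    (X B : Finset V) (hi : F.Ind B X (h • X)) : F.MovesFreely h X B := by
  induction B using Finset.induction_on with
  | empty => exact ⟨1, (F.fix _).one_mem, by
      simpa using (ind_of_subset_right (Finset.empty_subset _)).symm⟩
  | insert b B _ ih =>
    rw [Finset.insert_eq] at hi ⊢
    by_cases hb : b ∈ F.cl (X ∪ B)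
    · refine (ih (hi.mono_left (subset_cl_of (by grind)))).mono hh ?_
      refine Finset.union_subset ?_ (subset_cl_of (by grind))
      rw [Finset.union_comm]
      simpa using hb
    rcases hdec _ _ hb with hs | ⟨c, hc, hcb⟩
    · exact movesFreely_insert hm ih hs hi
    -- The intermediate point is conjugated over b, B and X so that the enlarged set stays
    -- independent from h • X. After the two insertions it is dropped again by `MovesFreely.mono`.
    · obtain ⟨ρ, hρ, hj⟩ := F.exists_ind_singleton c ({b} ∪ B ∪ X) (h • X)
      have hρX : ρ • (X ∪ B) = X ∪ B := smul_of_mem_fix' hρ (by grind)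
      have h1 : F.Special (X ∪ B) (ρ c) := by
        have := hc.smul hρ.1
        rwa [hρX] at this
      have h2 : F.Special (X ∪ ({ρ c} ∪ B)) b := by
        have := hcb.smul hρ.1
        rw [Finset.smul_finset_union, hρX, smul_singleton_apply,
          hρ.2 b (subset_cl (by grind))] at this
        convert this using 1
        grind
      have h3 : F.Ind ({b} ∪ ({ρ c} ∪ B)) X (h • X) :=
        (hi.symm.compose hj.symm).symm.mono_left (subset_cl_of (by grind))
      have h4 := movesFreely_insert hm (movesFreely_insert hm ih h1) h2 h3
      exact h4.mono hh (subset_cl_of (by grind))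

/-- All finite sets that are independent from the image of the base are moved freely. -/
def MovesAll (F : FreeGeometry V) (h : Equiv.Perm V) : Prop :=
  ∀ X B, F.Ind B X (h • X) → F.MovesFreely h X B

theorem MovesAll.conj (hh : F.MovesAll h) (hτ : τ ∈ F.G) : F.MovesAll (τ * h * τ⁻¹) := by
  intro X B hi
  have hτ' := F.G.inv_mem hτ
  have hi' := hi.smul hτ'
  simp only [mul_smul, inv_smul_smul] at hi'
  obtain ⟨σ, hσ, hj⟩ := hh _ _ hi'
  refine ⟨τ * σ * τ⁻¹, ?_, ?_⟩
  · have := conj_mem_fix hσ hτ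
    simpa only [Finset.smul_finset_union, mul_smul, smul_inv_smul] using this
  · have := hj.smul hτ
    simpa only [Finset.smul_finset_union, mul_smul, smul_inv_smul, inv_smul_smul] using this

/-- Extending a chain of two conjugates: the composition of the two maps can be prescribed on a
larger set, provided that the prescribed image is free. -/
theorem exists_conj_pair {γ₁ γ₂ v : Equiv.Perm V} {P₀ P₁ P₂ B₀ : Finset V}
    (h₁ : γ₁ ∈ F.G) (h₂ : γ₂ ∈ F.G) (m₁ : F.MovesAll γ₁) (m₂ : F.MovesAll γ₂)
    (e₁ : γ₁ • P₀ = P₁) (e₂ : γ₂ • P₁ = P₂) (hi : F.Ind P₀ P₁ P₂)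
    (hv : v ∈ F.G) (hvP : ∀ x ∈ F.cl P₀, v x = γ₂ (γ₁ x))
    (hvB : F.Ind (v • B₀) P₂ (P₀ ∪ P₁ ∪ B₀)) :
    ∃ τ₁ ∈ F.fix (P₀ ∪ P₁), ∃ τ₂ ∈ F.fix (P₁ ∪ P₂),
      ∀ x ∈ B₀, (τ₂ * γ₂ * τ₂⁻¹) ((τ₁ * γ₁ * τ₁⁻¹) x) = v x := by
  set X := P₀ ∪ P₁ with hX
  set T := P₂ ∪ v • B₀ ∪ B₀ with hT
  -- Q is the image of P₁ under the first map. It has to be free from P₂, v • B₀ and B₀ over X,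
  -- because the image of B₀ is going to be free only over P₁ ∪ Q.
  obtain ⟨τa, hτa, ha⟩ := F.exists_ind (γ₁ • P₁) X T
  set Q := τa • γ₁ • P₁ with hQ
  set γa := τa * γ₁ * τa⁻¹ with hγa
  have hτa' := (F.fix X).inv_mem hτa
  have ea₁ : γa • P₀ = P₁ := by
    rw [hγa, mul_smul, mul_smul, smul_of_mem_fix' hτa' (by grind), e₁,
      smul_of_mem_fix' hτa (by grind)]
  have ea₂ : γa • P₁ = Q := by
    rw [hγa, mul_smul, mul_smul, smul_of_mem_fix' hτa' (by grind)]
  have eaX : γa • X = P₁ ∪ Q := by rw [hX, Finset.smul_finset_union, ea₁, ea₂]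
  have hγaG : γa ∈ F.G := F.G.mul_mem (F.G.mul_mem hτa.1 h₁) hτa'.1
  obtain ⟨σ, hσ, hb⟩ := m₁.conj hτa.1 X B₀ (by
    rw [← hγa, eaX]
    exact (ha.symm.mono_left (subset_cl_of (by grind))).mono_right (subset_cl_of (by grind)))
  rw [← hγa, eaX] at hσ hb
  have hσ' := (F.fix _).inv_mem hσ
  have hb' : F.Ind (σ⁻¹ • γa • σ • B₀) (P₁ ∪ Q) (X ∪ B₀) := by
    have := hb.smul hσ'.1
    rwa [smul_of_mem_fix' (X := P₁ ∪ Q) hσ' (by grind), Finset.smul_finset_union, inv_smul_smul,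
      smul_of_mem_fix' (X := X) hσ' (by grind)] at this
  obtain ⟨ρ, hρ, hc⟩ := F.exists_ind (σ⁻¹ • γa • σ • B₀) (X ∪ Q ∪ B₀) T
  set B₁ := ρ • σ⁻¹ • γa • σ • B₀ with hB₁
  have hρ' := (F.fix _).inv_mem hρ
  have hc' : F.Ind B₁ (P₁ ∪ Q) (X ∪ B₀) := by
    have := hb'.smul hρ.1
    rwa [smul_of_mem_fix' (X := P₁ ∪ Q) hρ (by grind),
      smul_of_mem_fix' (X := X ∪ B₀) hρ (by grind)] at this
  have hd : F.Ind B₁ (P₁ ∪ Q) T :=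
    (hc'.mono_right (B' := X ∪ Q ∪ B₀) (subset_cl_of (by grind))).trans hc
      (subset_cl_of (by grind)) (subset_cl_of (by grind))
  set τ₁ := ρ * σ⁻¹ * τa with hτ₁
  have hτ₁X : τ₁ ∈ F.fix X :=
    (F.fix X).mul_mem ((F.fix X).mul_mem (fix_mono' (by grind) hρ) (fix_mono' (by grind) hσ')) hτa
  have hτ₁X' := (F.fix X).inv_mem hτ₁X
  set γ := τ₁ * γ₁ * τ₁⁻¹ with hγ
  have hγG : γ ∈ F.G := F.G.mul_mem (F.G.mul_mem hτ₁X.1 h₁) hτ₁X'.1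
  have hγB : γ • B₀ = B₁ := by
    have : γ = ρ * σ⁻¹ * γa * σ * ρ⁻¹ := by rw [hγ, hτ₁, hγa]; group
    rw [this]
    simp only [mul_smul]
    rw [smul_of_mem_fix' hρ' (by grind)]
  have i1 : F.Ind P₂ P₁ (P₀ ∪ Q) :=
    hi.symm.compose (ha.symm.mono_left (subset_cl_of (by grind)))
  -- This is what the second map needs in order to move B₁ freely, as P₂ = γ₂ • P₁.
  have I : F.Ind B₁ P₁ P₂ := by
    have j1 : F.Ind P₂ P₁ Q := i1.mono_right (subset_cl_of (by grind))
    have j2 : F.Ind P₂ (Q ∪ P₁) B₁ := by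
      rw [Finset.union_comm]
      exact hd.symm.mono_left (subset_cl_of (by grind))
    exact (j1.compose j2).symm.mono_left (subset_cl_of (by grind))
  have II : F.Ind T (X ∪ B₀) B₁ := by
    have j1 : F.Ind T (X ∪ B₀) Q :=
      (ha.base_mono (C' := X ∪ B₀) (subset_cl_of (by grind)) (subset_cl_of (by grind))).symm
    have j2 : F.Ind T (Q ∪ (X ∪ B₀)) B₁ := by
      rw [show Q ∪ (X ∪ B₀) = X ∪ Q ∪ B₀ by grind]
      exact hc.symm
    exact (j1.compose j2).mono_right (subset_cl_of (by grind))
  have III : F.Ind (v • B₀) P₂ (P₁ ∪ B₁) := by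
    have j1 : F.Ind B₁ (X ∪ B₀) (P₂ ∪ v • B₀) := II.symm.mono_right (subset_cl_of (by grind))
    have j2 : F.Ind (v • B₀) ((X ∪ B₀) ∪ P₂) B₁ := by
      rw [Finset.union_comm]
      exact j1.decompose.2.symm
    exact (hvB.compose j2).mono_right (subset_cl_of (by grind))
  obtain ⟨σ', hσ₂, hk⟩ := m₂ P₁ B₁ (by rw [e₂]; exact I)
  rw [e₂] at hσ₂ hk
  have hσ₂' := (F.fix _).inv_mem hσ₂
  set E := σ'⁻¹ • γ₂ • σ' • B₁ with hE
  have hEi : F.Ind E P₂ (P₁ ∪ B₁) := by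
    have := hk.smul hσ₂'.1
    rwa [smul_of_mem_fix' (X := P₂) hσ₂' (by grind), Finset.smul_finset_union, inv_smul_smul,
      smul_of_mem_fix' (X := P₁) hσ₂' (by grind)] at this
  -- θ carries the image E of B₁ under the second map to its prescribed place v • B₀ and fixes cl
  -- P₂. Both sets are free from P₁ ∪ B₁ over P₂, so stationarity replaces θ by an element that
  -- fixes P₁ ∪ B₁ too.
  set θ := v * γ⁻¹ * (σ'⁻¹ * γ₂ * σ')⁻¹ with hθ
  have hθE : θ • E = v • B₀ := by
    have : θ = v * γ⁻¹ * σ'⁻¹ * γ₂⁻¹ * σ' := by rw [hθ]; group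
    rw [this, hE]
    simp only [mul_smul, smul_inv_smul, inv_smul_smul]
    rw [← hγB, inv_smul_smul]
  have hθ₂ : θ ∈ F.fix P₂ := by
    refine ⟨F.G.mul_mem (F.G.mul_mem hv (F.G.inv_mem hγG)) (F.G.inv_mem
      (F.G.mul_mem (F.G.mul_mem hσ₂'.1 h₂) hσ₂.1)), fun p hp => ?_⟩
    have hp' : p ∈ γ₂ • γ₁ • F.cl P₀ := by
      rwa [← smul_cl h₁, e₁, ← smul_cl h₂, e₂]
    obtain ⟨y, hy, rfl⟩ := Finset.mem_smul_finset.1 hp'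
    obtain ⟨x, hx, rfl⟩ := Finset.mem_smul_finset.1 hy
    have hy₁ : γ₁ x ∈ F.cl P₁ := by rwa [← e₁, smul_cl h₁]
    have t1 : (σ'⁻¹ * γ₂ * σ')⁻¹ (γ₂ (γ₁ x)) = γ₁ x := by
      rw [Equiv.Perm.inv_eq_iff_eq]
      simp only [Equiv.Perm.mul_apply]
      rw [hσ₂.2 (γ₁ x) (cl_mono (by grind) hy₁)]
      exact (hσ₂'.2 _ (cl_mono (by grind) hp)).symm
    have t2 : γ⁻¹ (γ₁ x) = x := by
      rw [Equiv.Perm.inv_eq_iff_eq, hγ]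
      simp only [Equiv.Perm.mul_apply]
      rw [hτ₁X'.2 x (cl_mono (by grind) hx), hτ₁X.2 _ (cl_mono (by grind) hy₁)]
    change θ (γ₂ (γ₁ x)) = γ₂ (γ₁ x)
    rw [hθ, Equiv.Perm.mul_apply, Equiv.Perm.mul_apply, t1, t2, hvP x hx]
  obtain ⟨ρ', hρ₂, hρE⟩ := F.stationary E P₂ (P₁ ∪ B₁) θ hθ₂ hEi (by rw [hθE]; exact III)
  have hρ₂' := (F.fix _).inv_mem hρ₂
  refine ⟨τ₁, hτ₁X, ρ' * σ'⁻¹, (F.fix _).mul_mem (fix_mono' (by grind) hρ₂) hσ₂', ?_⟩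
  intro x hx
  have hy : γ x ∈ B₁ := by
    rw [← hγB]
    exact Finset.smul_mem_smul_finset hx
  have hyE : (σ'⁻¹ * γ₂ * σ') (γ x) ∈ E := by
    rw [hE, ← mul_smul, ← mul_smul]
    exact Finset.smul_mem_smul_finset hy
  rw [← hγ]
  have t1 : (ρ' * σ'⁻¹ * γ₂ * (ρ' * σ'⁻¹)⁻¹) (γ x) = ρ' ((σ'⁻¹ * γ₂ * σ') (γ x)) := by
    rw [mul_inv_rev, inv_inv]
    simp only [Equiv.Perm.mul_apply]
    rw [hρ₂'.2 _ (subset_cl (by grind))]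
  rw [t1, hρE _ hyE, hθ]
  simp

end FreeGeometry

/-! ### Chains of four conjugates -/

namespace FreeGeometry

open DimGeometry

variable {V : Type*} [DecidableEq V] {F : FreeGeometry V}
  {A B B' C D X Y Z Z' : Finset V} {a b c : V} {σ τ g h : Equiv.Perm V}

/-- A finite chain `Y₀ → Y₁ → Y₂ ← Y₃ ← Y₄` of sets mapped to each other by conjugates of `h`. -/
structure Chain (F : FreeGeometry V) (h : Equiv.Perm V) where
  /-- the conjugating elements -/
  a : Fin 4 → Equiv.Perm V
  /-- the finite sets of the chain -/
  Y : Fin 5 → Finset V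
  mem : ∀ i, a i ∈ F.G
  map₀ : (a 0 * h * (a 0)⁻¹) • Y 0 = Y 1
  map₁ : (a 1 * h * (a 1)⁻¹) • Y 1 = Y 2
  map₂ : (a 2 * h * (a 2)⁻¹) • Y 3 = Y 2
  map₃ : (a 3 * h * (a 3)⁻¹) • Y 4 = Y 3

namespace Chain

variable {s t u : Chain F h}

/-- The conjugates of `h` in the chain. -/
def conj (s : Chain F h) (i : Fin 4) : Equiv.Perm V := s.a i * h * (s.a i)⁻¹

/-- The composition of the maps from the left end to the middle. -/
def left (s : Chain F h) : Equiv.Perm V := s.conj 1 * s.conj 0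

/-- The composition of the maps from the right end to the middle. -/
def right (s : Chain F h) : Equiv.Perm V := s.conj 2 * s.conj 3

/-- The independence conditions under which a chain can be extended. -/
def Good (s : Chain F h) : Prop := F.Ind (s.Y 0) (s.Y 1) (s.Y 2) ∧ F.Ind (s.Y 4) (s.Y 3) (s.Y 2)

/-- The finite set on which the map with index `i` has been decided. -/
def base (s : Chain F h) (i : Fin 4) : Finset V := s.Y i.castSucc ∪ s.Y i.succ

/-- The chain `t` extends `s`. -/
def Ext (s t : Chain F h) : Prop :=
  (∀ i, ∃ τ ∈ F.fix (s.base i), t.a i = τ * s.a i) ∧ ∀ j, s.Y j ⊆ t.Y j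

theorem conj_mem (hh : h ∈ F.G) (s : Chain F h) (i : Fin 4) : s.conj i ∈ F.G :=
  F.G.mul_mem (F.G.mul_mem (s.mem i) hh) (F.G.inv_mem (s.mem i))

theorem left_mem (hh : h ∈ F.G) (s : Chain F h) : s.left ∈ F.G :=
  F.G.mul_mem (s.conj_mem hh 1) (s.conj_mem hh 0)

theorem right_mem (hh : h ∈ F.G) (s : Chain F h) : s.right ∈ F.G :=
  F.G.mul_mem (s.conj_mem hh 2) (s.conj_mem hh 3)

theorem left_smul (s : Chain F h) : s.left • s.Y 0 = s.Y 2 := by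
  rw [left, mul_smul, conj, conj, s.map₀, s.map₁]

theorem right_smul (s : Chain F h) : s.right • s.Y 4 = s.Y 2 := by
  rw [right, mul_smul, conj, conj, s.map₃, s.map₂]

theorem base_mono (hst : s.Ext t) (i : Fin 4) : s.base i ⊆ t.base i :=
  Finset.union_subset_union (hst.2 _) (hst.2 _)

theorem ext_refl (s : Chain F h) : s.Ext s :=
  ⟨fun _ => ⟨1, (F.fix _).one_mem, (one_mul _).symm⟩, fun _ => subset_rfl⟩

theorem Ext.trans (h1 : s.Ext t) (h2 : t.Ext u) : s.Ext u := by
  refine ⟨fun i => ?_, fun j => (h1.2 j).trans (h2.2 j)⟩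
  obtain ⟨τ₁, hτ₁, e1⟩ := h1.1 i
  obtain ⟨τ₂, hτ₂, e2⟩ := h2.1 i
  exact ⟨τ₂ * τ₁, (F.fix _).mul_mem (fix_mono' (base_mono h1 i) hτ₂) hτ₁, by
    rw [e2, e1, mul_assoc]⟩

/-- The points at which the conjugating elements have been decided in both directions. -/
def Settled (s : Chain F h) (x : V) : Prop := ∀ i, x ∈ s.base i ∧ s.a i x ∈ s.base i

/-- An extension multiplies each conjugating element on the left by something fixing the base: a
decided image protects the forward value, and a decided point protects the inverse. -/
theorem Ext.a_eq (hst : s.Ext t) {x : V} (hx : s.Settled x) (i : Fin 4) :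
    t.a i x = s.a i x ∧ (t.a i)⁻¹ x = (s.a i)⁻¹ x := by
  obtain ⟨τ, hτ, e⟩ := hst.1 i
  rw [e]
  refine ⟨hτ.2 _ (subset_cl (hx i).2), ?_⟩
  rw [mul_inv_rev, Equiv.Perm.mul_apply, ((F.fix _).inv_mem hτ).2 _ (subset_cl (hx i).1)]

theorem Ext.settled (hst : s.Ext t) {x : V} (hx : s.Settled x) : t.Settled x := fun i =>
  ⟨base_mono hst i (hx i).1, by rw [(hst.a_eq hx i).1]; exact base_mono hst i (hx i).2⟩

theorem Ext.conj_eq (hst : s.Ext t) {x : V} {i : Fin 4} (hx : x ∈ F.cl (s.base i))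
    (hx' : s.conj i x ∈ F.cl (s.base i)) : t.conj i x = s.conj i x := by
  obtain ⟨τ, hτ, e⟩ := hst.1 i
  have e' : t.conj i = τ * s.conj i * τ⁻¹ := by rw [conj, conj, e]; group
  rw [e', Equiv.Perm.mul_apply, Equiv.Perm.mul_apply, ((F.fix _).inv_mem hτ).2 _ hx, hτ.2 _ hx']

theorem mem_of_smul_eq {σ : Equiv.Perm V} (hσ : σ ∈ F.G) (e : σ • X = Y) {x : V}
    (hx : x ∈ F.cl X) : σ x ∈ F.cl Y := by
  rw [← e, smul_cl hσ]
  exact Finset.smul_mem_smul_finset hx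

theorem Ext.left_eq (hh : h ∈ F.G) (hst : s.Ext t) {x : V} (hx : x ∈ F.cl (s.Y 0)) :
    t.left x = s.left x := by
  have h1 := mem_of_smul_eq (s.conj_mem hh 0) s.map₀ hx
  have h2 := mem_of_smul_eq (s.conj_mem hh 1) s.map₁ h1
  have e1 : t.conj 0 x = s.conj 0 x :=
    hst.conj_eq (cl_mono Finset.subset_union_left hx) (cl_mono Finset.subset_union_right h1)
  rw [left, left, Equiv.Perm.mul_apply, Equiv.Perm.mul_apply, e1]
  exact hst.conj_eq (cl_mono Finset.subset_union_left h1) (cl_mono Finset.subset_union_right h2)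

theorem Ext.right_eq (hh : h ∈ F.G) (hst : s.Ext t) {x : V} (hx : x ∈ F.cl (s.Y 4)) :
    t.right x = s.right x := by
  have h1 := mem_of_smul_eq (s.conj_mem hh 3) s.map₃ hx
  have h2 := mem_of_smul_eq (s.conj_mem hh 2) s.map₂ h1
  have e1 : t.conj 3 x = s.conj 3 x :=
    hst.conj_eq (cl_mono Finset.subset_union_right hx) (cl_mono Finset.subset_union_left h1)
  rw [right, right, Equiv.Perm.mul_apply, Equiv.Perm.mul_apply, e1]
  exact hst.conj_eq (cl_mono Finset.subset_union_right h1) (cl_mono Finset.subset_union_left h2)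

/-- A chain can be enlarged to a good chain that settles a given finite set. -/
theorem exists_good (hh : h ∈ F.G) (s : Chain F h) (T : Finset V) :
    ∃ t : Chain F h, s.Ext t ∧ t.Good ∧ F.cl (t.Y 0) = t.Y 0 ∧ F.cl (t.Y 4) = t.Y 4 ∧
      (∀ x ∈ T, t.Settled x) ∧ T ⊆ t.Y 0 := by
  have hG := s.conj_mem hh
  have hG' : ∀ i, (s.conj i)⁻¹ ∈ F.G := fun i => F.G.inv_mem (hG i)
  set T₁ := T ∪ s.conj 0 • T ∪ Finset.univ.biUnion fun i => s.a i • T with hT₁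
  set W := T₁ ∪ Finset.univ.biUnion s.Y with hW
  have hYW : ∀ j, s.Y j ⊆ W := fun j =>
    (Finset.subset_biUnion_of_mem s.Y (Finset.mem_univ j)).trans Finset.subset_union_right
  -- The chain is rebuilt from its middle outwards: Y₂ is so large that its preimages Y₁ and Y₃
  -- contain W. The outer sets are then made independent from Y₂ by elements fixing Y₁ and Y₃, which
  -- disturbs nothing decided before.
  set Y₂ := F.cl (s.conj 1 • W ∪ s.conj 2 • W) with hY₂
  set Y₁ := (s.conj 1)⁻¹ • Y₂ with hY₁
  set Y₃ := (s.conj 2)⁻¹ • Y₂ with hY₃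
  have hW₁ : W ⊆ Y₁ := by
    rw [hY₁, ← Finset.smul_finset_subset_smul_finset_iff (a := s.conj 1), smul_inv_smul]
    exact subset_cl_of Finset.subset_union_left
  have hW₃ : W ⊆ Y₃ := by
    rw [hY₃, ← Finset.smul_finset_subset_smul_finset_iff (a := s.conj 2), smul_inv_smul]
    exact subset_cl_of Finset.subset_union_right
  have hc₁ : F.cl Y₁ = Y₁ := by rw [hY₁, smul_cl (hG' 1), hY₂, cl_cl]
  have hc₃ : F.cl Y₃ = Y₃ := by rw [hY₃, smul_cl (hG' 2), hY₂, cl_cl]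
  obtain ⟨τ₀, hτ₀, hi₀⟩ := F.exists_ind ((s.conj 0)⁻¹ • Y₁) Y₁ Y₂
  obtain ⟨τ₃, hτ₃, hi₃⟩ := F.exists_ind ((s.conj 3)⁻¹ • Y₃) Y₃ Y₂
  have hτ₀' := (F.fix _).inv_mem hτ₀
  have hτ₃' := (F.fix _).inv_mem hτ₃
  have hx₀ : ∀ x ∈ Y₁, τ₀ x = x := fun x hx => hτ₀.2 x (subset_cl hx)
  have hx₃ : ∀ x ∈ Y₃, τ₃ x = x := fun x hx => hτ₃.2 x (subset_cl hx)
  let t : Chain F h :=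
    { a := ![τ₀ * s.a 0, s.a 1, s.a 2, τ₃ * s.a 3]
      Y := ![τ₀ • (s.conj 0)⁻¹ • Y₁, Y₁, Y₂, Y₃, τ₃ • (s.conj 3)⁻¹ • Y₃]
      mem := by
        intro i
        fin_cases i
        · exact F.G.mul_mem hτ₀.1 (s.mem 0)
        · exact s.mem 1
        · exact s.mem 2
        · exact F.G.mul_mem hτ₃.1 (s.mem 3)
      map₀ := by
        have e : τ₀ * s.a 0 * h * (τ₀ * s.a 0)⁻¹ = τ₀ * s.conj 0 * τ₀⁻¹ := by
          rw [conj]; group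
        change (τ₀ * s.a 0 * h * (τ₀ * s.a 0)⁻¹) • τ₀ • (s.conj 0)⁻¹ • Y₁ = Y₁
        rw [e]
        simp only [mul_smul, inv_smul_smul, smul_inv_smul]
        exact smul_of_mem_fix' hτ₀ subset_rfl
      map₁ := smul_inv_smul (s.conj 1) Y₂
      map₂ := smul_inv_smul (s.conj 2) Y₂
      map₃ := by
        have e : τ₃ * s.a 3 * h * (τ₃ * s.a 3)⁻¹ = τ₃ * s.conj 3 * τ₃⁻¹ := by
          rw [conj]; group
        change (τ₃ * s.a 3 * h * (τ₃ * s.a 3)⁻¹) • τ₃ • (s.conj 3)⁻¹ • Y₃ = Y₃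
        rw [e]
        simp only [mul_smul, inv_smul_smul, smul_inv_smul]
        exact smul_of_mem_fix' hτ₃ subset_rfl }
  have hsub₀ : ∀ X : Finset V, X ⊆ Y₁ → s.conj 0 • X ⊆ Y₁ → X ⊆ τ₀ • (s.conj 0)⁻¹ • Y₁ := by
    intro X h1 h2
    rw [← smul_of_mem_fix' hτ₀ h1, Finset.smul_finset_subset_smul_finset_iff,
      ← Finset.smul_finset_subset_smul_finset_iff (a := s.conj 0), smul_inv_smul]
    exact h2
  have hsub₄ : s.Y 4 ⊆ τ₃ • (s.conj 3)⁻¹ • Y₃ := by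
    have h1 : s.Y 4 ⊆ Y₃ := (hYW 4).trans hW₃
    conv_lhs => rw [← smul_of_mem_fix' hτ₃ h1]
    rw [Finset.smul_finset_subset_smul_finset_iff,
      ← Finset.smul_finset_subset_smul_finset_iff (a := s.conj 3), smul_inv_smul]
    exact (s.map₃.le.trans (hYW 3)).trans hW₃
  have hTW : T ⊆ W := by grind
  have haW : ∀ i, ∀ x ∈ T, s.a i x ∈ W := by
    intro i x hx
    apply Finset.mem_union_left
    apply Finset.mem_union_right
    rw [Finset.mem_biUnion]
    exact ⟨i, Finset.mem_univ _, Finset.smul_mem_smul_finset hx⟩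
  refine ⟨t, ⟨?_, ?_⟩, ⟨hi₀, hi₃⟩, ?_, ?_, ?_, ?_⟩
  · intro i
    fin_cases i
    · exact ⟨τ₀, fix_mono' (Finset.union_subset ((hYW 0).trans hW₁) ((hYW 1).trans hW₁)) hτ₀, rfl⟩
    · exact ⟨1, (F.fix _).one_mem, (one_mul _).symm⟩
    · exact ⟨1, (F.fix _).one_mem, (one_mul _).symm⟩
    · exact ⟨τ₃, fix_mono' (Finset.union_subset ((hYW 3).trans hW₃) ((hYW 4).trans hW₃)) hτ₃, rfl⟩
  · intro j
    fin_cases j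
    · exact hsub₀ _ ((hYW 0).trans hW₁) ((s.map₀.le.trans (hYW 1)).trans hW₁)
    · exact (hYW 1).trans hW₁
    · refine s.map₁.ge.trans (subset_cl_of ?_)
      exact (Finset.smul_finset_subset_smul_finset (hYW 1)).trans Finset.subset_union_left
    · exact (hYW 3).trans hW₃
    · exact hsub₄
  · change F.cl (τ₀ • (s.conj 0)⁻¹ • Y₁) = τ₀ • (s.conj 0)⁻¹ • Y₁
    rw [smul_cl hτ₀.1, smul_cl (hG' 0), hc₁]
  · change F.cl (τ₃ • (s.conj 3)⁻¹ • Y₃) = τ₃ • (s.conj 3)⁻¹ • Y₃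
    rw [smul_cl hτ₃.1, smul_cl (hG' 3), hc₃]
  · intro x hx i
    have hxW := hTW hx
    have haxW := haW i x hx
    fin_cases i
    · refine ⟨Finset.mem_union_right _ (hW₁ hxW), Finset.mem_union_right _ ?_⟩
      change τ₀ (s.a 0 x) ∈ Y₁
      rw [hx₀ (s.a 0 x) (hW₁ haxW)]
      exact hW₁ haxW
    · exact ⟨Finset.mem_union_left _ (hW₁ hxW), Finset.mem_union_left _ (hW₁ haxW)⟩
    · exact ⟨Finset.mem_union_right _ (hW₃ hxW), Finset.mem_union_right _ (hW₃ haxW)⟩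
    · refine ⟨Finset.mem_union_left _ (hW₃ hxW), Finset.mem_union_left _ ?_⟩
      change τ₃ (s.a 3 x) ∈ Y₃
      rw [hx₃ (s.a 3 x) (hW₃ haxW)]
      exact hW₃ haxW
  · exact hsub₀ _ (hTW.trans hW₁) (Finset.Subset.trans (by grind) hW₁)

/-- A good chain can be extended so that its composition realizes a prescribed map. -/
theorem exists_extension (hh : h ∈ F.G) (hm : F.MovesAll h) (s : Chain F h) (hs : s.Good)
    {v : Equiv.Perm V} (hv : v ∈ F.G) (hvs : ∀ x ∈ F.cl (s.Y 0), s.right (v x) = s.left x)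
    (hB : s.Y 0 ⊆ B) :
    ∃ t : Chain F h, s.Ext t ∧ t.Y 0 = B ∧ ∀ x ∈ B, t.right (v x) = t.left x := by
  have hG := s.conj_mem hh
  have hvY : v • s.Y 0 = s.Y 4 := by
    have h1 : (s.right * v) • s.Y 0 = s.left • s.Y 0 :=
      smul_congr fun x hx => hvs x (subset_cl hx)
    rw [mul_smul, s.left_smul, ← s.right_smul] at h1
    exact smul_left_cancel _ h1
  -- Both halves are to meet at vL • B, a copy of s.left • B that is free over the middle set. The
  -- left half realizes vL on B and the right half realizes vL * v⁻¹ on v • B.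
  obtain ⟨ρ, hρ, hi⟩ := F.exists_ind (s.left • B) (s.Y 2)
    (s.Y 0 ∪ s.Y 1 ∪ B ∪ (s.Y 4 ∪ s.Y 3 ∪ v • B))
  rw [← mul_smul] at hi
  set vL := ρ * s.left with hvL
  have hvLG : vL ∈ F.G := F.G.mul_mem hρ.1 (s.left_mem hh)
  have hvL0 : ∀ x ∈ F.cl (s.Y 0), vL x = s.left x := fun x hx =>
    hρ.2 _ (mem_of_smul_eq (s.left_mem hh) s.left_smul hx)
  obtain ⟨τ₀, hτ₀, τ₁, hτ₁, h1⟩ := exists_conj_pair (B₀ := B) (hG 0) (hG 1)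
    (hm.conj (s.mem 0)) (hm.conj (s.mem 1)) s.map₀ s.map₁ hs.1 hvLG hvL0
    (hi.mono_right (subset_cl_of (by grind)))
  have hvR : ∀ x ∈ F.cl (s.Y 4), (vL * v⁻¹) x = s.conj 2 (s.conj 3 x) := by
    intro x hx
    have hx' : v⁻¹ x ∈ F.cl (s.Y 0) := by
      apply mem_of_smul_eq (F.G.inv_mem hv) _ hx
      rw [← hvY, inv_smul_smul]
    rw [Equiv.Perm.mul_apply, hvL0 _ hx', ← hvs _ hx']
    simp [right]
  have hvRB : (vL * v⁻¹) • (v • B) = vL • B := by rw [mul_smul, inv_smul_smul]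
  obtain ⟨τ₃, hτ₃, τ₂, hτ₂, h2⟩ := exists_conj_pair (B₀ := v • B) (hG 3) (hG 2)
    (hm.conj (s.mem 3)) (hm.conj (s.mem 2)) s.map₃ s.map₂ hs.2 (F.G.mul_mem hvLG (F.G.inv_mem hv))
    hvR (by rw [hvRB]; exact hi.mono_right (subset_cl_of (by grind)))
  have e : ∀ (τ : Equiv.Perm V) i, τ * s.a i * h * (τ * s.a i)⁻¹ = τ * s.conj i * τ⁻¹ := by
    intro τ i; rw [conj]; group
  let t : Chain F h :=
    { a := ![τ₀ * s.a 0, τ₁ * s.a 1, τ₂ * s.a 2, τ₃ * s.a 3]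
      Y := ![B, (τ₀ * s.conj 0 * τ₀⁻¹) • B, vL • B, (τ₃ * s.conj 3 * τ₃⁻¹) • v • B, v • B]
      mem := by
        intro i
        fin_cases i
        · exact F.G.mul_mem hτ₀.1 (s.mem 0)
        · exact F.G.mul_mem hτ₁.1 (s.mem 1)
        · exact F.G.mul_mem hτ₂.1 (s.mem 2)
        · exact F.G.mul_mem hτ₃.1 (s.mem 3)
      map₀ := by
        change (τ₀ * s.a 0 * h * (τ₀ * s.a 0)⁻¹) • B = _
        rw [e]; rfl
      map₁ := by
        change (τ₁ * s.a 1 * h * (τ₁ * s.a 1)⁻¹) • (τ₀ * s.conj 0 * τ₀⁻¹) • B = vL • B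
        rw [e, ← mul_smul]
        exact smul_congr h1
      map₂ := by
        change (τ₂ * s.a 2 * h * (τ₂ * s.a 2)⁻¹) • (τ₃ * s.conj 3 * τ₃⁻¹) • v • B = vL • B
        rw [e, ← hvRB, ← mul_smul]
        exact smul_congr h2
      map₃ := by
        change (τ₃ * s.a 3 * h * (τ₃ * s.a 3)⁻¹) • v • B = _
        rw [e]; rfl }
  have hl : ∀ x ∈ B, t.left x = vL x := by
    intro x hx
    rw [← h1 x hx, ← e, ← e]
    rfl
  have hr : ∀ x ∈ B, t.right (v x) = vL x := by
    intro x hx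
    have h3 := h2 (v x) (Finset.smul_mem_smul_finset hx)
    have h4 : (vL * v⁻¹) (v x) = vL x := by simp
    rw [← e, ← e, h4] at h3
    exact h3
  refine ⟨t, ⟨?_, ?_⟩, rfl, fun x hx => by rw [hl x hx, hr x hx]⟩
  · intro i
    fin_cases i
    · exact ⟨τ₀, hτ₀, rfl⟩
    · exact ⟨τ₁, hτ₁, rfl⟩
    · exact ⟨τ₂, by rw [Finset.union_comm] at hτ₂; exact hτ₂, rfl⟩
    · exact ⟨τ₃, by rw [Finset.union_comm] at hτ₃; exact hτ₃, rfl⟩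
  · have k0 := Finset.smul_finset_subset_smul_finset (a := τ₀ * s.conj 0 * τ₀⁻¹) hB
    have k2 := Finset.smul_finset_subset_smul_finset (a := vL) hB
    have k4 := Finset.smul_finset_subset_smul_finset (a := v) hB
    have k3 := Finset.smul_finset_subset_smul_finset (a := τ₃ * s.conj 3 * τ₃⁻¹) k4
    rw [hvY] at k4 k3
    rw [mul_smul, mul_smul, smul_of_mem_fix' ((F.fix _).inv_mem hτ₀) (by grind),
      show s.conj 0 • s.Y 0 = s.Y 1 from s.map₀, smul_of_mem_fix' hτ₀ (by grind)] at k0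
    rw [smul_congr (fun x hx => hvL0 x (subset_cl hx) : ∀ x ∈ s.Y 0, vL x = s.left x),
      s.left_smul] at k2
    rw [mul_smul, mul_smul, smul_of_mem_fix' (X := s.Y 4) ((F.fix _).inv_mem hτ₃) (by grind),
      show s.conj 3 • s.Y 4 = s.Y 3 from s.map₃, smul_of_mem_fix' (X := s.Y 3) hτ₃ (by grind)] at k3
    intro j
    fin_cases j
    · exact hB
    · exact k0
    · exact k2
    · exact k3
    · exact k4

end Chain

end FreeGeometry

/-! ### Back-and-forth along two chains and the normal closure -/

namespace FreeGeometry

open DimGeometry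

variable {V : Type*} [DecidableEq V] {F : FreeGeometry V}
  {A B B' C D X Y Z Z' : Finset V} {a b c : V} {σ τ g h k : Equiv.Perm V}

namespace Chain

variable {s t u s₁ s₂ : Chain F h}

/-- The composition of a chain, as a map from its left end to its right end. -/
def link (s : Chain F h) : Equiv.Perm V := s.right⁻¹ * s.left

theorem link_mem (hh : h ∈ F.G) (s : Chain F h) : s.link ∈ F.G :=
  F.G.mul_mem (F.G.inv_mem (s.right_mem hh)) (s.left_mem hh)

theorem right_eq_iff_link {x y : V} : s.right y = s.left x ↔ s.link x = y := by
  rw [link, Equiv.Perm.mul_apply, Equiv.Perm.inv_eq_iff_eq, eq_comm]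

theorem Ext.link_eq (hh : h ∈ F.G) (hst : s.Ext t) {x : V} (hx : x ∈ F.cl (s.Y 0)) :
    t.link x = s.link x := by
  rw [← right_eq_iff_link, hst.left_eq hh hx, hst.right_eq hh, right_eq_iff_link]
  have h1 : s.link • s.Y 0 = s.Y 4 := by
    rw [link, mul_smul, s.left_smul, ← s.right_smul, inv_smul_smul]
  exact mem_of_smul_eq (s.link_mem hh) h1 hx

/-- Two chains whose compositions, one after the other, approximate `k`. -/
structure Fits (k : Equiv.Perm V) (s₁ s₂ : Chain F h) (T : Finset V) : Prop where
  good : s₂.Good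
  closed : F.cl (s₁.Y 0) = s₁.Y 0
  meet : s₁.link • s₁.Y 0 = s₂.Y 0
  comp : ∀ x ∈ s₁.Y 0, s₂.link (s₁.link x) = k x
  settled₁ : ∀ x ∈ T, s₁.Settled x
  settled₂ : ∀ x ∈ T, s₂.Settled x
  subset : T ⊆ s₁.Y 0

/-- Making a chain good enlarges its left end in an uncontrolled way, while prescribing its link
need not keep it good. Two chains take turns: when one has been made good, the other is extended so
that the composition follows k on the enlarged set. -/
theorem Fits.exists_extension (hh : h ∈ F.G) (hm : F.MovesAll h) (hk : k ∈ F.G) {T : Finset V}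
    (hf : Fits k s₁ s₂ T) (T' : Finset V) :
    ∃ t₁ t₂ : Chain F h, s₁.Ext t₁ ∧ s₂.Ext t₂ ∧ Fits k t₁ t₂ T' := by
  obtain ⟨p₁, hp₁, hp₁g, hp₁c, -, hp₁s, hp₁T⟩ := s₁.exists_good hh T'
  have hl₁ := p₁.link_mem hh
  have e₁ : ∀ x ∈ s₁.Y 0, p₁.link x = s₁.link x := fun x hx => hp₁.link_eq hh (subset_cl hx)
  have hsub₂ : s₂.Y 0 ⊆ p₁.link • p₁.Y 0 := by
    rw [← hf.meet, ← smul_congr e₁]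
    exact Finset.smul_finset_subset_smul_finset (hp₁.2 0)
  have hcl₂ : F.cl (s₂.Y 0) = s₂.Y 0 := by
    rw [← hf.meet, smul_cl (s₁.link_mem hh), hf.closed]
  obtain ⟨p₂, hp₂, hp₂Y, hp₂l⟩ := s₂.exists_extension hh hm hf.good
    (v := k * p₁.link⁻¹) (F.G.mul_mem hk (F.G.inv_mem hl₁)) (by
      intro y hy
      rw [hcl₂, ← hf.meet] at hy
      obtain ⟨x, hx, rfl⟩ := Finset.mem_smul_finset.1 hy
      rw [right_eq_iff_link, Equiv.Perm.smul_def, hf.comp x hx, Equiv.Perm.mul_apply,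
        ← e₁ x hx]
      simp) hsub₂
  obtain ⟨q₂, hq₂, hq₂g, hq₂c, -, hq₂s, -⟩ := p₂.exists_good hh T'
  have hl₂ := q₂.link_mem hh
  have hcomp : ∀ x ∈ p₁.Y 0, q₂.link (p₁.link x) = k x := by
    intro x hx
    have hx' : p₁.link x ∈ p₁.link • p₁.Y 0 := Finset.smul_mem_smul_finset hx
    have h1 := hp₂l _ hx'
    rw [right_eq_iff_link] at h1
    rw [hq₂.link_eq hh (subset_cl (by rwa [hp₂Y])), h1]
    simp
  -- B is the set on which k is now forced through the second chain, since the first link has to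
  -- carry it onto q₂.Y 0.
  set B := k⁻¹ • q₂.link • q₂.Y 0 with hB
  have hBc : F.cl B = B := by rw [hB, smul_cl (F.G.inv_mem hk), smul_cl hl₂, hq₂c]
  have hsubB : p₁.Y 0 ⊆ B := by
    intro x hx
    rw [hB, Finset.mem_inv_smul_finset_iff, Equiv.Perm.smul_def, ← hcomp x hx]
    apply Finset.smul_mem_smul_finset
    apply hq₂.2
    rw [hp₂Y]
    exact Finset.smul_mem_smul_finset hx
  obtain ⟨q₁, hq₁, hq₁Y, hq₁l⟩ := p₁.exists_extension hh hm hp₁g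
    (v := q₂.link⁻¹ * k) (F.G.mul_mem (F.G.inv_mem hl₂) hk) (by
      intro x hx
      rw [hp₁c] at hx
      rw [right_eq_iff_link, Equiv.Perm.mul_apply, ← hcomp x hx]
      simp) hsubB
  have hq₁l' : ∀ x ∈ B, q₁.link x = (q₂.link⁻¹ * k) x := fun x hx =>
    right_eq_iff_link.1 (hq₁l x hx)
  refine ⟨q₁, q₂, hp₁.trans hq₁, hp₂.trans hq₂, hq₂g, by rw [hq₁Y, hBc], ?_, ?_, ?_, hq₂s, ?_⟩
  · rw [hq₁Y, smul_congr hq₁l', mul_smul, hB, smul_inv_smul, inv_smul_smul]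
  · intro x hx
    rw [hq₁Y] at hx
    rw [hq₁l' x hx]
    simp
  · exact fun x hx => hq₁.settled (hp₁s x hx)
  · rw [hq₁Y]
    exact hp₁T.trans hsubB

end Chain

/-- Every element of the group is a product of conjugates of an element moving all finite sets
freely, and of their inverses. -/
theorem mem_of_movesAll [Countable V] (hh : h ∈ F.G) (hm : F.MovesAll h) (hk : k ∈ F.G)
    (N : Subgroup (Equiv.Perm V)) (hN : h ∈ N)
    (hconj : ∀ a ∈ F.G, ∀ x ∈ N, a * x * a⁻¹ ∈ N) : k ∈ N := by
  let P := {p : (Chain F h × Chain F h) × Finset V // Chain.Fits k p.1.1 p.1.2 p.2}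
  let _ : Preorder P :=
    { le := fun p q => (p.1.1.1.Ext q.1.1.1 ∧ p.1.1.2.Ext q.1.1.2) ∧ p.1.2 ⊆ q.1.2
      le_refl := fun p => ⟨⟨Chain.ext_refl _, Chain.ext_refl _⟩, subset_rfl⟩
      le_trans := fun p q r h1 h2 => ⟨⟨h1.1.1.trans h2.1.1, h1.1.2.trans h2.1.2⟩,
        h1.2.trans h2.2⟩ }
  let s₀ : Chain F h :=
    { a := fun _ => 1
      Y := fun _ => ∅
      mem := fun _ => F.G.one_mem
      map₀ := Finset.smul_finset_empty _
      map₁ := Finset.smul_finset_empty _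
      map₂ := Finset.smul_finset_empty _
      map₃ := Finset.smul_finset_empty _ }
  have hs₀ : Chain.Fits k s₀ s₀ ∅ :=
    { good := ⟨ind_of_subset_right (Finset.empty_subset _),
        ind_of_subset_right (Finset.empty_subset _)⟩
      closed := F.cl_empty
      meet := Finset.smul_finset_empty _
      comp := fun x hx => absurd hx (Finset.notMem_empty x)
      settled₁ := fun x hx => absurd hx (Finset.notMem_empty x)
      settled₂ := fun x hx => absurd hx (Finset.notMem_empty x)
      subset := Finset.empty_subset _ }
  obtain ⟨u, hu, -, huD⟩ := exists_monotone_seq_meeting (P := P) ⟨⟨⟨s₀, s₀⟩, ∅⟩, hs₀⟩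
    (fun v p => v ∈ p.1.2) (by
      rintro v ⟨⟨⟨s₁, s₂⟩, T⟩, hf⟩
      obtain ⟨t₁, t₂, h1, h2, h3⟩ := hf.exists_extension hh hm hk (insert v T)
      exact ⟨⟨⟨⟨t₁, t₂⟩, insert v T⟩, h3⟩, ⟨⟨h1, h2⟩, Finset.subset_insert _ _⟩,
        Finset.mem_insert_self _ _⟩)
  have hT : Monotone fun k => (u k).1.2 := fun k l hkl => (hu hkl).2
  have lim₁ : ∀ i, ∃ β ∈ F.G, ∀ k, ∀ x ∈ (u k).1.2,
      β x = (u k).1.1.1.a i x ∧ β⁻¹ x = ((u k).1.1.1.a i)⁻¹ x := fun i =>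
    F.exists_limit (fun k => (u k).1.1.1.a i) (fun k => (u k).1.2) (fun k => (u k).1.1.1.mem i)
      (fun k l hkl x hx => (hu hkl).1.1.a_eq ((u k).2.settled₁ x hx) i) hT huD
  have lim₂ : ∀ i, ∃ β ∈ F.G, ∀ k, ∀ x ∈ (u k).1.2,
      β x = (u k).1.1.2.a i x ∧ β⁻¹ x = ((u k).1.1.2.a i)⁻¹ x := fun i =>
    F.exists_limit (fun k => (u k).1.1.2.a i) (fun k => (u k).1.2) (fun k => (u k).1.1.2.mem i)
      (fun k l hkl x hx => (hu hkl).1.2.a_eq ((u k).2.settled₂ x hx) i) hT huD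
  choose α hα hαu using lim₁
  choose β hβ hβu using lim₂
  have hev : ∀ v, ∀ᶠ k in atTop, v ∈ (u k).1.2 := by
    intro v
    obtain ⟨k, hk⟩ := huD v
    exact eventually_atTop.2 ⟨k, fun l hl => hT hl hk⟩
  have conv : ∀ (γ : Equiv.Perm V) (c : ℕ → Equiv.Perm V),
      (∀ k, ∀ x ∈ (u k).1.2, γ x = c k x ∧ γ⁻¹ x = (c k)⁻¹ x) →
      ∀ x, ∀ᶠ k in atTop, (c k * h * (c k)⁻¹) x = (γ * h * γ⁻¹) x := by
    intro γ c hc x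
    filter_upwards [hev x, hev (h (γ⁻¹ x))] with k h1 h2
    simp only [Equiv.Perm.mul_apply]
    rw [← (hc k _ h1).2, ← (hc k _ h2).1]
  have comp : ∀ (γ γ' : Equiv.Perm V) (c c' : ℕ → Equiv.Perm V),
      (∀ x, ∀ᶠ k in atTop, c k x = γ x) → (∀ x, ∀ᶠ k in atTop, c' k x = γ' x) →
      ∀ x, ∀ᶠ k in atTop, (c k * c' k) x = (γ * γ') x := by
    intro γ γ' c c' h1 h2 x
    filter_upwards [h1 (γ' x), h2 x] with k h3 h4
    rw [Equiv.Perm.mul_apply, Equiv.Perm.mul_apply, h4, h3]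
  have inv : ∀ (γ : Equiv.Perm V) (c : ℕ → Equiv.Perm V),
      (∀ x, ∀ᶠ k in atTop, c k x = γ x) → ∀ x, ∀ᶠ k in atTop, (c k)⁻¹ x = γ⁻¹ x := by
    intro γ c h1 x
    filter_upwards [h1 (γ⁻¹ x)] with k h2
    rw [Equiv.Perm.inv_eq_iff_eq, h2]
    exact (γ.apply_symm_apply x).symm
  set c := fun i => α i * h * (α i)⁻¹
  set d := fun i => β i * h * (β i)⁻¹
  have hlink₁ := comp _ _ _ _ (inv _ _ (comp _ _ _ _ (conv _ _ (hαu 2)) (conv _ _ (hαu 3))))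
    (comp _ _ _ _ (conv _ _ (hαu 1)) (conv _ _ (hαu 0)))
  have hlink₂ := comp _ _ _ _ (inv _ _ (comp _ _ _ _ (conv _ _ (hβu 2)) (conv _ _ (hβu 3))))
    (comp _ _ _ _ (conv _ _ (hβu 1)) (conv _ _ (hβu 0)))
  have hlink := comp _ _ _ _ hlink₂ hlink₁
  -- At each point the links are eventually constant, and their composition there is k; so k is a
  -- product of eight conjugates of h and h⁻¹.
  have hke : k = ((d 2 * d 3)⁻¹ * (d 1 * d 0)) * ((c 2 * c 3)⁻¹ * (c 1 * c 0)) := by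
    ext x
    obtain ⟨l, h1, h2⟩ := ((hlink x).and (hev x)).exists
    rw [← (u l).2.comp x ((u l).2.subset h2)]
    exact h1
  rw [hke]
  have hc : ∀ i, c i ∈ N := fun i => hconj _ (hα i) _ hN
  have hd : ∀ i, d i ∈ N := fun i => hconj _ (hβ i) _ hN
  exact N.mul_mem (N.mul_mem (N.inv_mem (N.mul_mem (hd 2) (hd 3))) (N.mul_mem (hd 1) (hd 0)))
    (N.mul_mem (N.inv_mem (N.mul_mem (hc 2) (hc 3))) (N.mul_mem (hc 1) (hc 0)))

/-- If every nontrivial element moves points out of the closure of their position, and special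
points generate, then the normal closure of every nontrivial element is the whole group. -/
theorem mem_of_ne_one [Countable V] (hg : g ∈ F.G)
    (hmove : ∀ Z b, b ∉ F.cl Z → ∃ σ ∈ F.fix Z, g (σ b) ∉ F.cl ({σ b} ∪ Z))
    (hdec : ∀ X b, b ∉ F.cl X → F.Special X b ∨ ∃ c, F.Special X c ∧ F.Special ({c} ∪ X) b)
    (hk : k ∈ F.G) (N : Subgroup (Equiv.Perm V)) (hN : g ∈ N)
    (hconj : ∀ a ∈ F.G, ∀ x ∈ N, a * x * a⁻¹ ∈ N) : k ∈ N := by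
  have hm : F.Moves 0 g := by
    intro X b hb Z hXZ hgX hi
    -- Independence from g⁻¹ • Z turns, after applying g, into independence of the image from Z over
    -- g • X.
    set Z₁ := Z ∪ g⁻¹ • Z with hZ₁
    obtain ⟨σ₀, hσ₀, hi₀⟩ := F.exists_ind_singleton b Z Z₁
    have hs₀ : F.Special X (σ₀ b) := by
      have := hb.smul hσ₀.1
      rwa [smul_of_mem_fix' hσ₀ hXZ] at this
    have hj₀ : F.Ind {σ₀ b} X Z₁ := (ind_smul_of_fix hi hσ₀ hXZ subset_rfl).trans hi₀
      (subset_cl_of hXZ) (subset_cl_of (by grind))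
    have hnot : σ₀ b ∉ F.cl Z₁ := by
      intro hmem
      apply hs₀.1
      rw [← hj₀.inter]
      exact Finset.mem_inter.2 ⟨subset_cl (by grind), cl_mono (by grind) hmem⟩
    obtain ⟨σ₁, hσ₁, hout⟩ := hmove Z₁ _ hnot
    have hj₁ : F.Ind {σ₁ (σ₀ b)} X Z₁ := ind_smul_of_fix hj₀ hσ₁ (by grind) subset_rfl
    have hs₁ : F.Special X (σ₁ (σ₀ b)) := by
      have := hs₀.smul hσ₁.1
      rwa [smul_of_mem_fix' hσ₁ (show X ⊆ Z₁ by grind)] at this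
    set b₁ := σ₁ (σ₀ b) with hb₁
    have hj₂ : F.Ind {g b₁} (g • X) Z := by
      have := (hj₁.mono_right (B' := g⁻¹ • Z) (subset_cl_of (by grind))).smul hg
      rwa [smul_singleton_apply, smul_inv_smul] at this
    have hgs := hs₁.smul hg
    refine ⟨σ₁ * σ₀, (F.fix Z).mul_mem (fix_mono' (by grind) hσ₁) hσ₀, hj₂, ?_⟩
    change F.cl ({b₁} ∪ Z) ∩ F.cl ({g b₁} ∪ Z) ⊆ F.cl Z
    have hout' : g b₁ ∉ F.cl ({b₁} ∪ Z) := fun h => hout (cl_mono (by grind) h)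
    intro x hx
    rw [Finset.mem_inter] at hx
    rcases hgs.2 with hd | hfree
    -- The image adds at most 1 to d(Z), so a common point outside cl Z would generate the same
    -- closure over Z. The image would then lie in cl(b₁, Z).
    · by_contra hxZ
      have e1 := d_insert_of_notMem hxZ
      have e2 : F.d ({g b₁} ∪ Z) ≤ F.d Z + 1 := by
        have h1 := F.submod ({g b₁} ∪ g • X) Z
        have h2 := F.mono (g • X) (({g b₁} ∪ g • X) ∩ Z) (by grind)
        have h3 : {g b₁} ∪ g • X ∪ Z = {g b₁} ∪ Z := by grind
        rw [h3] at h1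
        omega
      have e3 : F.cl (insert x Z) = F.cl ({g b₁} ∪ Z) :=
        cl_eq_of_subset_of_d (Finset.insert_subset hx.2 (subset_cl_of (by grind))) (by omega)
      apply hout'
      have e4 : g b₁ ∈ F.cl (insert x Z) := by rw [e3]; exact subset_cl (by grind)
      exact cl_subset_cl (Finset.insert_subset hx.1 (subset_cl_of (by grind))) e4
    -- A free point adds nothing but itself to cl Z, and that point has been moved out of cl(b₁, Z).
    · have hf : F.Ind {g b₁} ∅ Z := hfree.trans hj₂ (Finset.empty_subset _)
        (subset_cl_of (by grind))
      have h1 := hf.1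
      simp only [Finset.union_empty, F.cl_singleton] at h1
      have h2 := h1 hx.2
      rw [Finset.mem_union, Finset.mem_singleton] at h2
      rcases h2 with rfl | h2
      · exact absurd hx.1 hout'
      · exact h2
  obtain ⟨α, hα, hm₁⟩ := hm.exists_succ hg
  have hg₁ : α * g * α⁻¹ * g ∈ F.G :=
    F.G.mul_mem (F.G.mul_mem (F.G.mul_mem hα hg) (F.G.inv_mem hα)) hg
  have hN₁ : α * g * α⁻¹ * g ∈ N := N.mul_mem (hconj _ hα _ hN) hN
  obtain ⟨β, hβ, hm₂⟩ := hm₁.exists_succ hg₁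
  set g₁ := α * g * α⁻¹ * g
  have hg₂ : β * g₁ * β⁻¹ * g₁ ∈ F.G :=
    F.G.mul_mem (F.G.mul_mem (F.G.mul_mem hβ hg₁) (F.G.inv_mem hβ)) hg₁
  exact mem_of_movesAll hg₂ (fun X B hi => movesFreely_of_moves hg₂ hm₂ hdec X B hi) hk N
    (N.mul_mem (hconj _ hβ _ hN₁) hN₁) hconj

end FreeGeometry

/-! ### Predimension, free amalgamation and dimension -/

namespace UniformHypergraph

/-- The arithmetic properties of a control function that govern the class `𝒞_f` for `m = 1`. -/
structure Control (r n : ℕ) (f : ℝ → ℝ) : Prop where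
  zero : f 0 = 0
  mono : ∀ x y : ℕ, x ≤ y → f x ≤ f y
  unbounded : ∀ c : ℝ, ∃ k : ℕ, c < f k
  add_le : ∀ x y : ℕ, y ≤ x → f (x + y : ℕ) ≤ f x + 1
  one : f 1 = n
  two : n < f 2
  param : n = 1 ∧ 3 ≤ r ∨ n = 2 ∧ r = 2

namespace Control

variable {r n : ℕ} {f : ℝ → ℝ} (hf : Control r n f)
include hf

theorem nonneg (x : ℕ) : 0 ≤ f x := by
  have := hf.mono 0 x (Nat.zero_le _)
  rwa [Nat.cast_zero, hf.zero] at this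

theorem le_of_one_le (x : ℕ) (hx : 1 ≤ x) : n ≤ f x := by
  have := hf.mono 1 x hx
  rwa [Nat.cast_one, hf.one] at this

theorem lt_of_two_le (x : ℕ) (hx : 2 ≤ x) : n < f x := by
  have := hf.mono 2 x hx
  exact hf.two.trans_le (mod_cast this)

theorem pos : 1 ≤ n := by rcases hf.param with h | h <;> omega

theorem succ_le (x : ℕ) (hx : 1 ≤ x) : f (x + 1 : ℕ) ≤ f x + 1 := hf.add_le x 1 hx

theorem le_mul (x : ℕ) : f x ≤ n * x := by
  have hn : (1 : ℝ) ≤ n := mod_cast hf.pos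
  induction x with
  | zero => simp [hf.zero]
  | succ x ih =>
    rcases Nat.eq_zero_or_pos x with rfl | hx
    · simp [hf.one]
    · have := hf.succ_le x hx
      push_cast at *
      linarith

end Control

variable {r n : ℕ} {f : ℝ → ℝ} {V : Type*} {H : UniformHypergraph r V} {W X Y Z : Finset V}

open Classical in
/-- The set `R[X]` of hyperedges contained in `X`. -/
noncomputable def edgesIn (H : UniformHypergraph r V) (X : Finset V) : Finset (Finset V) :=
  X.powerset.filter (fun e => e ∈ H.edges)

theorem mem_edgesIn {e : Finset V} : e ∈ H.edgesIn X ↔ e ⊆ X ∧ e ∈ H.edges := by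
  simp [edgesIn]

theorem predim_eq : H.predim n 1 X = n * X.card - (H.edgesIn X).card := by
  simp [predim, edgesIn]

variable [DecidableEq V]

theorem edgesIn_inter : H.edgesIn (X ∩ Y) = H.edgesIn X ∩ H.edgesIn Y := by
  ext e
  simp only [Finset.mem_inter, mem_edgesIn, Finset.subset_inter_iff]
  tauto

theorem edgesIn_union_subset : H.edgesIn X ∪ H.edgesIn Y ⊆ H.edgesIn (X ∪ Y) := by
  intro e
  simp only [Finset.mem_union, mem_edgesIn]
  rintro (h | h)
  · exact ⟨h.1.trans Finset.subset_union_left, h.2⟩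
  · exact ⟨h.1.trans Finset.subset_union_right, h.2⟩

theorem predim_submod (n : ℕ) (H : UniformHypergraph r V) (X Y : Finset V) :
    H.predim n 1 (X ∪ Y) + H.predim n 1 (X ∩ Y) ≤ H.predim n 1 X + H.predim n 1 Y := by
  simp only [predim_eq, edgesIn_inter]
  have h1 := Finset.card_union_add_card_inter X Y
  have h2 := Finset.card_union_add_card_inter (H.edgesIn X) (H.edgesIn Y)
  have h3 := Finset.card_le_card (edgesIn_union_subset (H := H) (X := X) (Y := Y))
  have h4 : (n : ℤ) * (X ∪ Y).card + n * (X ∩ Y).card = n * X.card + n * Y.card := by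
    rw [← mul_add, ← mul_add]
    exact_mod_cast congrArg _ h1
  omega

/-- No hyperedge crosses between `X` and `Y`. -/
def NoCross (H : UniformHypergraph r V) (X Y : Finset V) : Prop :=
  ∀ e ∈ H.edges, e ⊆ X ∪ Y → e ⊆ X ∨ e ⊆ Y

/-- The defect in submodularity counts the hyperedges of X ∪ Y contained in neither X nor Y. -/
theorem predim_modular_iff : H.NoCross X Y ↔
    H.predim n 1 (X ∪ Y) + H.predim n 1 (X ∩ Y) = H.predim n 1 X + H.predim n 1 Y := by
  simp only [predim_eq, edgesIn_inter]
  have h1 := Finset.card_union_add_card_inter X Y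
  have h2 := Finset.card_union_add_card_inter (H.edgesIn X) (H.edgesIn Y)
  have h4 : (n : ℤ) * (X ∪ Y).card + n * (X ∩ Y).card = n * X.card + n * Y.card := by
    rw [← mul_add, ← mul_add]
    exact_mod_cast congrArg _ h1
  have h5 : H.NoCross X Y ↔ H.edgesIn X ∪ H.edgesIn Y = H.edgesIn (X ∪ Y) := by
    constructor
    · intro h
      refine edgesIn_union_subset.antisymm fun e he => ?_
      rw [mem_edgesIn] at he
      simp only [Finset.mem_union, mem_edgesIn]
      have := h e he.2 he.1
      tauto
    · intro h e he hs
      have : e ∈ H.edgesIn X ∪ H.edgesIn Y := by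
        rw [h, mem_edgesIn]
        exact ⟨hs, he⟩
      simp only [Finset.mem_union, mem_edgesIn] at this
      tauto
  rw [h5]
  constructor
  · intro h
    rw [← h]
    omega
  · intro h
    refine Finset.eq_of_subset_of_card_le edgesIn_union_subset ?_
    omega

/-- The finite set `W` satisfies the defining condition of the class `𝒞_f`. -/
def Good (n : ℕ) (f : ℝ → ℝ) (H : UniformHypergraph r V) (W : Finset V) : Prop :=
  ∀ X ⊆ W, f X.card ≤ H.predim n 1 X

/-- Every proper extension of `A` inside `W` has larger predimension. -/
def Strong (n : ℕ) (H : UniformHypergraph r V) (A W : Finset V) : Prop :=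
  ∀ Y, A ⊂ Y → Y ⊆ W → H.predim n 1 A < H.predim n 1 Y

variable {A B C : Finset V}

theorem Strong.le (h : H.Strong n A W) (h1 : A ⊆ Y) (h2 : Y ⊆ W) :
    H.predim n 1 A ≤ H.predim n 1 Y := by
  rcases h1.eq_or_ssubset with rfl | h3
  · exact le_rfl
  · exact (h Y h3 h2).le

theorem Strong.mono (h : H.Strong n A W) (hX : X ⊆ W) : H.Strong n A X :=
  fun Y h1 h2 => h Y h1 (h2.trans hX)

/-- An extension Y of A ∩ X inside X is compared with the extension Y ∪ A of A by submodularity. -/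
theorem Strong.inter (h : H.Strong n A W) (hX : X ⊆ W) (hA : A ⊆ W) : H.Strong n (A ∩ X) X := by
  intro Y h1 h2
  have h3 := predim_submod n H Y A
  have h4 : Y ∩ A = A ∩ X := by
    apply Finset.Subset.antisymm
    · grind
    · exact Finset.subset_inter h1.subset Finset.inter_subset_left
  have h5 : A ⊂ Y ∪ A := by
    refine Finset.ssubset_iff_subset_ne.2 ⟨Finset.subset_union_right, fun h6 => h1.not_subset ?_⟩
    have : Y ⊆ A := h6 ▸ Finset.subset_union_left
    exact Finset.subset_inter this h2
  have h6 := h _ h5 (Finset.union_subset (h2.trans hX) hA)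
  rw [h4] at h3
  omega

theorem Strong.trans (h : H.Strong n A B) (hAB : A ⊆ B) (h' : H.Strong n B W) (hB : B ⊆ W) :
    H.Strong n A W := by
  intro Y h1 h2
  have h3 := predim_submod n H Y B
  have h4 := h.le (Y := Y ∩ B) (Finset.subset_inter h1.subset hAB) Finset.inter_subset_right
  by_cases hYB : Y ⊆ B
  · exact h Y h1 hYB
  · have h5 := h' (Y ∪ B) (Finset.ssubset_iff_subset_ne.2 ⟨Finset.subset_union_right, fun h6 =>
      hYB (h6 ▸ Finset.subset_union_left)⟩) (Finset.union_subset h2 hB)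
    omega

theorem NoCross.symm (h : H.NoCross X Y) : H.NoCross Y X := fun e he hs =>
  (h e he (by rwa [Finset.union_comm])).symm

theorem NoCross.inter (h : H.NoCross X Y) (hZ : Z ⊆ X ∪ Y) : H.NoCross (Z ∩ X) (Z ∩ Y) := by
  intro e he hs
  have h1 : e ⊆ Z := hs.trans (by grind)
  rcases h e he (h1.trans hZ) with h2 | h2
  · exact Or.inl (Finset.subset_inter h1 h2)
  · exact Or.inr (Finset.subset_inter h1 h2)

theorem NoCross.predim_inter (h : H.NoCross X Y) (hZ : Z ⊆ X ∪ Y) :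
    H.predim n 1 Z + H.predim n 1 (Z ∩ X ∩ Y) =
      H.predim n 1 (Z ∩ X) + H.predim n 1 (Z ∩ Y) := by
  have h1 := (predim_modular_iff (n := n)).1 (h.inter hZ)
  rwa [← Finset.inter_union_distrib_left, Finset.inter_eq_left.2 hZ,
    show Z ∩ X ∩ (Z ∩ Y) = Z ∩ X ∩ Y by grind] at h1

/-- Without crossing hyperedges, δ of an extension over X equals δ of its trace on Y over X ∩ Y. -/
theorem NoCross.strong (h : H.NoCross X Y) (hs : H.Strong n (X ∩ Y) Y) : H.Strong n X (X ∪ Y) := by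
  intro Z h1 h2
  have h3 := h.predim_inter (n := n) h2
  rw [Finset.inter_eq_right.2 h1.subset] at h3
  have h4 := hs (Z ∩ Y) (Finset.ssubset_iff_subset_ne.2 ⟨by grind, fun h6 => h1.not_subset ?_⟩)
    Finset.inter_subset_right
  · omega
  · intro z hz
    rcases Finset.mem_union.1 (h2 hz) with h7 | h7
    · exact h7
    · have : z ∈ X ∩ Y := h6 ▸ Finset.mem_inter.2 ⟨hz, h7⟩
      exact Finset.mem_inter.1 this |>.1

/-- The smaller trace Z ∩ Y adds at least 1 to δ(Z ∩ X) by strength and integrality, while f(|Z|)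
exceeds f(|Z ∩ X|) by at most 1 because the size at most doubles. -/
theorem NoCross.le_predim (hf : Control r n f) (h : H.NoCross X Y) (hX : H.Good n f X)
    (hY : H.Strong n (X ∩ Y) Y) (hZ : Z ⊆ X ∪ Y) (hZX : ¬ Z ⊆ X)
    (hc : (Z ∩ Y).card ≤ (Z ∩ X).card) :
    f Z.card ≤ H.predim n 1 Z := by
  have h1 := h.predim_inter (n := n) hZ
  have h2 := (hY.inter (X := Z ∩ Y) Finset.inter_subset_right Finset.inter_subset_right)
    (Z ∩ Y) (Finset.ssubset_iff_subset_ne.2 ⟨by grind, fun h6 => hZX ?_⟩) subset_rfl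
  · have h3 : X ∩ Y ∩ (Z ∩ Y) = Z ∩ X ∩ Y := by grind
    rw [h3] at h2
    have h4 := hX (Z ∩ X) Finset.inter_subset_right
    have h5 := hf.add_le (Z ∩ X).card (Z ∩ Y).card hc
    have h6 : Z.card ≤ (Z ∩ X).card + (Z ∩ Y).card := by
      refine le_trans (Finset.card_le_card ?_) (Finset.card_union_le _ _)
      grind
    have h7 := hf.mono _ _ h6
    have h8 : H.predim n 1 (Z ∩ X) + 1 ≤ H.predim n 1 Z := by omega
    have h9 : ((H.predim n 1 (Z ∩ X) : ℤ) : ℝ) + 1 ≤ H.predim n 1 Z := by exact_mod_cast h8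
    linarith
  · intro z hz
    rcases Finset.mem_union.1 (hZ hz) with h7 | h7
    · exact h7
    · have : z ∈ X ∩ Y ∩ (Z ∩ Y) := by rw [h6]; exact Finset.mem_inter.2 ⟨hz, h7⟩
      grind

/-- Free amalgamation. -/
theorem NoCross.good (hf : Control r n f) (h : H.NoCross X Y) (hX : H.Good n f X)
    (hY : H.Good n f Y) (hsX : H.Strong n (X ∩ Y) X) (hsY : H.Strong n (X ∩ Y) Y) :
    H.Good n f (X ∪ Y) := by
  intro Z hZ
  by_cases h1 : Z ⊆ X
  · exact hX Z h1
  by_cases h2 : Z ⊆ Y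
  · exact hY Z h2
  rcases le_total (Z ∩ Y).card (Z ∩ X).card with h3 | h3
  · exact h.le_predim hf hX hsY hZ h1 h3
  · exact h.symm.le_predim hf hY (by rwa [Finset.inter_comm]) (by rwa [Finset.union_comm]) h2 h3

theorem InClass.good (h : H.InClass n 1 f) (W : Finset V) : H.Good n f W := fun X _ => (h X).2

theorem Control.inClass (hf : Control r n f) (h : ∀ W, H.Good n f W) : H.InClass n 1 f := by
  intro X
  have h1 := h X X subset_rfl
  refine ⟨?_, h1⟩
  have := (hf.nonneg _).trans h1
  exact_mod_cast this

/-! ### The dimension -/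

theorem InClass.bddBelow (h : H.InClass n 1 f) (X : Finset V) :
    BddBelow {k | ∃ Y : Finset V, X ⊆ Y ∧ k = H.predim n 1 Y} :=
  ⟨0, by rintro _ ⟨Y, -, rfl⟩; exact (h Y).1⟩

theorem InClass.dim_le (h : H.InClass n 1 f) (hXY : X ⊆ Y) : H.dim n 1 X ≤ H.predim n 1 Y :=
  csInf_le (h.bddBelow X) ⟨Y, hXY, rfl⟩

theorem InClass.exists_dim_eq (h : H.InClass n 1 f) (X : Finset V) :
    ∃ Y, X ⊆ Y ∧ H.dim n 1 X = H.predim n 1 Y :=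
  Int.csInf_mem (s := {k | ∃ Y : Finset V, X ⊆ Y ∧ k = H.predim n 1 Y})
    ⟨_, X, subset_rfl, rfl⟩ (h.bddBelow X)

theorem InClass.dim_mono (h : H.InClass n 1 f) (hXY : X ⊆ Y) : H.dim n 1 X ≤ H.dim n 1 Y := by
  obtain ⟨Z, h1, h2⟩ := h.exists_dim_eq Y
  rw [h2]
  exact h.dim_le (hXY.trans h1)

theorem InClass.dim_submod (h : H.InClass n 1 f) (X Y : Finset V) :
    H.dim n 1 (X ∪ Y) + H.dim n 1 (X ∩ Y) ≤ H.dim n 1 X + H.dim n 1 Y := by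
  obtain ⟨X', h1, h2⟩ := h.exists_dim_eq X
  obtain ⟨Y', h3, h4⟩ := h.exists_dim_eq Y
  have h5 := h.dim_le (Finset.union_subset_union h1 h3)
  have h6 := h.dim_le (Finset.inter_subset_inter h1 h3)
  have h7 := predim_submod n H X' Y'
  omega

theorem InClass.card_le (hf : Control r n f) (h : H.InClass n 1 f) (k : ℤ) :
    ∃ N : ℕ, ∀ Y : Finset V, H.predim n 1 Y ≤ k → Y.card ≤ N := by
  obtain ⟨N, hN⟩ := hf.unbounded k
  refine ⟨N, fun Y hY => ?_⟩
  by_contra! hc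
  have h1 := hf.mono _ _ hc.le
  have h2 := (h Y).2
  have h3 : ((H.predim n 1 Y : ℤ) : ℝ) ≤ k := by exact_mod_cast hY
  linarith

theorem InClass.dim_insert_eq_of_mem (h : H.InClass n 1 f) {a : V} (h1 : X ⊆ Y)
    (h2 : H.predim n 1 Y ≤ H.dim n 1 X) (ha : a ∈ Y) : H.dim n 1 (insert a X) = H.dim n 1 X :=
  le_antisymm ((h.dim_le (Finset.insert_subset ha h1)).trans h2)
    (h.dim_mono (Finset.subset_insert _ _))

/-- Any finitely many closure points can be adjoined without raising dim X, so together they lie in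
a finite set with δ = dim X. The unboundedness of `f` bounds the size of such sets. -/
theorem InClass.finite_closure (hf : Control r n f) (h : H.InClass n 1 f) (X : Finset V) :
    {a | H.dim n 1 (insert a X) = H.dim n 1 X}.Finite := by
  obtain ⟨N, hN⟩ := h.card_le hf (H.dim n 1 X)
  have key : ∀ T : Finset V, (∀ a ∈ T, H.dim n 1 (insert a X) = H.dim n 1 X) →
      H.dim n 1 (X ∪ T) = H.dim n 1 X := by
    intro T
    induction T using Finset.induction_on with
    | empty => simp
    | insert a T _ ih =>
      intro hT
      have h1 := ih fun b hb => hT b (Finset.mem_insert_of_mem hb)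
      have h2 := hT a (Finset.mem_insert_self _ _)
      have h3 := h.dim_submod (X ∪ T) (insert a X)
      have h4 := h.dim_mono (show X ⊆ (X ∪ T) ∩ insert a X by grind)
      have h5 := h.dim_mono (show X ⊆ X ∪ insert a T by grind)
      rw [show X ∪ T ∪ insert a X = X ∪ insert a T by grind] at h3
      omega
  by_contra hinf
  obtain ⟨T, hT, hc⟩ := Set.Infinite.exists_subset_card_eq hinf (N + 1)
  obtain ⟨Y, hY, hd⟩ := h.exists_dim_eq (X ∪ T)
  have h1 := hN Y (by rw [← hd, key T fun a ha => hT ha])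
  have h2 := Finset.card_le_card (Finset.subset_union_right.trans hY)
  omega

end UniformHypergraph

/-! ### From embeddings to the geometry of a hypergraph -/

namespace UniformHypergraph

variable {r n : ℕ} {f : ℝ → ℝ} {S T V : Type*} [DecidableEq S] [DecidableEq T] [DecidableEq V]
  {H : UniformHypergraph r V} {K : UniformHypergraph r T} {L : UniformHypergraph r S}
  {φ ψ : T → V} {χ : S → T} {σ : Equiv.Perm V}

/-! ### Partial embeddings -/

/-- The map `φ` restricts to an embedding of the substructure on `W`. -/
def Embeds (K : UniformHypergraph r T) (H : UniformHypergraph r V) (W : Finset T) (φ : T → V) :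
    Prop :=
  InjOn φ W ∧ ∀ e ⊆ W, e ∈ K.edges ↔ e.image φ ∈ H.edges

namespace Embeds

variable {A W X : Finset T}

theorem mono (h : Embeds K H W φ) (hX : X ⊆ W) : Embeds K H X φ :=
  ⟨h.1.mono (Finset.coe_subset.2 hX), fun e he => h.2 e (he.trans hX)⟩

theorem congr (h : Embeds K H W φ) (he : ∀ x ∈ W, ψ x = φ x) : Embeds K H W ψ := by
  refine ⟨h.1.congr fun x hx => (he x hx).symm, fun e hs => ?_⟩
  rw [h.2 e hs, Finset.image_congr fun x hx => he x (hs hx)]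

theorem comp {W : Finset S} (h : Embeds L K W χ) (h' : Embeds K H (W.image χ) φ) :
    Embeds L H W (φ ∘ χ) := by
  refine ⟨h'.1.comp h.1 fun x hx => by simpa using ⟨x, hx, rfl⟩, fun e he => ?_⟩
  rw [h.2 e he, h'.2 _ (Finset.image_subset_image he), Finset.image_image]

theorem injOn_of_subset (h : Embeds K H W φ) (hX : X ⊆ W) : InjOn φ X :=
  h.1.mono (Finset.coe_subset.2 hX)

theorem image_subset_image (h : Embeds K H W φ) (hA : A ⊆ W) (hX : X ⊆ W) :
    A.image φ ⊆ X.image φ ↔ A ⊆ X := by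
  refine ⟨fun hs a ha => ?_, Finset.image_subset_image⟩
  obtain ⟨x, hx, he⟩ := Finset.mem_image.1 (hs (Finset.mem_image_of_mem φ ha))
  rwa [← h.1 (hX hx) (hA ha) he]

theorem inter_image (h : Embeds K H W φ) (hA : A ⊆ W) (hX : X ⊆ W) :
    (A ∩ X).image φ = A.image φ ∩ X.image φ :=
  Finset.image_inter_of_injOn _ _ (h.1.mono (by grind))

theorem exists_inverse [Nonempty T] (h : Embeds K H W φ) :
    ∃ ψ : V → T, Embeds H K (W.image φ) ψ ∧ ∀ x ∈ W, ψ (φ x) = x := by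
  have h1 : ∀ x ∈ W, Function.invFunOn φ W (φ x) = x := fun x hx =>
    h.1.leftInvOn_invFunOn hx
  have h2 : ∀ e ⊆ W, (e.image φ).image (Function.invFunOn φ W) = e := by
    intro e he
    rw [Finset.image_image]
    exact (Finset.image_congr fun x hx => h1 x (he hx)).trans Finset.image_id
  refine ⟨Function.invFunOn φ W, ⟨?_, ?_⟩, h1⟩
  · intro y hy z hz he
    simp only [Finset.coe_image, Set.mem_image] at hy hz
    obtain ⟨y, hy, rfl⟩ := hy
    obtain ⟨z, hz, rfl⟩ := hz
    rw [h1 y hy, h1 z hz] at he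
    rw [he]
  · intro e he
    obtain ⟨e, he', rfl⟩ := Finset.subset_image_iff.1 he
    rw [h2 e (mod_cast he'), h.2 e (mod_cast he')]

theorem card_image (h : Embeds K H W φ) (hX : X ⊆ W) : (X.image φ).card = X.card :=
  Finset.card_image_of_injOn (h.injOn_of_subset hX)

theorem predim_image (h : Embeds K H W φ) (hX : X ⊆ W) :
    H.predim n 1 (X.image φ) = K.predim n 1 X := by
  rw [predim_eq, predim_eq, h.card_image hX]
  congr 2
  symm
  apply Finset.card_bij (fun e _ => e.image φ)
  · intro e he
    rw [mem_edgesIn] at he ⊢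
    exact ⟨Finset.image_subset_image he.1, (h.2 e (he.1.trans hX)).1 he.2⟩
  · intro e he e' he' hs
    rw [mem_edgesIn] at he he'
    apply Finset.Subset.antisymm
    · exact (h.image_subset_image (he.1.trans hX) (he'.1.trans hX)).1 hs.subset
    · exact (h.image_subset_image (he'.1.trans hX) (he.1.trans hX)).1 hs.symm.subset
  · intro e he
    rw [mem_edgesIn] at he
    obtain ⟨e, he', rfl⟩ := Finset.subset_image_iff.1 he.1
    have he' : e ⊆ X := mod_cast he'
    exact ⟨e, mem_edgesIn.2 ⟨he', (h.2 e (he'.trans hX)).2 he.2⟩, rfl⟩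

theorem good (h : Embeds K H W φ) (hX : X ⊆ W) : H.Good n f (X.image φ) ↔ K.Good n f X := by
  constructor
  · intro hg Y hY
    have := hg (Y.image φ) (Finset.image_subset_image hY)
    rwa [h.card_image (hY.trans hX), h.predim_image (hY.trans hX)] at this
  · intro hg Y hY
    obtain ⟨Y, hY', rfl⟩ := Finset.subset_image_iff.1 hY
    have hY' : Y ⊆ X := mod_cast hY'
    rw [h.card_image (hY'.trans hX), h.predim_image (hY'.trans hX)]
    exact hg Y hY'

theorem strong (h : Embeds K H W φ) (hA : A ⊆ W) (hX : X ⊆ W) :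
    H.Strong n (A.image φ) (X.image φ) ↔ K.Strong n A X := by
  constructor
  · intro hs Y h1 h2
    have := hs (Y.image φ) ((ssubset_iff_subset_not_subset).2
      ⟨Finset.image_subset_image h1.subset, fun h3 => h1.not_subset
        ((h.image_subset_image (h2.trans hX) hA).1 h3)⟩) (Finset.image_subset_image h2)
    rwa [h.predim_image hA, h.predim_image (h2.trans hX)] at this
  · intro hs Y h1 h2
    obtain ⟨Y, hY, rfl⟩ := Finset.subset_image_iff.1 h2
    have hY : Y ⊆ X := mod_cast hY
    rw [h.predim_image hA, h.predim_image (hY.trans hX)]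
    refine hs Y ((ssubset_iff_subset_not_subset).2
      ⟨(h.image_subset_image hA (hY.trans hX)).1 h1.subset, fun h3 => h1.not_subset
        (Finset.image_subset_image h3)⟩) hY

end Embeds

theorem mem_aut_iff : σ ∈ H.aut ↔ ∀ e : Finset V, e ∈ H.edges ↔ e.image σ ∈ H.edges := by
  have : ∀ e : Finset V, e.map σ.toEmbedding = e.image σ := fun e => by
    rw [Finset.map_eq_image]; rfl
  simp only [← this]
  rfl

theorem embeds_of_mem_aut (hσ : σ ∈ H.aut) (W : Finset V) : Embeds H H W σ :=
  ⟨σ.injective.injOn, fun e _ => mem_aut_iff.1 hσ e⟩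

/-! ### The dimension geometry of a hypergraph -/

theorem InClass.dim_image_le (h : H.InClass n 1 f) (hσ : σ ∈ H.aut) (X : Finset V) :
    H.dim n 1 (X.image σ) ≤ H.dim n 1 X := by
  obtain ⟨Y, h1, h2⟩ := h.exists_dim_eq X
  rw [h2, ← (embeds_of_mem_aut hσ Y).predim_image subset_rfl]
  exact h.dim_le (Finset.image_subset_image h1)

/-- The geometry of the dimension function of a hypergraph all of whose finite subsets are in
the class. -/
noncomputable def InClass.geometry (h : H.InClass n 1 f) (hf : Control r n f) :
    DimGeometry V where
  d := H.dim n 1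
  mono _ _ := h.dim_mono
  submod := h.dim_submod
  finite := h.finite_closure hf
  G := H.aut
  smul_d := by
    intro σ hσ X
    apply le_antisymm (h.dim_image_le hσ X)
    have h1 := h.dim_image_le (H.aut.inv_mem hσ) (X.image σ)
    rwa [Finset.image_image, show (⇑σ⁻¹ ∘ ⇑σ) = id by ext; simp, Finset.image_id] at h1

/-- A finite set is closed if it is strong in every larger finite set. -/
def Closed (n : ℕ) (H : UniformHypergraph r V) (A : Finset V) : Prop :=
  ∀ W, H.Strong n A W

variable {A B C X Y : Finset V} {a b c : V}

theorem Closed.dim_eq (h : H.InClass n 1 f) (hA : H.Closed n A) :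
    H.dim n 1 A = H.predim n 1 A := by
  obtain ⟨Y, h1, h2⟩ := h.exists_dim_eq A
  have := h.dim_le (subset_refl A)
  have := (hA Y).le h1 subset_rfl
  omega

theorem dimOver_singleton (H : UniformHypergraph r V) (a : V) (Z : Set V) :
    H.dimOver n 1 {a} Z = sInf {k | ∃ Y : Finset V, (Y : Set V) ⊆ Z ∧
      k = H.dim n 1 (insert a Y) - H.dim n 1 Y} := by
  have : ∀ Y : Finset V, @Union.union _ (@Finset.instUnion V
      fun a b => Classical.propDecidable (a = b)) {a} Y = insert a Y := by
    intro Y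
    ext x
    simp
  simp only [dimOver, this]

section

variable (hf : Control r n f) (h : H.InClass n 1 f)
include hf h

/-- A finite set realizing dim X consists of closure points. So a set equal to its closure realizes
its own dimension, and no proper extension does. -/
theorem InClass.cl_eq_iff : (h.geometry hf).cl X = X ↔ H.Closed n X := by
  constructor
  · intro hX
    obtain ⟨Y₀, h1, h2⟩ := h.exists_dim_eq X
    have key : ∀ Y, X ⊆ Y → H.predim n 1 Y ≤ H.dim n 1 X → Y ⊆ X := by
      intro Y h3 h4 y hy
      rw [← hX, DimGeometry.mem_cl]
      exact h.dim_insert_eq_of_mem h3 h4 hy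
    have h3 : Y₀ = X := (key Y₀ h1 h2.ge).antisymm h1
    subst h3
    intro W Y h4 _
    by_contra! hc
    exact h4.not_subset (key Y h4.subset (by omega))
  · intro hX
    refine Finset.Subset.antisymm (fun a ha => ?_) DimGeometry.subset_cl
    rw [DimGeometry.mem_cl] at ha
    change H.dim n 1 _ = H.dim n 1 _ at ha
    obtain ⟨Y, h1, h2⟩ := h.exists_dim_eq (insert a X)
    by_contra hc
    have h3 := hX Y Y (ssubset_iff_subset_not_subset.2
      ⟨(Finset.subset_insert _ _).trans h1, fun h4 => hc (h4 (h1 (Finset.mem_insert_self _ _)))⟩)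
      subset_rfl
    rw [← h2, ha, Closed.dim_eq h hX] at h3
    omega

theorem InClass.closed_cl : H.Closed n ((h.geometry hf).cl X) :=
  (h.cl_eq_iff hf).1 (DimGeometry.cl_cl _)

theorem InClass.predim_cl : H.predim n 1 ((h.geometry hf).cl X) = H.dim n 1 X := by
  rw [← Closed.dim_eq h (h.closed_cl hf)]
  exact DimGeometry.d_cl (S := h.geometry hf) X

theorem InClass.dim_singleton_union_sub_nonneg (X : Finset V) :
    0 ≤ H.dim n 1 (insert a X) - H.dim n 1 X := by
  have := h.dim_mono (Finset.subset_insert a X)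
  omega

theorem InClass.mem_dcl {Z : Set V} :
    a ∈ H.dcl n 1 Z ↔ ∃ Y : Finset V, (Y : Set V) ⊆ Z ∧ a ∈ (h.geometry hf).cl Y := by
  have hb : BddBelow {k | ∃ Y : Finset V, (Y : Set V) ⊆ Z ∧
      k = H.dim n 1 (insert a Y) - H.dim n 1 Y} :=
    ⟨0, by rintro _ ⟨Y, -, rfl⟩; exact h.dim_singleton_union_sub_nonneg hf Y⟩
  change H.dimOver n 1 {a} Z = 0 ↔ _
  rw [dimOver_singleton]
  constructor
  · intro h0
    have h1 := Int.csInf_mem (s := {k | ∃ Y : Finset V, (Y : Set V) ⊆ Z ∧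
      k = H.dim n 1 (insert a Y) - H.dim n 1 Y}) ⟨_, ∅, by simp, rfl⟩ hb
    rw [h0] at h1
    obtain ⟨Y, h3, h4⟩ := h1
    refine ⟨Y, h3, DimGeometry.mem_cl.2 ?_⟩
    change H.dim n 1 _ = H.dim n 1 _
    omega
  · rintro ⟨Y, h1, h2⟩
    rw [DimGeometry.mem_cl] at h2
    change H.dim n 1 _ = H.dim n 1 _ at h2
    refine le_antisymm (csInf_le hb ⟨Y, h1, by omega⟩) ?_
    refine le_csInf ⟨_, ∅, by simp, rfl⟩ ?_
    rintro _ ⟨Y, -, rfl⟩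
    exact h.dim_singleton_union_sub_nonneg hf Y

theorem InClass.dcl_coe : H.dcl n 1 X = ((h.geometry hf).cl X : Set V) := by
  ext a
  rw [h.mem_dcl hf]
  constructor
  · rintro ⟨Y, h1, h2⟩
    exact DimGeometry.cl_mono (by exact_mod_cast h1) h2
  · intro ha
    exact ⟨X, subset_rfl, ha⟩

theorem InClass.dClosed_coe : H.DClosed n 1 X ↔ H.Closed n X := by
  rw [DClosed, h.dcl_coe hf, Finset.coe_inj, h.cl_eq_iff hf]

end

end UniformHypergraph

/-! ### Homogeneity of the generic structure -/

namespace UniformHypergraph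

variable {r n : ℕ} {f : ℝ → ℝ} {T V : Type*} [DecidableEq T] [DecidableEq V]
  {H : UniformHypergraph r V} {K : UniformHypergraph r T}
  {σ : Equiv.Perm V} {A B C W X Y : Finset V} {a b c : V} {φ : V → V}

/-- The structure induced along an injective map. -/
def comap {T₁ : Type*} (K : UniformHypergraph r T) (i : T₁ → T) (hi : Function.Injective i) :
    UniformHypergraph r T₁ where
  edges := {e | e.map ⟨i, hi⟩ ∈ K.edges}
  card_of_mem e he := by rw [← K.card_of_mem _ he, Finset.card_map]

theorem comap_embeds {T₁ : Type*} (K : UniformHypergraph r T) {i : T₁ → T}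
    (hi : Function.Injective i) (W : Finset T₁) : Embeds (K.comap i hi) K W i := by
  refine ⟨hi.injOn, fun e _ => ?_⟩
  change e.map _ ∈ K.edges ↔ _
  rw [Finset.map_eq_image]
  rfl

/-- The amalgams needed later live on finite subsets of V or of other types rather than on `Fin k`;
an enumeration of W transports the extension property to them. -/
theorem IsGeneric.realize (hf : Control r n f) (hH : H.IsGeneric n 1 f) {W C : Finset T}
    (hW : K.Good n f W) (hCW : C ⊆ W) (hC : K.Strong n C W) {g : T → V} (hg : Embeds K H C g)
    (hgC : H.Closed n (C.image g)) :
    ∃ h, Embeds K H W h ∧ (∀ x ∈ C, h x = g x) ∧ H.Closed n (W.image h) := by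
  let e := W.equivFin
  let i : Fin W.card → T := fun j => (e.symm j : T)
  have hi : Function.Injective i := Subtype.val_injective.comp e.symm.injective
  have hiW : (Finset.univ : Finset (Fin W.card)).image i = W := by
    ext x
    simp only [Finset.mem_image, Finset.mem_univ, true_and]
    constructor
    · rintro ⟨j, rfl⟩
      exact (e.symm j).2
    · intro hx
      exact ⟨e ⟨x, hx⟩, by simp [i]⟩
  set B := K.comap i hi
  have hB : Embeds B K Finset.univ i := comap_embeds K hi _
  have hBc : B.InClass n 1 f := by
    apply hf.inClass
    intro X
    have := (hB.good (X := Finset.univ) (n := n) (f := f) subset_rfl).1 (by rwa [hiW])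
    exact fun Y _ => this Y (Finset.subset_univ _)
  set A : Finset (Fin W.card) := Finset.univ.filter (fun j => i j ∈ C) with hA
  have hiA : A.image i = C := by
    ext x
    simp only [hA, Finset.mem_image, Finset.mem_filter, Finset.mem_univ, true_and]
    constructor
    · rintro ⟨j, hj, rfl⟩
      exact hj
    · intro hx
      exact ⟨e ⟨x, hCW hx⟩, by simpa [i] using hx, by simp [i]⟩
  have hAC : ∀ j ∈ A, i j ∈ C := fun j hj => (Finset.mem_filter.1 hj).2
  have hAcl : B.DClosed n 1 A := by
    rw [hBc.dClosed_coe hf]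
    intro X
    have := (hB.strong (n := n) (Finset.subset_univ A) subset_rfl).1 (by rwa [hiW, hiA])
    exact this.mono (Finset.subset_univ _)
  have hBA : Embeds B H A (g ∘ i) :=
    (hB.mono (Finset.subset_univ A)).comp (by rwa [hiA])
  let g' : (A : Set (Fin W.card)) ↪ V :=
    ⟨fun j => g (i j), fun j k hjk => Subtype.ext (hBA.1 j.2 k.2 hjk)⟩
  obtain ⟨h, h1, h2, h3⟩ := hH.extend _ B hBc A hAcl g' (by
      intro s
      change s.map _ ∈ B.edges ↔ _
      rw [hBA.2 _ (by intro x; simp only [Finset.mem_map]; rintro ⟨y, -, rfl⟩; exact y.2)]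
      rw [Finset.map_eq_image, Finset.map_eq_image, Finset.image_image]
      rfl) (by
      have : range g' = (C.image g : Finset V) := by
        rw [← hiA, Finset.image_image]
        ext x
        simp [g']
      rw [this, hH.inClass.dClosed_coe hf]
      exact hgC)
  have h1' : Embeds B H Finset.univ h := ⟨h.injective.injOn, fun s _ => by
    rw [h1 s, Finset.map_eq_image]⟩
  let h' : T → V := fun x => if hx : x ∈ W then h (e ⟨x, hx⟩) else g x
  have hh' : ∀ j, h' (i j) = h j := by
    intro j
    have : i j ∈ W := (e.symm j).2
    simp only [h', dif_pos this]
    congr 1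
    exact e.apply_symm_apply j
  have him : ∀ s : Finset (Fin W.card), (s.image i).image h' = s.image h := by
    intro s
    rw [Finset.image_image]
    exact Finset.image_congr fun x _ => hh' x
  refine ⟨h', ⟨?_, ?_⟩, ?_, ?_⟩
  · rw [← hiW]
    intro x hx y hy hxy
    simp only [Finset.coe_image, Finset.coe_univ, image_univ, Set.mem_range] at hx hy
    obtain ⟨x, rfl⟩ := hx
    obtain ⟨y, rfl⟩ := hy
    rw [hh', hh'] at hxy
    rw [h.injective hxy]
  · intro s hs
    rw [← hiW] at hs
    obtain ⟨s, -, rfl⟩ := Finset.subset_image_iff.1 hs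
    rw [him, ← hB.2 s (Finset.subset_univ _), h1'.2 s (Finset.subset_univ _)]
  · intro x hx
    rw [← hiA] at hx
    obtain ⟨j, hj, rfl⟩ := Finset.mem_image.1 hx
    rw [hh']
    exact h2 ⟨j, hj⟩
  · rw [← hH.inClass.dClosed_coe hf]
    have : ((W.image h' : Finset V) : Set V) = range h := by
      have h4 : W.image h' = Finset.univ.image h := by rw [← him, hiW]
      rw [h4]
      simp
    rw [this]
    exact h3

theorem Embeds.of_agree {K K' : UniformHypergraph r V} (h : ∀ e ⊆ W, e ∈ K.edges ↔ e ∈ K'.edges) :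
    Embeds K K' W id :=
  ⟨injOn_id _, fun e he => by rw [Finset.image_id]; exact h e he⟩

theorem Closed.inter (hf : Control r n f) (h : H.InClass n 1 f) (hA : H.Closed n A)
    (hB : H.Closed n B) : H.Closed n (A ∩ B) := by
  rw [← h.cl_eq_iff hf] at *
  refine Finset.Subset.antisymm (Finset.subset_inter ?_ ?_) DimGeometry.subset_cl
  · exact (DimGeometry.cl_mono Finset.inter_subset_left).trans hA.subset
  · exact (DimGeometry.cl_mono Finset.inter_subset_right).trans hB.subset

/-- A partial isomorphism between closed finite sets extends to any larger closed finite set. -/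
theorem IsGeneric.extend_embeds (hf : Control r n f) (hH : H.IsGeneric n 1 f)
    (hφ : Embeds H H W φ) (hW : H.Closed n W) (hφW : H.Closed n (W.image φ)) (hWX : W ⊆ X) :
    ∃ ψ : V → V, Embeds H H X ψ ∧ (∀ x ∈ W, ψ x = φ x) ∧ H.Closed n (X.image ψ) :=
  hH.realize hf (hH.inClass.good X) hWX (hW X) hφ hφW

/-- Homogeneity of the generic structure. -/
theorem IsGeneric.exists_aut (hf : Control r n f) (hH : H.IsGeneric n 1 f)
    (hφ : Embeds H H W φ) (hW : H.Closed n W) (hφW : H.Closed n (W.image φ)) :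
    ∃ σ ∈ H.aut, ∀ x ∈ W, σ x = φ x := by
  by_cases hV : Nonempty V
  swap
  · exact ⟨1, H.aut.one_mem, fun x => absurd ⟨x⟩ hV⟩
  have := hH.countable
  let P := {p : Finset V × (V → V) // Embeds H H p.1 p.2 ∧ H.Closed n p.1 ∧
    H.Closed n (p.1.image p.2)}
  let _ : Preorder P :=
    { le := fun p q => p.1.1 ⊆ q.1.1 ∧ ∀ x ∈ p.1.1, q.1.2 x = p.1.2 x
      le_refl := fun p => ⟨subset_rfl, fun _ _ => rfl⟩
      le_trans := fun p q s h1 h2 => ⟨h1.1.trans h2.1, fun x hx => by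
        rw [h2.2 x (h1.1 hx), h1.2 x hx]⟩ }
  set g := hH.inClass.geometry hf
  obtain ⟨u, hu, hu0, huD⟩ := exists_monotone_seq_meeting (P := P) ⟨⟨W, φ⟩, hφ, hW, hφW⟩
    (fun (v : V) p => v ∈ p.1.1 ∧ v ∈ p.1.1.image p.1.2) (by
      rintro v ⟨⟨X, ψ⟩, h1, h2, h3⟩
      dsimp only at h1 h2 h3
      have hX' : H.Closed n (g.cl (insert v X)) := hH.inClass.closed_cl hf
      obtain ⟨ψ', h4, h5, h6⟩ := hH.extend_embeds hf h1 h2 h3 (X := g.cl (insert v X))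
        (DimGeometry.subset_cl_of (Finset.subset_insert _ _))
      set X' := g.cl (insert v X)
      have hXX' : X ⊆ X' := DimGeometry.subset_cl_of (Finset.subset_insert _ _)
      obtain ⟨θ, h7, h8⟩ := h4.exists_inverse
      have himθ : (X'.image ψ').image θ = X' := by
        rw [Finset.image_image]
        exact (Finset.image_congr fun x hx => h8 x hx).trans Finset.image_id
      -- This is the back step: the inverse is extended to a closed set containing v and inverted
      -- again, so that v enters the range.
      set Y := g.cl (insert v (X'.image ψ'))
      have hXY : X'.image ψ' ⊆ Y := DimGeometry.subset_cl_of (Finset.subset_insert _ _)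
      have hY : H.Closed n Y := hH.inClass.closed_cl hf
      obtain ⟨θ', h9, h10, h11⟩ := hH.extend_embeds hf h7 h6 (by rwa [himθ]) hXY
      obtain ⟨ψ'', h12, h13⟩ := h9.exists_inverse
      have him : (Y.image θ').image ψ'' = Y := by
        rw [Finset.image_image]
        exact (Finset.image_congr fun x hx => h13 x hx).trans Finset.image_id
      have hθ' : ∀ x ∈ X', θ' (ψ' x) = x := fun x hx => by
        rw [h10 _ (Finset.mem_image_of_mem _ hx), h8 x hx]
      have hsub : X' ⊆ Y.image θ' := fun x hx => Finset.mem_image.2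
        ⟨ψ' x, hXY (Finset.mem_image_of_mem _ hx), hθ' x hx⟩
      have hag : ∀ x ∈ X', ψ'' x = ψ' x := fun x hx => by
        have := h13 (ψ' x) (hXY (Finset.mem_image_of_mem _ hx))
        rwa [hθ' x hx] at this
      refine ⟨⟨⟨Y.image θ', ψ''⟩, h12, h11, by rw [him]; exact hY⟩,
        ⟨hXX'.trans hsub, fun x hx => (hag x (hXX' hx)).trans (h5 x hx)⟩,
        hsub (DimGeometry.subset_cl (Finset.mem_insert_self _ _)), ?_⟩
      change v ∈ (Y.image θ').image ψ''
      rw [him]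
      exact DimGeometry.subset_cl (Finset.mem_insert_self _ _))
  choose t ht using huD
  let m : V → V := fun x => (u (t x)).1.2 x
  have hm : ∀ k, ∀ x ∈ (u k).1.1, m x = (u k).1.2 x := by
    intro k x hx
    rcases le_total k (t x) with h | h
    · exact (hu h).2 x hx
    · exact ((hu h).2 x (ht x).1).symm
  have hbig : ∀ X : Finset V, ∃ k, X ⊆ (u k).1.1 := by
    intro X
    refine ⟨X.sup t, fun x hx => (hu (Finset.le_sup hx)).1 (ht x).1⟩
  have hinj : Function.Injective m := by
    intro x y hxy
    obtain ⟨k, hk⟩ := hbig {x, y}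
    have hx : x ∈ (u k).1.1 := hk (by simp)
    have hy : y ∈ (u k).1.1 := hk (by simp)
    rw [hm k x hx, hm k y hy] at hxy
    exact (u k).2.1.1 hx hy hxy
  have hsurj : Function.Surjective m := by
    intro y
    obtain ⟨x, hx, he⟩ := Finset.mem_image.1 (ht y).2
    exact ⟨x, by rw [hm _ x hx, he]⟩
  refine ⟨Equiv.ofBijective m ⟨hinj, hsurj⟩, ?_, ?_⟩
  · rw [mem_aut_iff]
    intro e
    obtain ⟨k, hk⟩ := hbig e
    rw [(u k).2.1.2 e hk]
    have : e.image (Equiv.ofBijective m ⟨hinj, hsurj⟩) = e.image (u k).1.2 :=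
      Finset.image_congr fun x hx => hm k x (hk hx)
    rw [this]
  · intro x hx
    have h1 := hm 0 x (by rw [hu0]; exact hx)
    rw [hu0] at h1
    exact h1

end UniformHypergraph

/-! ### Free amalgams and existence of the generic structure -/

namespace UniformHypergraph

variable {r n : ℕ} {f : ℝ → ℝ} {T V : Type*} [DecidableEq T] [DecidableEq V]
  {H : UniformHypergraph r V} {B : UniformHypergraph r T} {K K' : UniformHypergraph r V}
  {X Y Z : Finset V} {A W : Finset T}

theorem good_congr (h : ∀ e ⊆ X, e ∈ K'.edges ↔ e ∈ K.edges) :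
    K'.Good n f X ↔ K.Good n f X := by
  have := (Embeds.of_agree h).good (n := n) (f := f) (X := X) subset_rfl
  rwa [Finset.image_id, Iff.comm] at this

theorem strong_congr (h : ∀ e ⊆ X, e ∈ K'.edges ↔ e ∈ K.edges) (hY : Y ⊆ X) :
    K'.Strong n Y X ↔ K.Strong n Y X := by
  have := (Embeds.of_agree h).strong (n := n) hY subset_rfl
  rwa [Finset.image_id, Finset.image_id, Iff.comm] at this

theorem Good.strong_empty (hf : Control r n f) (h : K.Good n f X) : K.Strong n ∅ X := by
  intro Y h1 h2
  have h3 := h Y h2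
  have h4 := hf.le_of_one_le Y.card (Finset.card_pos.2 (Finset.nonempty_iff_ne_empty.2 h1.ne'))
  have h5 : (0 : ℝ) < n := mod_cast hf.pos
  have h6 : K.predim n 1 ∅ = 0 := by
    have : K.edgesIn ∅ = ∅ := by
      rw [Finset.eq_empty_iff_forall_notMem]
      intro e he
      rw [mem_edgesIn, Finset.subset_empty] at he
      have := K.card_of_mem _ he.2
      rw [he.1, Finset.card_empty] at this
      rcases hf.param with h | h <;> omega
    simp [predim_eq, this]
  rw [h6]
  have h7 : (0 : ℝ) < K.predim n 1 Y := by linarith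
  exact_mod_cast h7

theorem good_of_no_edges (hf : Control r n f) (h : ∀ e ⊆ X, e ∉ K.edges) : K.Good n f X := by
  intro Y hY
  have : K.edgesIn Y = ∅ := by
    rw [Finset.eq_empty_iff_forall_notMem]
    intro e he
    rw [mem_edgesIn] at he
    exact h e (he.1.trans hY) he.2
  rw [predim_eq, this]
  have := hf.le_mul Y.card
  simpa using this

theorem exists_fresh_map [Infinite V] {g : T → V} (hg : InjOn g A) (hX : A.image g ⊆ X) :
    ∃ h : T → V, InjOn h W ∧ (∀ x ∈ A, h x = g x) ∧ ∀ x ∈ W, h x ∈ X → x ∈ A := by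
  let i := X.finite_toSet.infinite_compl.natEmbedding
  have hi : ∀ k, (i k : V) ∉ X := fun k => (i k).2
  let e := W.equivFin
  refine ⟨fun x => if x ∈ A then g x else if hx : x ∈ W then i (e ⟨x, hx⟩) else g x, ?_, ?_, ?_⟩
  · intro x hx y hy hxy
    have hx : x ∈ W := hx
    have hy : y ∈ W := hy
    have hgX : ∀ x ∈ A, g x ∈ X := fun x hx => hX (Finset.mem_image_of_mem _ hx)
    by_cases h1 : x ∈ A <;> by_cases h2 : y ∈ A
    · simp only [h1, h2, if_true] at hxy
      exact hg h1 h2 hxy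
    · simp only [h1, h2, hx, hy, if_true, if_false, dif_pos] at hxy
      exact absurd (hxy ▸ hgX x h1) (hi _)
    · simp only [h1, h2, hx, hy, if_true, if_false, dif_pos] at hxy
      exact absurd (hxy.symm ▸ hgX y h2) (hi _)
    · simp only [h1, h2, hx, hy, if_false, dif_pos] at hxy
      have h3 := e.injective (Fin.val_injective (i.injective (Subtype.ext hxy)))
      exact congrArg Subtype.val h3
  · intro x hx
    simp [hx]
  · intro x hx hxX
    by_contra h1
    simp only [h1, hx, if_false, dif_pos] at hxX
    exact hi _ hxX

/-- The free amalgam of a set `X` with a structure `B` over a common strong substructure `A`,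
realised on fresh points. -/
theorem exists_free_amalgam [Infinite V] (hf : Control r n f) (hX : K.Good n f X)
    (hW : B.Good n f W) (hA : A ⊆ W) (hAW : B.Strong n A W) {g : T → V} (hg : Embeds B K A g)
    (hgX : A.image g ⊆ X) (hs : K.Strong n (A.image g) X) :
    ∃ (K' : UniformHypergraph r V) (h : T → V), (∀ e ⊆ X, e ∈ K'.edges ↔ e ∈ K.edges) ∧
      Embeds B K' W h ∧ (∀ x ∈ A, h x = g x) ∧ X ∩ W.image h = A.image g ∧
      K'.NoCross X (W.image h) ∧ K'.Good n f (X ∪ W.image h) ∧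
      K'.Strong n X (X ∪ W.image h) ∧ K'.Strong n (W.image h) (X ∪ W.image h) := by
  obtain ⟨h, hinj, hhg, hfresh⟩ := exists_fresh_map (W := W) hg.1 hgX
  have hsA : ∀ s ⊆ W, s.image h ⊆ X → s ⊆ A := fun s hs h1 x hx =>
    hfresh x (hs hx) (h1 (Finset.mem_image_of_mem _ hx))
  have himg : ∀ s ⊆ A, s.image h = s.image g := fun s hs =>
    Finset.image_congr fun x hx => hhg x (hs hx)
  let K' : UniformHypergraph r V :=
    { edges := {e | (e ⊆ X ∧ e ∈ K.edges) ∨ ∃ s ⊆ W, s ∈ B.edges ∧ s.image h = e}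
      card_of_mem := by
        rintro e (⟨-, he⟩ | ⟨s, hs, he, rfl⟩)
        · exact K.card_of_mem e he
        · rw [Finset.card_image_of_injOn (hinj.mono (Finset.coe_subset.2 hs)),
            B.card_of_mem s he] }
  have hagree : ∀ e ⊆ X, e ∈ K'.edges ↔ e ∈ K.edges := by
    intro e he
    constructor
    · rintro (⟨-, h1⟩ | ⟨s, hs, h1, rfl⟩)
      · exact h1
      · have h2 := hsA s hs he
        rw [himg s h2]
        exact (hg.2 s h2).1 h1
    · exact fun h1 => Or.inl ⟨he, h1⟩
  have hemb : Embeds B K' W h := by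
    refine ⟨hinj, fun s hs => ⟨fun h1 => Or.inr ⟨s, hs, h1, rfl⟩, ?_⟩⟩
    rintro (⟨h1, h2⟩ | ⟨t, ht, h1, h2⟩)
    · have h3 := hsA s hs h1
      rw [himg s h3] at h2
      exact (hg.2 s h3).2 h2
    · have : t = s := by
        apply Finset.coe_injective
        apply (hinj.image_eq_image_iff (Finset.coe_subset.2 ht) (Finset.coe_subset.2 hs)).1
        rw [← Finset.coe_image, ← Finset.coe_image, h2]
      rwa [← this]
  have hinter : X ∩ W.image h = A.image g := by
    rw [← himg A subset_rfl]
    ext y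
    simp only [Finset.mem_inter, Finset.mem_image]
    constructor
    · rintro ⟨h1, x, hx, rfl⟩
      exact ⟨x, hfresh x hx h1, rfl⟩
    · rintro ⟨x, hx, rfl⟩
      refine ⟨hgX ?_, x, hA hx, rfl⟩
      rw [hhg x hx]
      exact Finset.mem_image_of_mem _ hx
  have hnc : K'.NoCross X (W.image h) := by
    rintro e (⟨h1, -⟩ | ⟨s, hs, -, rfl⟩) -
    · exact Or.inl h1
    · exact Or.inr (Finset.image_subset_image hs)
  have hs1 : K'.Strong n (X ∩ W.image h) X := by
    rw [hinter, strong_congr hagree hgX]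
    exact hs
  have hs2 : K'.Strong n (X ∩ W.image h) (W.image h) := by
    rw [hinter, ← himg A subset_rfl, hemb.strong hA subset_rfl]
    exact hAW
  refine ⟨K', h, hagree, hemb, hhg, hinter, hnc, ?_, hnc.strong hs2, ?_⟩
  · exact hnc.good hf ((good_congr hagree).2 hX) ((hemb.good subset_rfl).2 hW) hs1 hs2
  · rw [Finset.union_comm]
    exact hnc.symm.strong (by rwa [Finset.inter_comm])

/-- Adding isolated points. -/
theorem exists_add_points (hf : Control r n f) (hX : K.Good n f X) (hXY : X ⊆ Y) :
    ∃ K' : UniformHypergraph r V, (∀ e ⊆ X, e ∈ K'.edges ↔ e ∈ K.edges) ∧ K'.Good n f Y ∧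
      K'.Strong n X Y := by
  let K' : UniformHypergraph r V :=
    { edges := {e | e ⊆ X ∧ e ∈ K.edges}
      card_of_mem := fun e he => K.card_of_mem e he.2 }
  have hagree : ∀ e ⊆ X, e ∈ K'.edges ↔ e ∈ K.edges := fun e he => ⟨And.right, fun h => ⟨he, h⟩⟩
  have hX' := (good_congr (n := n) (f := f) hagree).2 hX
  have hnc : K'.NoCross X (Y \ X) := fun e he _ => Or.inl he.1
  have hg : K'.Good n f (Y \ X) := by
    apply good_of_no_edges hf
    intro e he h
    have h1 : e = ∅ := Finset.subset_empty.1 fun x hx =>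
      absurd (h.1 hx) (Finset.mem_sdiff.1 (he hx)).2
    have h2 := K'.card_of_mem e h
    rw [h1, Finset.card_empty] at h2
    rcases hf.param with h | h <;> omega
  have hi : X ∩ (Y \ X) = ∅ := Finset.inter_sdiff_self _ _
  have h1 := hnc.good hf hX' hg (by rw [hi]; exact hX'.strong_empty hf)
    (by rw [hi]; exact hg.strong_empty hf)
  have h2 := hnc.strong (n := n) (by rw [hi]; exact hg.strong_empty hf)
  rw [Finset.union_sdiff_of_subset hXY] at h1 h2
  exact ⟨K', hagree, h1, h2⟩

instance {α : Type*} [Finite α] : Finite (UniformHypergraph r α) :=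
  Finite.of_injective edges fun K L h => by
    cases K
    cases L
    simpa using h

/-- The generic structure exists. -/
theorem Control.exists_isGeneric (hf : Control r n f) :
    ∃ H : UniformHypergraph r ℕ, H.IsGeneric n 1 f := by
  classical
  let P := {p : Finset ℕ × UniformHypergraph r ℕ // p.2.Good n f p.1}
  let _ : Preorder P :=
    { le := fun p q => p.1.1 ⊆ q.1.1 ∧
        (∀ e ⊆ p.1.1, e ∈ q.1.2.edges ↔ e ∈ p.1.2.edges) ∧ q.1.2.Strong n p.1.1 q.1.1
      le_refl := fun p => ⟨subset_rfl, fun _ _ => Iff.rfl, fun Y h1 h2 =>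
        absurd h2 h1.not_subset⟩
      le_trans := fun p q s h1 h2 => ⟨h1.1.trans h2.1, fun e he => by
        rw [h2.2.1 e (he.trans h1.1), h1.2.1 e he],
        Strong.trans ((strong_congr h2.2.1 h1.1).2 h1.2.2) h1.1 h2.2.2 h2.1⟩ }
  let ι := Σ k : ℕ, UniformHypergraph r (Fin k) × Finset (Fin k) × (Fin k → ℕ)
  -- If g embeds A strongly into the current stage, then it must extend strongly to B inside the
  -- stage. The first clause puts the range of g into the stage, and with constant g this makes the
  -- stages exhaust ℕ.
  let D : ι → P → Prop := fun i p =>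
    Finset.univ.image i.2.2.2 ⊆ p.1.1 ∧
      (i.2.1.Good n f Finset.univ → i.2.1.Strong n i.2.2.1 Finset.univ →
        Embeds i.2.1 p.1.2 i.2.2.1 i.2.2.2 → p.1.2.Strong n (i.2.2.1.image i.2.2.2) p.1.1 →
        ∃ h : Fin i.1 → ℕ, Embeds i.2.1 p.1.2 Finset.univ h ∧
          (∀ x ∈ i.2.2.1, h x = i.2.2.2 x) ∧ Finset.univ.image h ⊆ p.1.1 ∧
          p.1.2.Strong n (Finset.univ.image h) p.1.1)
  let K₀ : UniformHypergraph r ℕ := ⟨∅, fun e he => absurd he (Set.notMem_empty e)⟩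
  obtain ⟨u, hu, -, huD⟩ := exists_monotone_seq_meeting (P := P) ⟨⟨∅, K₀⟩,
    good_of_no_edges hf fun e _ he => Set.notMem_empty e he⟩ D (by
      rintro ⟨k, B, A, g⟩ p
      obtain ⟨K₁, h1, h2, h3⟩ := exists_add_points hf p.2
        (Finset.subset_union_left (s₁ := p.1.1) (s₂ := Finset.univ.image g))
      let q : P := ⟨⟨p.1.1 ∪ Finset.univ.image g, K₁⟩, h2⟩
      have hpq : p ≤ q := ⟨Finset.subset_union_left, h1, h3⟩
      by_cases hyp : B.Good n f Finset.univ ∧ B.Strong n A Finset.univ ∧ Embeds B K₁ A g ∧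
        K₁.Strong n (A.image g) q.1.1
      swap
      · exact ⟨q, hpq, Finset.subset_union_right, fun a b c d => absurd ⟨a, b, c, d⟩ hyp⟩
      obtain ⟨a, b, c, d⟩ := hyp
      obtain ⟨K', h, e1, e2, e3, -, -, e4, e5, e6⟩ := exists_free_amalgam hf h2 a
        (Finset.subset_univ A) b c ((Finset.image_subset_image (Finset.subset_univ A)).trans
          Finset.subset_union_right) d
      refine ⟨⟨⟨q.1.1 ∪ Finset.univ.image h, K'⟩, e4⟩,
        hpq.trans ⟨Finset.subset_union_left, e1, e5⟩,
        (Finset.subset_union_right (s₁ := p.1.1)).trans Finset.subset_union_left,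
        fun _ _ _ _ => ⟨h, e2, e3, Finset.subset_union_right, e6⟩⟩)
  have hbig : ∀ X : Finset ℕ, ∃ k, X ⊆ (u k).1.1 := by
    intro X
    have hpt : ∀ x, ∃ k, x ∈ (u k).1.1 := by
      intro x
      obtain ⟨k, hk, -⟩ := huD ⟨1, ⟨∅, fun e he => absurd he (Set.notMem_empty e)⟩, ∅, fun _ => x⟩
      exact ⟨k, hk (by simp)⟩
    choose t ht using hpt
    exact ⟨X.sup t, fun x hx => (hu (Finset.le_sup hx)).1 (ht x)⟩
  let M : UniformHypergraph r ℕ :=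
    { edges := {e | ∃ k, e ⊆ (u k).1.1 ∧ e ∈ (u k).1.2.edges}
      card_of_mem := fun e ⟨k, _, he⟩ => (u k).1.2.card_of_mem e he }
  have hM : ∀ k, ∀ e ⊆ (u k).1.1, e ∈ M.edges ↔ e ∈ (u k).1.2.edges := by
    intro k e he
    refine ⟨?_, fun h => ⟨k, he, h⟩⟩
    rintro ⟨l, h1, h2⟩
    rcases le_total k l with h | h
    · exact ((hu h).2.1 e he).1 h2
    · exact ((hu h).2.1 e h1).2 h2
  have hMc : M.InClass n 1 f := by
    apply hf.inClass
    intro X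
    obtain ⟨k, hk⟩ := hbig X
    exact fun Y hY => (good_congr (hM k)).2 (u k).2 Y (hY.trans hk)
  -- Stages are strong in all later ones, so strength within one stage becomes closedness in the
  -- union.
  have hclosed : ∀ k (X : Finset ℕ), X ⊆ (u k).1.1 → (u k).1.2.Strong n X (u k).1.1 →
      M.Closed n X := by
    intro k X hX hs W Y h1 h2
    obtain ⟨l, hl⟩ := hbig (W ∪ (u k).1.1)
    have hkl : (u k).1.1 ⊆ (u l).1.1 := Finset.subset_union_right.trans hl
    let m := max k l
    have h3 := hu (le_max_left k l)
    have h4 := hu (le_max_right k l)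
    have h5 : (u m).1.2.Strong n X (u m).1.1 :=
      Strong.trans ((strong_congr h3.2.1 hX).2 hs) hX h3.2.2 h3.1
    have h6 := (strong_congr (hM m) (hX.trans h3.1)).2 h5
    exact h6 Y h1 (h2.trans (Finset.subset_union_left.trans (hl.trans h4.1)))
  refine ⟨M, inferInstance, hMc, ?_⟩
  intro k B hB A hA g hg hgc
  set A' := A.toFinset with hA'
  have hAA : A = (A' : Set (Fin k)) := by simp [A']
  let g' : Fin k → ℕ := fun j => if hj : j ∈ A then g ⟨j, hj⟩ else 0
  have hg' : ∀ j : A, g' j = g j := fun j => by simp [g']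
  have hmem : ∀ j, j ∈ A' → j ∈ A := fun j hj => by simpa [A'] using hj
  have hE : Embeds B M A' g' := by
    refine ⟨?_, ?_⟩
    · intro x hx y hy hxy
      have h1 := hg' ⟨x, hmem x hx⟩
      have h2 := hg' ⟨y, hmem y hy⟩
      dsimp only at h1 h2
      rw [h1, h2] at hxy
      exact congrArg Subtype.val (g.injective hxy)
    · intro e he
      have h1 : (e.subtype (· ∈ A)).map (Function.Embedding.subtype _) = e := by
        rw [Finset.subtype_map, Finset.filter_true_of_mem fun x hx => hmem x (he hx)]
      have h2 : (e.subtype (· ∈ A)).map g = e.image g' := by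
        conv_rhs => rw [← h1]
        rw [Finset.map_eq_image, Finset.map_eq_image, Finset.image_image]
        exact Finset.image_congr fun x _ => (hg' x).symm
      have h3 := hg (e.subtype (· ∈ A))
      rw [h2] at h3
      rw [← h3]
      change _ ↔ (e.subtype (· ∈ A)).map (Function.Embedding.subtype _) ∈ B.edges
      rw [h1]
  have hrange : range g = (A'.image g' : Finset ℕ) := by
    ext x
    simp only [Set.mem_range, Finset.coe_image, Set.mem_image, ← hAA]
    constructor
    · rintro ⟨j, rfl⟩
      exact ⟨j, j.2, hg' j⟩
    · rintro ⟨j, hj, rfl⟩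
      exact ⟨⟨j, hj⟩, (hg' ⟨j, hj⟩).symm⟩
  rw [hrange, hMc.dClosed_coe hf] at hgc
  rw [hAA, hB.dClosed_coe hf] at hA
  obtain ⟨l, hl1, hl2⟩ := huD ⟨k, B, A', g'⟩
  have hsub : A'.image g' ⊆ (u l).1.1 :=
    (Finset.image_subset_image (Finset.subset_univ _)).trans hl1
  obtain ⟨h, h1, h2, h3, h4⟩ := hl2 (hB.good _) (hA _)
    ⟨hE.1, fun e he => by
      rw [hE.2 e he, hM l _ ((Finset.image_subset_image he).trans hsub)]⟩
    ((strong_congr (hM l) hsub).1 (hgc _))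
  refine ⟨⟨h, fun x y hxy => h1.1 (by simp) (by simp) hxy⟩, ?_, ?_, ?_⟩
  · intro e
    rw [h1.2 e (Finset.subset_univ _), Finset.map_eq_image,
      ← hM l _ ((Finset.image_subset_image (Finset.subset_univ _)).trans h3)]
    rfl
  · intro a
    rw [← hg' a]
    exact h2 a (by simp [A'])
  · have : range h = (Finset.univ.image h : Finset ℕ) := by simp
    change M.DClosed n 1 (range h)
    rw [this, hMc.dClosed_coe hf]
    exact hclosed l _ h3 h4

end UniformHypergraph

/-! ### Free independence in the generic structure -/

namespace UniformHypergraph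

variable {r n : ℕ} {f : ℝ → ℝ} {T V : Type*} [DecidableEq T] [DecidableEq V]
  {H : UniformHypergraph r V} {K : UniformHypergraph r T}
  {A B C W X Y : Finset V} {a b c : V} {σ τ : Equiv.Perm V}

theorem Closed.of_strong (hB : H.Closed n B) (h : H.Strong n A B) (hAB : A ⊆ B) :
    H.Closed n A := fun W =>
  (h.trans hAB (hB (B ∪ W)) Finset.subset_union_left).mono Finset.subset_union_right

theorem Embeds.noCross {X Y : Finset T} {φ : T → V} (h : Embeds K H (X ∪ Y) φ)
    (hnc : K.NoCross X Y) : H.NoCross (X.image φ) (Y.image φ) := by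
  intro e he hs
  rw [← Finset.image_union] at hs
  obtain ⟨s, hs', rfl⟩ := Finset.subset_image_iff.1 hs
  have hs' : s ⊆ X ∪ Y := mod_cast hs'
  rcases hnc s ((h.2 s hs').2 he) hs' with h1 | h1
  · exact Or.inl (Finset.image_subset_image h1)
  · exact Or.inr (Finset.image_subset_image h1)

theorem predim_singleton_le : H.predim n 1 {a} ≤ n := by
  rw [predim_eq, Finset.card_singleton]
  omega

theorem InClass.closed_empty (hf : Control r n f) (h : H.InClass n 1 f) : H.Closed n ∅ :=
  fun W => (h.good W).strong_empty hf

/-- The condition n < f(2) is used here: two or more points have δ > n ≥ δ({a}). -/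
theorem InClass.closed_singleton (hf : Control r n f) (h : H.InClass n 1 f) (a : V) :
    H.Closed n {a} := by
  intro W Y h1 h2
  have h3 := hf.lt_of_two_le Y.card (by
    have := Finset.card_lt_card h1
    rw [Finset.card_singleton] at this
    omega)
  have h4 := predim_singleton_le (n := n) (H := H) (a := a)
  have h5 : (n : ℝ) < H.predim n 1 Y := h3.trans_le (h Y).2
  have h6 : (n : ℤ) < H.predim n 1 Y := by exact_mod_cast h5
  omega

theorem InClass.predim_insert_le (h : H.InClass n 1 f) (a : V) (X : Finset V) :
    H.predim n 1 (insert a X) ≤ H.predim n 1 X + n := by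
  have h1 := predim_submod n H {a} X
  have h2 := predim_singleton_le (n := n) (H := H) (a := a)
  have h3 := (h ({a} ∩ X)).1
  rw [← Finset.insert_eq] at h1
  omega

theorem InClass.dim_insert_le (h : H.InClass n 1 f) (a : V) (X : Finset V) :
    H.dim n 1 (insert a X) ≤ H.dim n 1 X + n := by
  obtain ⟨Y, h1, h2⟩ := h.exists_dim_eq X
  have h3 := h.dim_le (Finset.insert_subset_insert a h1)
  have h4 := h.predim_insert_le a Y
  omega

section

variable (hf : Control r n f) (h : H.InClass n 1 f)
include hf h

/-- On closures d and δ agree, so the dimension part of independence says that δ is modular on the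
two closures. -/
theorem InClass.noCross_of_ind (hi : (h.geometry hf).Ind A C B) :
    H.NoCross ((h.geometry hf).cl (A ∪ C)) ((h.geometry hf).cl (B ∪ C)) := by
  rw [predim_modular_iff (n := n), hi.inter, ← hi.cl_eq, h.predim_cl hf, h.predim_cl hf,
    h.predim_cl hf, h.predim_cl hf]
  exact hi.2

theorem InClass.ind_of_noCross
    (hcl : H.Closed n ((h.geometry hf).cl (A ∪ C) ∪ (h.geometry hf).cl (B ∪ C)))
    (hi : (h.geometry hf).cl (A ∪ C) ∩ (h.geometry hf).cl (B ∪ C) = (h.geometry hf).cl C)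
    (hnc : H.NoCross ((h.geometry hf).cl (A ∪ C)) ((h.geometry hf).cl (B ∪ C))) :
    (h.geometry hf).Ind A C B := by
  have h1 : (h.geometry hf).cl (A ∪ B ∪ C) =
      (h.geometry hf).cl (A ∪ C) ∪ (h.geometry hf).cl (B ∪ C) := by
    apply Finset.Subset.antisymm
    · rw [← (h.cl_eq_iff hf).2 hcl]
      apply DimGeometry.cl_mono
      have h2 := DimGeometry.subset_cl (S := h.geometry hf) (X := A ∪ C)
      have h3 := DimGeometry.subset_cl (S := h.geometry hf) (X := B ∪ C)
      grind
    · exact Finset.union_subset (DimGeometry.cl_mono (by grind)) (DimGeometry.cl_mono (by grind))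
  refine ⟨h1.subset, ?_⟩
  rw [predim_modular_iff (n := n), hi, ← h1, h.predim_cl hf, h.predim_cl hf,
    h.predim_cl hf, h.predim_cl hf] at hnc
  exact hnc

/-- With no crossing hyperedges δ splits over the traces of X on the two sides, and traces on closed
sets are closed, so δ is d there. -/
theorem InClass.modular (hi : (h.geometry hf).Ind A C B) (hX : (h.geometry hf).cl X = X)
    (hs : X ⊆ (h.geometry hf).cl (A ∪ B ∪ C)) :
    H.dim n 1 X + H.dim n 1 (X ∩ (h.geometry hf).cl C) =
      H.dim n 1 (X ∩ (h.geometry hf).cl (A ∪ C)) +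
        H.dim n 1 (X ∩ (h.geometry hf).cl (B ∪ C)) := by
  rw [hi.cl_eq] at hs
  have h1 := (h.noCross_of_ind hf hi).predim_inter (n := n) hs
  rw [Finset.inter_assoc, hi.inter] at h1
  have hX' := (h.cl_eq_iff hf).1 hX
  rw [Closed.dim_eq h hX', Closed.dim_eq h (hX'.inter hf h (h.closed_cl hf)),
    Closed.dim_eq h (hX'.inter hf h (h.closed_cl hf)),
    Closed.dim_eq h (hX'.inter hf h (h.closed_cl hf))]
  exact h1

end

section

variable (hf : Control r n f) (hH : H.IsGeneric n 1 f)
include hf hH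

/-- Edgeless hypergraphs of every finite size belong to the class and embed. -/
theorem IsGeneric.infinite : Infinite V := by
  by_contra hfin
  rw [not_infinite_iff_finite] at hfin
  have := Fintype.ofFinite V
  let K : UniformHypergraph r ℕ := ⟨∅, fun e he => absurd he (Set.notMem_empty e)⟩
  have hV : IsEmpty V ∨ Nonempty V := isEmpty_or_nonempty V
  have hg : K.Good n f (Finset.range (Fintype.card V + 1)) :=
    good_of_no_edges hf fun e _ he => Set.notMem_empty e he
  have hne : Nonempty V := by
    rcases hV with hV | hV
    · obtain ⟨h, -, -⟩ := hH.extend 1 ⟨∅, fun e he => absurd he (Set.notMem_empty e)⟩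
        (hf.inClass fun W => good_of_no_edges hf fun e _ he => Set.notMem_empty e he) ∅ (by
          have := (InClass.dClosed_coe hf (hf.inClass (H := (⟨∅, fun e he =>
            absurd he (Set.notMem_empty e)⟩ : UniformHypergraph r (Fin 1)))
            fun W => good_of_no_edges hf fun e _ he => Set.notMem_empty e he) (X := ∅)).2
            (InClass.closed_empty hf (hf.inClass
              fun W => good_of_no_edges hf fun e _ he => Set.notMem_empty e he))
          simpa using this) (Function.Embedding.ofIsEmpty) (by
          intro e
          rw [Finset.eq_empty_of_isEmpty e, Finset.map_empty]
          constructor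
          · intro he
            exact absurd he (Set.notMem_empty _)
          · intro he
            have := H.card_of_mem _ he
            rw [Finset.card_empty] at this
            rcases hf.param with h | h <;> omega) (by
          have := (InClass.dClosed_coe hf hH.inClass (X := ∅)).2
            (InClass.closed_empty hf hH.inClass)
          rwa [Set.range_eq_empty, ← Finset.coe_empty])
      exact ⟨h 0⟩
    · exact hV
  obtain ⟨v⟩ := hne
  obtain ⟨h, h1, -, -⟩ := hH.realize hf hg (Finset.empty_subset _) (hg.strong_empty hf)
    (g := fun _ => v) ⟨by simp, by
      intro e he
      rw [Finset.subset_empty.1 he, Finset.image_empty]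
      constructor
      · intro he
        exact absurd he (Set.notMem_empty _)
      · intro he
        have := H.card_of_mem _ he
        rw [Finset.card_empty] at this
        rcases hf.param with h | h <;> omega⟩
    (by rw [Finset.image_empty]; exact InClass.closed_empty hf hH.inClass)
  have h2 := h1.card_image subset_rfl
  have h3 := Finset.card_le_univ ((Finset.range (Fintype.card V + 1)).image h)
  rw [h2, Finset.card_range] at h3
  omega

/-- The free amalgam of cl(A ∪ C) and cl(B ∪ C) over cl C is realized over the actual cl(B ∪ C). The
new copy of cl(A ∪ C) is closed, so homogeneity supplies the automorphism. -/
theorem IsGeneric.exists_ind (A C B : Finset V) :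
    ∃ σ ∈ (hH.inClass.geometry hf).fix C, (hH.inClass.geometry hf).Ind (σ • A) C B := by
  have := hH.infinite hf
  set S := hH.inClass.geometry hf with hS
  set W := S.cl (A ∪ C) with hW
  set X := S.cl (B ∪ C) with hX
  have hCW : S.cl C ⊆ W := DimGeometry.cl_mono Finset.subset_union_right
  have hCX : S.cl C ⊆ X := DimGeometry.cl_mono Finset.subset_union_right
  have hCc : H.Closed n (S.cl C) := hH.inClass.closed_cl hf
  have hWc : H.Closed n W := hH.inClass.closed_cl hf
  have hXc : H.Closed n X := hH.inClass.closed_cl hf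
  obtain ⟨K', g, h1, h2, h3, h4, h5, h6, h7, h8⟩ := exists_free_amalgam (K := H) (B := H)
    (A := S.cl C) (W := W) (X := X) (g := id) hf (hH.inClass.good X) (hH.inClass.good W) hCW
    (hCc W) (Embeds.of_agree fun _ _ => Iff.rfl) (by rwa [Finset.image_id])
    (by rw [Finset.image_id]; exact hCc X)
  rw [Finset.image_id] at h4
  obtain ⟨θ, t1, t2, t3⟩ := hH.realize hf h6 Finset.subset_union_left h7
    (g := id) (Embeds.of_agree h1) (by rwa [Finset.image_id])
  have hφ : Embeds H H W (θ ∘ g) := h2.comp (t1.mono Finset.subset_union_right)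
  have hWim : W.image (θ ∘ g) = (W.image g).image θ := Finset.image_image.symm
  have hφc : H.Closed n (W.image (θ ∘ g)) := by
    rw [hWim]
    exact t3.of_strong ((t1.strong Finset.subset_union_right subset_rfl).2 h8)
      (Finset.image_subset_image Finset.subset_union_right)
  obtain ⟨σ, hσ, hσφ⟩ := hH.exists_aut hf hφ hWc hφc
  have hfix : σ ∈ S.fix C := by
    refine ⟨hσ, fun c hc => ?_⟩
    rw [hσφ c (hCW hc), Function.comp_apply, h3 c hc]
    exact t2 c (hCX hc)
  have hXim : X.image θ = X := (Finset.image_congr fun x hx => t2 x hx).trans Finset.image_id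
  have hcl : S.cl (σ • A ∪ C) = (W.image g).image θ := by
    have e1 : σ • A ∪ C = σ • (A ∪ C) := by
      rw [Finset.smul_finset_union, DimGeometry.smul_of_mem_fix' hfix subset_rfl]
    rw [e1, DimGeometry.smul_cl (S := S) hσ, ← hWim]
    exact Finset.image_congr fun x hx => hσφ x hx
  refine ⟨σ, hfix, hH.inClass.ind_of_noCross hf ?_ ?_ ?_⟩
  · rw [← hS, hcl, ← hX, Finset.union_comm]
    rwa [Finset.image_union, hXim] at t3
  · rw [← hS, hcl, ← hX, Finset.inter_comm]
    conv_lhs => rw [← hXim]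
    rw [← t1.inter_image Finset.subset_union_left Finset.subset_union_right, h4]
    exact (Finset.image_congr fun x hx => t2 x (hCX hx)).trans Finset.image_id
  · rw [← hS, hcl, ← hX]
    have := (t1.noCross h5).symm
    rwa [hXim] at this

/-- Both closed unions are free amalgams over cl C, so the identity on cl(B ∪ C) and τ on cl(A ∪ C)
glue to an isomorphism between them, which extends by homogeneity. -/
theorem IsGeneric.stationary (hτ : τ ∈ (hH.inClass.geometry hf).fix C)
    (h1 : (hH.inClass.geometry hf).Ind A C B)
    (h2 : (hH.inClass.geometry hf).Ind (τ • A) C B) :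
    ∃ σ ∈ (hH.inClass.geometry hf).fix (B ∪ C), ∀ a ∈ A, σ a = τ a := by
  have n1 := hH.inClass.noCross_of_ind hf h1
  have n2 := hH.inClass.noCross_of_ind hf h2
  have c1 : H.Closed n ((hH.inClass.geometry hf).cl (A ∪ B ∪ C)) := hH.inClass.closed_cl hf
  have c2 : H.Closed n ((hH.inClass.geometry hf).cl (τ • A ∪ B ∪ C)) := hH.inClass.closed_cl hf
  rw [h1.cl_eq] at c1
  rw [h2.cl_eq] at c2
  have i1 := h1.inter
  have i2 := h2.inter
  set S := hH.inClass.geometry hf with hS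
  have e1 : S.cl (τ • A ∪ C) = τ • S.cl (A ∪ C) := by
    rw [← DimGeometry.smul_cl (S := S) hτ.1, Finset.smul_finset_union,
      DimGeometry.smul_of_mem_fix' hτ subset_rfl]
  rw [e1] at n2 c2 i2
  set W := S.cl (A ∪ C)
  set X := S.cl (B ∪ C)
  set D := S.cl C
  have hDW : D ⊆ W := i1 ▸ Finset.inter_subset_left
  have hDX : D ⊆ X := i1 ▸ Finset.inter_subset_right
  let φ : V → V := fun x => if x ∈ X then x else τ x
  have hφX : ∀ x ∈ X, φ x = x := fun x hx => if_pos hx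
  have hφW : ∀ x ∈ W, φ x = τ x := by
    intro x hx
    by_cases hx' : x ∈ X
    · rw [hφX x hx', hτ.2 x (by change x ∈ D; rw [← i1]; exact Finset.mem_inter.2 ⟨hx, hx'⟩)]
    · exact if_neg hx'
  have hback : ∀ x ∈ W, τ x ∈ X → x ∈ D := by
    intro x hx hx'
    have h3 : τ x ∈ D := by
      rw [← i2]
      exact Finset.mem_inter.2 ⟨Finset.smul_mem_smul_finset hx, hx'⟩
    have h4 := hτ.2 _ h3
    rwa [← τ.injective h4]
  have hτX : ∀ x ∈ X, x ∈ τ • W → x ∈ D := by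
    intro x hx hx'
    rw [← i2]
    exact Finset.mem_inter.2 ⟨hx', hx⟩
  have him : (W ∪ X).image φ = τ • W ∪ X := by
    rw [Finset.image_union, Finset.image_congr fun x hx => hφW x hx,
      Finset.image_congr fun x hx => hφX x hx]
    congr 1
    exact Finset.image_id
  have hEW : Embeds H H W φ := (embeds_of_mem_aut hτ.1 W).congr hφW
  have hEX : Embeds H H X φ :=
    (Embeds.of_agree (K := H) (K' := H) fun _ _ => Iff.rfl).congr hφX
  have hE : Embeds H H (W ∪ X) φ := by
    refine ⟨?_, ?_⟩
    · have key : ∀ x ∈ W, ∀ y ∈ X, φ x = φ y → x = y := by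
        intro x hx y hy hxy
        apply hEX.1 _ hy hxy
        apply hDX
        apply hback x hx
        rw [← hφW x hx, hxy, hφX y hy]
        exact hy
      intro x hx y hy hxy
      simp only [Finset.coe_union, Set.mem_union, Finset.mem_coe] at hx hy
      rcases hx with hx | hx <;> rcases hy with hy | hy
      · exact hEW.1 hx hy hxy
      · exact key x hx y hy hxy
      · exact (key y hy x hx hxy.symm).symm
      · exact hEX.1 hx hy hxy
    · intro e he
      constructor
      · intro h3
        rcases n1 e h3 he with h4 | h4
        · exact (hEW.2 e h4).1 h3
        · exact (hEX.2 e h4).1 h3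
      · intro h3
        rcases n2 _ h3 (him ▸ Finset.image_subset_image he) with h4 | h4
        · refine (hEW.2 e fun x hx => ?_).2 h3
          have h5 := h4 (Finset.mem_image_of_mem φ hx)
          rcases Finset.mem_union.1 (he hx) with h6 | h6
          · exact h6
          · rw [hφX x h6] at h5
            exact hDW (hτX x h6 h5)
        · refine (hEX.2 e fun x hx => ?_).2 h3
          have h5 := h4 (Finset.mem_image_of_mem φ hx)
          rcases Finset.mem_union.1 (he hx) with h6 | h6
          · rw [hφW x h6] at h5
            exact hDX (hback x h6 h5)
          · exact h6
  obtain ⟨σ, hσ, hσφ⟩ := hH.exists_aut hf hE c1 (by rwa [him])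
  refine ⟨σ, ⟨hσ, fun c hc => ?_⟩, fun a ha => ?_⟩
  · rw [hσφ c (Finset.mem_union_right _ hc), hφX c hc]
  · have : a ∈ W := DimGeometry.subset_cl (Finset.mem_union_left _ ha)
    rw [hσφ a (Finset.mem_union_left _ this), hφW a this]

end

/-- The free geometry of a generic structure. -/
noncomputable def IsGeneric.freeGeometry (hH : H.IsGeneric n 1 f) (hf : Control r n f) :
    FreeGeometry V where
  toDimGeometry := hH.inClass.geometry hf
  exists_ind := hH.exists_ind hf
  stationary _ _ _ _ hτ h1 h2 := hH.stationary hf hτ h1 h2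
  modular _ _ _ _ hi hX hs := hH.inClass.modular hf hi hX hs
  d_insert_le a X := by
    have h1 := hH.inClass.dim_insert_le a X
    have h2 : n ≤ 2 := by rcases hf.param with h | h <;> omega
    change H.dim n 1 _ ≤ H.dim n 1 _ + 2
    omega
  cl_empty := (hH.inClass.cl_eq_iff hf).2 (hH.inClass.closed_empty hf)
  cl_singleton a := (hH.inClass.cl_eq_iff hf).2 (hH.inClass.closed_singleton hf a)
  mem_of_forall := by
    intro σ hσ
    change σ ∈ H.aut
    rw [mem_aut_iff]
    intro e
    obtain ⟨τ, hτ, he⟩ := hσ e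
    rw [mem_aut_iff.1 hτ e, Finset.image_congr fun x hx => he x hx]

end UniformHypergraph

/-! ### Growth of logarithmic control functions -/

section

variable {f : ℝ → ℝ} {x₀ : ℝ}

/-- A control function grows at most linearly with the slope allowed at the left end point. -/
theorem IsLogControl.le_add_mul (hf : IsLogControl f x₀) (h0 : 0 ≤ x₀) {x y s : ℝ} (hx : x₀ ≤ x)
    (hxy : x ≤ y) (hs : ∀ f' : ℝ → ℝ, (∀ x ∈ Ici x₀, HasDerivWithinAt f (f' x) (Ici x) x) →
      AntitoneOn f' (Ici x₀) → (∀ x ∈ Ici x₀, f' x ≤ 1 / x) → ∀ t, x ≤ t → f' t ≤ s) :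
    f y ≤ f x + s * (y - x) := by
  obtain ⟨f', h1, h2, h3⟩ := hf.rightDeriv
  have hB : ∀ t, HasDerivAt (fun t => f x + s * (t - x)) s t := fun t => by
    simpa using (((hasDerivAt_id t).sub_const x).const_mul s).const_add (f x)
  exact image_le_of_deriv_right_le_deriv_boundary (f := f) (f' := f') (a := x) (b := y)
    (B := fun t => f x + s * (t - x)) (B' := fun _ => s)
    (hf.continuousOn.mono fun t ht => (h0.trans hx).trans ht.1)
    (fun t ht => h1 t (hx.trans ht.1)) (by simp)
    (fun t _ => (hB t).continuousAt.continuousWithinAt) (fun t _ => (hB t).hasDerivWithinAt)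
    (fun t ht => hs f' h1 h2 h3 t ht.1) (right_mem_Icc.2 hxy)

/-- The slope is at most 1/x on an interval of length y ≤ x. -/
theorem IsLogControl.add_le (hf : IsLogControl f x₀) (h0 : 0 < x₀) {x y : ℝ} (hx : x₀ ≤ x)
    (hy : 0 ≤ y) (hyx : y ≤ x) : f (x + y) ≤ f x + 1 := by
  have hx0 : 0 < x := h0.trans_le hx
  have h1 := hf.le_add_mul h0.le (s := 1 / x) hx (le_add_of_nonneg_right hy)
    fun f' _ _ h t ht => (h t (hx.trans ht)).trans (one_div_le_one_div_of_le hx0 ht)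
  have h2 : 1 / x * (x + y - x) ≤ 1 := by
    rw [add_sub_cancel_left, one_div, inv_mul_le_iff₀ hx0, mul_one]
    exact hyx
  linarith

theorem IsLogControl.natCast_mono (hf : IsLogControl f x₀) (x y : ℕ) (h : x ≤ y) : f x ≤ f y :=
  hf.monotoneOn (Set.mem_Ici.2 (Nat.cast_nonneg x)) (Set.mem_Ici.2 (Nat.cast_nonneg y))
    (Nat.cast_le.2 h)

theorem IsLogControl.unbounded (hf : IsLogControl f x₀) (c : ℝ) : ∃ k : ℕ, c < f k := by
  have := (hf.tendsto.comp tendsto_natCast_atTop_atTop).eventually (eventually_gt_atTop c)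
  exact this.exists

/-- If `f` were constant on an initial interval, its right derivative at x₀ would be 0. Being
non-increasing, it would stay at most 0 and `f` would be bounded. -/
theorem IsLogControl.lt_of_lt (hf : IsLogControl f x₀) (h0 : 0 ≤ x₀) {y : ℝ} (hy : x₀ < y) :
    f x₀ < f y := by
  by_contra! hc
  have heq : ∀ t ∈ Icc x₀ y, f t = f x₀ := fun t ht => le_antisymm
    ((hf.monotoneOn (h0.trans ht.1) (h0.trans hy.le) ht.2).trans hc)
    (hf.monotoneOn h0 (h0.trans ht.1) ht.1)
  have hle : ∀ t, x₀ ≤ t → f t ≤ f x₀ := by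
    intro t ht
    have := hf.le_add_mul h0 (s := 0) le_rfl ht (by
      intro f' h1 h2 _ t ht
      have h4 : HasDerivWithinAt f 0 (Ici x₀) x₀ := by
        refine (hasDerivWithinAt_const x₀ (Ici x₀) (f x₀)).congr_of_eventuallyEq ?_ rfl
        filter_upwards [Icc_mem_nhdsGE hy] with t ht
        exact heq t ht
      have h5 := (uniqueDiffWithinAt_Ici x₀).eq_deriv _ (h1 x₀ self_mem_Ici) h4
      rw [← h5]
      exact h2 self_mem_Ici ht ht)
    simpa using this
  obtain ⟨t, h1, h2⟩ := ((hf.tendsto.eventually (eventually_gt_atTop (f x₀))).and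
    (eventually_ge_atTop x₀)).exists
  exact absurd (hle t h2) h1.not_ge

open UniformHypergraph

theorem IsLogControl.control_one {r : ℕ} (hr : 3 ≤ r) (hf : IsLogControl f 1) (h1 : f 1 = 1) :
    Control r 1 f where
  zero := hf.zero
  mono := hf.natCast_mono
  unbounded := hf.unbounded
  add_le x y hyx := by
    rcases Nat.eq_zero_or_pos x with rfl | hx
    · obtain rfl : y = 0 := by omega
      simp
    · rw [Nat.cast_add]
      exact hf.add_le one_pos (mod_cast hx) (Nat.cast_nonneg y) (mod_cast hyx)
  one := by simpa using h1
  two := by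
    have := hf.lt_of_lt zero_le_one (y := 2) (by norm_num)
    rw [h1] at this
    simpa using this
  param := Or.inl ⟨rfl, hr⟩

theorem IsLogControl.control_two (hf : IsLogControl f 2) (h1 : f 1 = 2) (h2 : f 2 = 3) :
    Control 2 2 f where
  zero := hf.zero
  mono := hf.natCast_mono
  unbounded := hf.unbounded
  add_le x y hyx := by
    rcases Nat.lt_or_ge x 2 with hx | hx
    · interval_cases x
      · obtain rfl : y = 0 := by omega
        simp
      -- The derivative bound starts only at 2, so doubling a single point uses the given values:
      -- f(2) = 3 = f(1) + 1.
      · interval_cases y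
        · simp
        · norm_num [h1, h2]
    · rw [Nat.cast_add]
      exact hf.add_le two_pos (mod_cast hx) (Nat.cast_nonneg y) (mod_cast hyx)
  one := by simpa using h1
  two := by rw [h2]; norm_num
  param := Or.inr ⟨rfl, rfl⟩

end

/-! ### Free points and pendant edges -/

/-- `p` is a free point over `Z`. -/
def DimGeometry.FreePoint {V : Type*} [DecidableEq V] (S : DimGeometry V) (Z : Finset V) (p : V) :
    Prop :=
  p ∉ S.cl Z ∧ S.Ind {p} ∅ Z

namespace UniformHypergraph

variable {r n : ℕ} {f : ℝ → ℝ} {T V : Type*} [DecidableEq T] [DecidableEq V]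
  {H : UniformHypergraph r V} {K : UniformHypergraph r T}
  {A B C E P W X Y Z : Finset V} {a b c p : V} {σ τ g : Equiv.Perm V}

theorem Control.two_le (hf : Control r n f) : 2 ≤ r := by
  rcases hf.param with h | h <;> omega

theorem embeds_singleton (hr : 2 ≤ r) (x : T) (φ : T → V) : Embeds K H {x} φ := by
  refine ⟨by simp, fun e he => ?_⟩
  have h1 := Finset.card_le_card he
  have h2 := Finset.card_image_le (s := e) (f := φ)
  rw [Finset.card_singleton] at h1
  constructor
  · intro h
    have := K.card_of_mem e h
    omega
  · intro h
    have := H.card_of_mem _ h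
    omega

theorem edgesIn_eq_empty (hX : X.card < r) : H.edgesIn X = ∅ := by
  rw [Finset.eq_empty_iff_forall_notMem]
  intro e he
  rw [mem_edgesIn] at he
  have h1 := Finset.card_le_card he.1
  have h2 := H.card_of_mem e he.2
  omega

theorem predim_of_card_lt (hX : X.card < r) : H.predim n 1 X = n * X.card := by
  rw [predim_eq, edgesIn_eq_empty hX]
  simp

theorem InClass.freePoint (hf : Control r n f) (h : H.InClass n 1 f)
    (hd : H.dim n 1 (insert p Z) = H.dim n 1 Z + n)
    (hc : (h.geometry hf).cl (insert p Z) ⊆ insert p ((h.geometry hf).cl Z)) :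
    (h.geometry hf).FreePoint Z p := by
  have hn := hf.pos
  have hr := hf.two_le
  refine ⟨fun hp => ?_, ?_, ?_⟩
  · rw [DimGeometry.mem_cl] at hp
    change H.dim n 1 _ = H.dim n 1 _ at hp
    omega
  · rw [Finset.union_empty, Finset.union_empty, Finset.union_empty,
      (h.cl_eq_iff hf).2 (h.closed_singleton hf p)]
    exact hc
  · rw [Finset.union_empty, Finset.union_empty, Finset.union_empty]
    change H.dim n 1 (insert p Z) + H.dim n 1 ∅ = H.dim n 1 {p} + H.dim n 1 Z
    rw [hd, Closed.dim_eq h (h.closed_empty hf), Closed.dim_eq h (h.closed_singleton hf p),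
      predim_of_card_lt (by rw [Finset.card_empty]; omega),
      predim_of_card_lt (by rw [Finset.card_singleton]; omega)]
    simp
    ring

theorem IsGeneric.exists_aut_apply (hf : Control r n f) (hH : H.IsGeneric n 1 f) (p q : V) :
    ∃ σ ∈ H.aut, σ p = q := by
  obtain ⟨σ, h1, h2⟩ := hH.exists_aut (W := {p}) (φ := fun _ => q) hf
    (embeds_singleton hf.two_le _ _) (hH.inClass.closed_singleton hf p)
    (by rw [Finset.image_singleton]; exact hH.inClass.closed_singleton hf q)
  exact ⟨σ, h1, h2 p (Finset.mem_singleton_self p)⟩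

/-- Any two points are conjugate, and ∅ is closed; stationarity over ∅ then makes two points that
are free over Z conjugate over Z. -/
theorem IsGeneric.exists_fix_of_freePoint (hf : Control r n f) (hH : H.IsGeneric n 1 f) {q : V}
    (hp : (hH.inClass.geometry hf).FreePoint Z p) (hq : (hH.inClass.geometry hf).FreePoint Z q) :
    ∃ σ ∈ (hH.inClass.geometry hf).fix Z, σ p = q := by
  obtain ⟨τ, h1, h2⟩ := hH.exists_aut_apply hf p q
  have h0 : (hH.inClass.geometry hf).cl ∅ = ∅ :=
    (hH.inClass.cl_eq_iff hf).2 (hH.inClass.closed_empty hf)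
  obtain ⟨σ, h3, h4⟩ := hH.stationary hf (A := {p}) (C := ∅) (B := Z) (τ := τ)
    ⟨h1, by rw [h0]; simp⟩ hp.2 (by rw [DimGeometry.smul_singleton_apply, h2]; exact hq.2)
  rw [Finset.union_empty] at h3
  exact ⟨σ, h3, by rw [h4 p (Finset.mem_singleton_self p), h2]⟩

/-! ### Pendant edges -/

/-- `P` completes `c ∈ E` to a hyperedge attached freely to the closed set `E`. -/
structure IsPendant (n : ℕ) (H : UniformHypergraph r V) (E : Finset V) (c : V) (P : Finset V) :
    Prop where
  mem : c ∈ E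
  nonempty : P.Nonempty
  card : P.card + 1 = r
  disjoint : Disjoint E P
  edge : insert c P ∈ H.edges
  noCross : H.NoCross E (insert c P)
  closed : H.Closed n (E ∪ P)

theorem IsPendant.notMem (h : H.IsPendant n E c P) : c ∉ P := fun h' =>
  Finset.disjoint_left.1 h.disjoint h.mem h'

/-- The pendant edge is the only hyperedge of E ∪ P not contained in E. -/
theorem IsPendant.predim_eq (h : H.IsPendant n E c P) (hY : Y ⊆ E ∪ P) :
    H.predim n 1 Y + (if insert c P ⊆ Y then 1 else 0) =
      H.predim n 1 (Y ∩ E) + n * (Y ∩ P).card := by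
  have hcard : Y.card = (Y ∩ E).card + (Y ∩ P).card := by
    rw [← Finset.card_union_of_disjoint, ← Finset.inter_union_distrib_left,
      Finset.inter_eq_left.2 hY]
    exact h.disjoint.mono Finset.inter_subset_right Finset.inter_subset_right
  have hP : ¬ insert c P ⊆ E := fun hs => by
    obtain ⟨x, hx⟩ := h.nonempty
    exact Finset.disjoint_left.1 h.disjoint (hs (Finset.mem_insert_of_mem hx)) hx
  have hedge : ∀ e ∈ H.edges, e ⊆ Y → e ⊆ E ∨ e = insert c P := by
    intro e he hs
    rcases h.noCross e he (hs.trans (hY.trans (by grind))) with h1 | h1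
    · exact Or.inl h1
    · right
      apply Finset.eq_of_subset_of_card_le h1
      rw [H.card_of_mem e he, Finset.card_insert_of_notMem h.notMem, h.card]
  by_cases hi : insert c P ⊆ Y
  · have : H.edgesIn Y = insert (insert c P) (H.edgesIn (Y ∩ E)) := by
      ext e
      rw [Finset.mem_insert, mem_edgesIn, mem_edgesIn, Finset.subset_inter_iff]
      constructor
      · rintro ⟨h1, h2⟩
        rcases hedge e h2 h1 with h3 | h3
        · exact Or.inr ⟨⟨h1, h3⟩, h2⟩
        · exact Or.inl h3
      · rintro (rfl | h1)
        · exact ⟨hi, h.edge⟩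
        · exact ⟨h1.1.1, h1.2⟩
    rw [UniformHypergraph.predim_eq, UniformHypergraph.predim_eq, this,
      Finset.card_insert_of_notMem (by
        rw [mem_edgesIn]
        exact fun h1 => hP (h1.1.trans Finset.inter_subset_right)), hcard, if_pos hi]
    push_cast
    ring
  · have : H.edgesIn Y = H.edgesIn (Y ∩ E) := by
      ext e
      rw [mem_edgesIn, mem_edgesIn, Finset.subset_inter_iff]
      constructor
      · rintro ⟨h1, h2⟩
        rcases hedge e h2 h1 with h3 | h3
        · exact ⟨⟨h1, h3⟩, h2⟩
        · exact absurd (h3 ▸ h1) hi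
      · rintro h1
        exact ⟨h1.1.1, h1.2⟩
    rw [UniformHypergraph.predim_eq, UniformHypergraph.predim_eq, this, hcard, if_neg hi]
    push_cast
    ring

theorem IsPendant.mono (h : H.IsPendant n E c P) {E' : Finset V} (hE : E' ⊆ E) (hc : c ∈ E')
    (hE' : H.Closed n E') : H.IsPendant n E' c P where
  mem := hc
  nonempty := h.nonempty
  card := h.card
  disjoint := h.disjoint.mono_left hE
  edge := h.edge
  noCross e he hs := by
    rcases h.noCross e he (hs.trans (Finset.union_subset_union_left hE)) with h1 | h1
    · by_cases h2 : e ⊆ E'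
      · exact Or.inl h2
      · refine Or.inr fun x hx => ?_
        rcases Finset.mem_union.1 (hs hx) with h3 | h3
        · exfalso
          apply h2
          intro y hy
          rcases Finset.mem_union.1 (hs hy) with h4 | h4
          · exact h4
          · rcases Finset.mem_insert.1 h4 with rfl | h5
            · exact hc
            · exact absurd h5 (Finset.disjoint_left.1 h.disjoint (h1 hy))
        · exact h3
    · exact Or.inr h1
  closed := by
    have hi : (E' ∪ P) ∩ E = E' := by
      have := Finset.disjoint_right.1 h.disjoint
      ext x
      simp only [Finset.mem_inter, Finset.mem_union]
      constructor
      · rintro ⟨h1 | h1, h2⟩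
        · exact h1
        · exact absurd h2 (this h1)
      · exact fun h1 => ⟨Or.inl h1, hE h1⟩
    -- E ∪ P is the free amalgam of E' ∪ P and E over E', and E' is strong in E; hence E' ∪ P is
    -- strong in E ∪ P.
    have hnc : H.NoCross (E' ∪ P) E := by
      intro e he hs
      rcases h.noCross e he (hs.trans (by grind)) with h1 | h1
      · exact Or.inr h1
      · exact Or.inl (h1.trans (by grind))
    have hs := hnc.strong (n := n) (by rw [hi]; exact hE' E)
    rw [show E' ∪ P ∪ E = E ∪ P by grind] at hs
    exact h.closed.of_strong hs (Finset.union_subset_union_left hE)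

theorem IsPendant.predim_union (h : H.IsPendant n E c P) :
    H.predim n 1 (E ∪ P) + 1 = H.predim n 1 E + n * P.card := by
  have h1 := h.predim_eq subset_rfl
  rw [if_pos (Finset.insert_subset (Finset.mem_union_left _ h.mem) Finset.subset_union_right),
    Finset.inter_eq_right.2 Finset.subset_union_left,
    Finset.inter_eq_right.2 Finset.subset_union_right] at h1
  exact h1

/-- The dimension and the closure of a point of a pendant edge. -/
theorem IsPendant.dim_insert (hf : Control r n f) (hH : H.InClass n 1 f)
    (h : H.IsPendant n E c P) (hZ : Z ⊆ E) (hZc : H.Closed n Z) (hp : p ∈ P) :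
    H.dim n 1 (insert c Z) + 1 ≤ H.dim n 1 (insert p Z) ∨
      H.dim n 1 (insert p Z) = H.dim n 1 Z + n ∧ (hH.geometry hf).FreePoint Z p := by
  -- The set P and its one hyperedge contribute n|P| − 1 ≥ 1 to δ.
  have hnr : 2 ≤ n * P.card := by
    have h1 := h.card
    have h2 : 1 ≤ P.card := Finset.card_pos.2 ⟨p, hp⟩
    rcases hf.param with ⟨rfl, h3⟩ | ⟨rfl, h3⟩ <;> omega
  set S := hH.geometry hf with hS
  set Y := S.cl (insert p Z) with hY
  have hYd : H.predim n 1 Y = H.dim n 1 (insert p Z) := hH.predim_cl hf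
  have hZp : insert p Z ⊆ Y := DimGeometry.subset_cl
  have hYE : Y ⊆ E ∪ P := by
    have h1 : S.cl (insert p Z) ⊆ S.cl (E ∪ P) := DimGeometry.cl_mono (by grind)
    rwa [(hH.cl_eq_iff hf).2 h.closed] at h1
  have h1 := h.predim_eq hYE
  have hk : 1 ≤ (Y ∩ P).card :=
    Finset.card_pos.2 ⟨p, Finset.mem_inter.2 ⟨hZp (Finset.mem_insert_self _ _), hp⟩⟩
  have hZYE : Z ⊆ Y ∩ E := Finset.subset_inter ((Finset.subset_insert _ _).trans hZp) hZ
  have hZd := Closed.dim_eq hH hZc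
  -- If cl(p, Z) contains the whole edge, then it contains c and costs at least 1 more than c.
  -- Otherwise no hyperedge in it meets P, and comparison with d(Z) + n shows that p is free over Z.
  split_ifs at h1 with hi
  · left
    have h2 : insert c Z ⊆ Y ∩ E := Finset.insert_subset
      (Finset.mem_inter.2 ⟨hi (Finset.mem_insert_self _ _), h.mem⟩) hZYE
    have h3 := hH.dim_le h2
    have h4 : Y ∩ P = P := Finset.inter_eq_right.2 ((Finset.subset_insert _ _).trans hi)
    rw [h4] at h1
    have h5 : (2 : ℤ) ≤ n * P.card := mod_cast hnr
    omega
  · right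
    have h2 := hH.dim_insert_le p Z
    have h3 := (hZc E).le hZYE Finset.inter_subset_right
    have h4 : (n : ℤ) * 1 ≤ n * (Y ∩ P).card := by
      apply mul_le_mul_of_nonneg_left _ (Nat.cast_nonneg n)
      exact_mod_cast hk
    have hd : H.dim n 1 (insert p Z) = H.dim n 1 Z + n := by omega
    refine ⟨hd, hH.freePoint hf hd ?_⟩
    rw [(hH.cl_eq_iff hf).2 hZc]
    have h5 : Y ∩ E ⊆ Z := by
      by_contra hc
      have := hZc E (Y ∩ E) (Finset.ssubset_iff_subset_ne.2 ⟨hZYE, fun he => hc he.symm.subset⟩)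
        Finset.inter_subset_right
      omega
    have h6 : (Y ∩ P).card ≤ 1 := by
      by_contra! hc
      have : (n : ℤ) * 2 ≤ n * (Y ∩ P).card := by
        apply mul_le_mul_of_nonneg_left _ (Nat.cast_nonneg n)
        exact_mod_cast hc
      have := hf.pos
      omega
    intro x hx
    rcases Finset.mem_union.1 (hYE hx) with h7 | h7
    · exact Finset.mem_insert_of_mem (h5 (Finset.mem_inter.2 ⟨hx, h7⟩))
    · have := Finset.card_le_one.1 h6 x (Finset.mem_inter.2 ⟨hx, h7⟩) p
        (Finset.mem_inter.2 ⟨hZp (Finset.mem_insert_self _ _), hp⟩)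
      rw [this]
      exact Finset.mem_insert_self _ _

/-- Pendant edges exist over every closed finite set. -/
theorem IsGeneric.exists_isPendant (hf : Control r n f) (hr : f r ≤ n * r - 1)
    (hH : H.IsGeneric n 1 f) (hE : H.Closed n E) (hc : c ∈ E) : ∃ P, H.IsPendant n E c P := by
  have := hH.infinite hf
  have h2r := hf.two_le
  let i₀ : Fin r := ⟨0, by omega⟩
  let B : UniformHypergraph r (Fin r) := ⟨{Finset.univ}, fun e he => by
    rw [Set.mem_singleton_iff.1 he, Finset.card_univ, Fintype.card_fin]⟩
  have hcardY : ∀ Y : Finset (Fin r), Y ≠ Finset.univ → Y.card < r := by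
    intro Y hY
    have := Finset.card_lt_card (Finset.ssubset_univ_iff.2 hY)
    rwa [Finset.card_univ, Fintype.card_fin] at this
  have hdu : B.predim n 1 Finset.univ = n * r - 1 := by
    have : B.edgesIn Finset.univ = {Finset.univ} := by
      ext e
      rw [mem_edgesIn, Finset.mem_singleton]
      exact ⟨fun h => h.2, fun h => ⟨Finset.subset_univ _, h⟩⟩
    rw [predim_eq, this]
    simp
  have hB : B.Good n f Finset.univ := by
    intro Y _
    by_cases hY : Y = Finset.univ
    · rw [hY, hdu, Finset.card_univ, Fintype.card_fin]
      push_cast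
      exact hr
    · rw [predim_of_card_lt (hcardY Y hY)]
      push_cast
      exact hf.le_mul _
  have hBs : B.Strong n {i₀} Finset.univ := by
    intro Y h1 _
    have h3 := Finset.card_lt_card h1
    rw [Finset.card_singleton] at h3
    rw [predim_of_card_lt (by rw [Finset.card_singleton]; omega), Finset.card_singleton]
    by_cases hY : Y = Finset.univ
    · rw [hY, hdu]
      rcases hf.param with ⟨rfl, h3⟩ | ⟨rfl, rfl⟩
      · push_cast
        omega
      · norm_num
    · rw [predim_of_card_lt (hcardY Y hY)]
      have := hf.pos
      apply mul_lt_mul_of_pos_left _ (by omega)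
      exact_mod_cast h3
  obtain ⟨K, h, k1, k2, k3, k4, k5, k6, k7, k8⟩ := exists_free_amalgam (K := H) (B := B)
    (A := {i₀}) (W := Finset.univ) (X := E) (g := fun _ => c) hf (hH.inClass.good E) hB
    (Finset.subset_univ _) hBs (embeds_singleton h2r _ _)
    (by rw [Finset.image_singleton]; exact Finset.singleton_subset_iff.2 hc)
    (by rw [Finset.image_singleton]; exact hH.inClass.closed_singleton hf c E)
  rw [Finset.image_singleton] at k4
  obtain ⟨θ, t1, t2, t3⟩ := hH.realize hf k6 Finset.subset_union_left k7
    (g := id) (Embeds.of_agree k1) (by rwa [Finset.image_id])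
  have hEim : E.image θ = E := (Finset.image_congr fun x hx => t2 x hx).trans Finset.image_id
  set Q := (Finset.univ.image h).image θ with hQ
  have hcE : E ∩ Q = {c} := by
    conv_lhs => rw [← hEim, hQ]
    rw [← t1.inter_image Finset.subset_union_left Finset.subset_union_right, k4,
      Finset.image_singleton, t2 c hc]
    rfl
  have hcQ : c ∈ Q := by
    have : c ∈ E ∩ Q := by rw [hcE]; exact Finset.mem_singleton_self c
    exact (Finset.mem_inter.1 this).2
  have hEmb := k2.comp (t1.mono Finset.subset_union_right)
  have hQ' : Q = Finset.univ.image (θ ∘ h) := Finset.image_image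
  have hQcard : Q.card = r := by
    rw [hQ', hEmb.card_image subset_rfl, Finset.card_univ, Fintype.card_fin]
  have hins : insert c (Q.erase c) = Q := Finset.insert_erase hcQ
  have hcard : (Q.erase c).card + 1 = r := by rw [Finset.card_erase_add_one hcQ, hQcard]
  refine ⟨Q.erase c, hc, Finset.card_pos.1 (by omega), hcard, ?_, ?_, ?_, ?_⟩
  · rw [Finset.disjoint_left]
    intro x h1 h2
    have : x ∈ E ∩ Q := Finset.mem_inter.2 ⟨h1, Finset.mem_of_mem_erase h2⟩
    rw [hcE, Finset.mem_singleton] at this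
    exact Finset.ne_of_mem_erase h2 this
  · rw [hins, hQ']
    exact (hEmb.2 _ subset_rfl).1 (Set.mem_singleton _)
  · rw [hins]
    have := t1.noCross k5
    rwa [hEim] at this
  · have h1 : E ∪ Q.erase c = E ∪ Q := by grind
    rwa [h1, ← hEim, hQ, ← Finset.image_union]

/-- A set of points containing all free points over `Z`, and containing every point all of whose
neighbourhoods admit pendant edges with the other points in the set, is everything. -/
theorem IsGeneric.forall_mem_of_freePoint (hf : Control r n f) (hr : f r ≤ n * r - 1)
    (hH : H.IsGeneric n 1 f) (hZ : H.Closed n Z) (M : Set V)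
    (hfree : ∀ p, (hH.inClass.geometry hf).FreePoint Z p → p ∈ M)
    (hpend : ∀ c, (∀ E, H.Closed n E → c ∈ E → ∃ P, H.IsPendant n E c P ∧ ↑P ⊆ M) → c ∈ M)
    (c : V) : c ∈ M := by
  -- The number k bounds n − d(c / Z). The pendant edge is taken over cl(E ∪ Z), so that each new
  -- point is either free over Z or has a larger dimension over Z than c.
  have key : ∀ k : ℕ, ∀ c, H.dim n 1 Z + n ≤ H.dim n 1 (insert c Z) + k → c ∈ M := by
    intro k
    induction k using Nat.strong_induction_on with
    | _ k ih =>
      intro c hk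
      apply hpend
      intro E hE hcE
      obtain ⟨P, hP⟩ := hH.exists_isPendant (E := (hH.inClass.geometry hf).cl (E ∪ Z)) hf hr
        (hH.inClass.closed_cl hf) (DimGeometry.subset_cl (Finset.mem_union_left _ hcE))
      refine ⟨P, hP.mono (DimGeometry.subset_cl_of Finset.subset_union_left) hcE hE, ?_⟩
      intro p hp
      rcases hP.dim_insert hf hH.inClass (DimGeometry.subset_cl_of Finset.subset_union_right) hZ hp
        with h1 | ⟨h1, h2⟩
      · rcases k with _ | k
        · have := hH.inClass.dim_insert_le p Z
          push_cast at hk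
          omega
        · apply ih k (by omega)
          push_cast at hk
          omega
      · exact hfree p h2
  apply key n
  have := hH.inClass.dim_mono (Finset.subset_insert c Z)
  omega

/-- An automorphism that is bounded on free points is trivial. -/
theorem IsGeneric.eq_one_of_freePoint (hf : Control r n f) (hr : f r ≤ n * r - 1)
    (hH : H.IsGeneric n 1 f) (hg : g ∈ H.aut)
    (hZ : ∀ b, (hH.inClass.geometry hf).FreePoint Z b → g b ∈ Z ∨ g b = b) : g = 1 := by
  set S := hH.inClass.geometry hf with hS
  ext c
  -- The base is enlarged by g⁻¹ • Z so that a free point cannot be sent into Z; it must then be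
  -- fixed.
  refine hH.forall_mem_of_freePoint hf hr (Z := S.cl (Z ∪ g⁻¹ • Z)) (hH.inClass.closed_cl hf)
    {x | g x = x} ?_ ?_ c
  · intro b hb
    have hZZ : Z ⊆ S.cl (Z ∪ g⁻¹ • Z) := DimGeometry.subset_cl_of Finset.subset_union_left
    rcases hZ b ⟨fun h => hb.1 (DimGeometry.cl_mono hZZ h),
      hb.2.mono_right (DimGeometry.subset_cl_of (hZZ.trans Finset.subset_union_left))⟩ with h | h
    · exfalso
      apply hb.1
      rw [DimGeometry.cl_cl]
      apply DimGeometry.subset_cl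
      apply Finset.mem_union_right
      rw [Finset.mem_inv_smul_finset_iff]
      exact h
    · exact h
  · intro c hc
    by_contra hne
    -- If P is fixed pointwise, then P together with g c is again a hyperedge. As c and g c both lie
    -- in E, and only the pendant edge crosses from E to P, this forces g c = c.
    obtain ⟨P, hP, hPM⟩ := hc (S.cl {c, g c}) (hH.inClass.closed_cl hf)
      (DimGeometry.subset_cl (by simp))
    have hgc : g c ∈ S.cl {c, g c} := DimGeometry.subset_cl (by simp)
    have h1 := (mem_aut_iff.1 hg _).1 hP.edge
    have h2 : P.image g = P := (Finset.image_congr fun x hx => hPM hx).trans Finset.image_id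
    rw [Finset.image_insert, h2] at h1
    rcases hP.noCross _ h1 (by grind) with h3 | h3
    · obtain ⟨x, hx⟩ := hP.nonempty
      exact Finset.disjoint_left.1 hP.disjoint (h3 (Finset.mem_insert_of_mem hx)) hx
    · rcases Finset.mem_insert.1 (h3 (Finset.mem_insert_self _ _)) with h4 | h4
      · exact hne h4
      · exact Finset.disjoint_left.1 hP.disjoint hgc h4

end UniformHypergraph

/-! ### Special points and algebraic attachments -/

namespace UniformHypergraph

variable {r n : ℕ} {f : ℝ → ℝ} {V : Type*} [DecidableEq V]
  {H : UniformHypergraph r V} {A D L R U W X Y Z : Finset V} {a b c p : V} {σ τ g : Equiv.Perm V}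

/-- Every point is reached in at most two special steps. -/
theorem IsGeneric.special_or (hf : Control r n f) (hr : f r ≤ n * r - 1) (hH : H.IsGeneric n 1 f)
    (hb : b ∉ (hH.inClass.geometry hf).cl X) :
    (hH.inClass.geometry hf).Special X b ∨ ∃ c, (hH.inClass.geometry hf).Special X c ∧
      (hH.inClass.geometry hf).Special ({c} ∪ X) b := by
  have h1 := DimGeometry.d_insert_of_notMem hb
  change H.dim n 1 X + 1 ≤ H.dim n 1 (insert b X) at h1
  have h2 := hH.inClass.dim_insert_le b X
  by_cases hd : H.dim n 1 (insert b X) = H.dim n 1 X + 1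
  · exact Or.inl ⟨hb, Or.inl hd⟩
  right
  obtain ⟨rfl, rfl⟩ : n = 2 ∧ r = 2 := by
    rcases hf.param with ⟨rfl, _⟩ | h
    · push_cast at h2
      omega
    · exact h
  push_cast at h2
  -- Now n = r = 2 and b has relative dimension 2. A pendant neighbour c of b is free over X, and
  -- the edge between them lowers the dimension of b over c and X to 1.
  obtain ⟨P, hP⟩ := hH.exists_isPendant (E := (hH.inClass.geometry hf).cl (insert b X)) (c := b)
    hf hr (hH.inClass.closed_cl hf) (DimGeometry.subset_cl (Finset.mem_insert_self _ _))
  set S := hH.inClass.geometry hf with hS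
  obtain ⟨c, hc⟩ := Finset.card_eq_one.1 (show P.card = 1 by have := hP.card; omega)
  subst hc
  have hZ : H.Closed 2 (S.cl X) := hH.inClass.closed_cl hf
  have hdX : H.dim 2 1 (S.cl X) = H.dim 2 1 X := DimGeometry.d_cl (S := S) X
  have hdi : ∀ x, H.dim 2 1 (insert x (S.cl X)) = H.dim 2 1 (insert x X) := fun x =>
    DimGeometry.d_eq_of_cl_eq (S := S) (DimGeometry.cl_eq_of_subset
      (Finset.insert_subset (DimGeometry.subset_cl (Finset.mem_insert_self _ _))
        (DimGeometry.cl_mono (Finset.subset_insert _ _)))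
      (DimGeometry.subset_cl_of (Finset.insert_subset_insert _ DimGeometry.subset_cl)))
  have h3 := hP.dim_insert hf hH.inClass (p := c)
    (DimGeometry.cl_mono (Finset.subset_insert _ _)) hZ (Finset.mem_singleton_self c)
  have h4 := hH.inClass.dim_insert_le c (S.cl X)
  rw [hdi, hdi, hdX] at h3
  rw [hdi, hdX] at h4
  push_cast at h3 h4
  obtain ⟨h5, h6⟩ := h3.resolve_left (by omega)
  have hEP : H.dim 2 1 (S.cl (insert b X) ∪ {c}) = H.dim 2 1 X + 3 := by
    rw [Closed.dim_eq hH.inClass hP.closed]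
    have h7 := hP.predim_union
    have h8 : H.predim 2 1 (S.cl (insert b X)) = H.dim 2 1 (insert b X) := hH.inClass.predim_cl hf
    rw [h8, Finset.card_singleton] at h7
    push_cast at h7
    omega
  have hbc : H.dim 2 1 (insert b ({c} ∪ X)) = H.dim 2 1 X + 3 := by
    rw [← hEP]
    apply DimGeometry.d_eq_of_cl_eq (S := S)
    apply DimGeometry.cl_eq_of_subset
    · have := DimGeometry.subset_cl (S := S) (X := insert b X)
      exact DimGeometry.subset_cl_of (by grind)
    · exact Finset.union_subset (DimGeometry.cl_mono (by grind)) (DimGeometry.subset_cl_of (by grind))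
  have hcX : H.dim 2 1 ({c} ∪ X) = H.dim 2 1 X + 2 := h5
  refine ⟨c, ⟨fun h => h6.1 (by rwa [DimGeometry.cl_cl]), Or.inr (h6.2.mono_right
    (DimGeometry.subset_cl_of (DimGeometry.subset_cl.trans Finset.subset_union_left)))⟩, ?_, ?_⟩
  · rw [DimGeometry.mem_cl]
    change ¬ H.dim 2 1 _ = H.dim 2 1 _
    omega
  · left
    change H.dim 2 1 (insert b ({c} ∪ X)) = H.dim 2 1 ({c} ∪ X) + 1
    omega

/-! ### Attaching a point algebraically -/

/-- Attaching a new point `p` by `n` hyperedges through the points of `L`. -/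
theorem exists_attach (H : UniformHypergraph r V) (hp : p ∉ U) (hL : L ⊆ U)
    (hcard : n = 1 ∧ L.card + 1 = r ∧ 1 ≤ L.card ∨ n = 2 ∧ r = 2 ∧ L.card = 2) :
    ∃ K : UniformHypergraph r V, (∀ e ⊆ U, e ∈ K.edges ↔ e ∈ H.edges) ∧
      ∀ Y ⊆ U, ∃ ν : ℕ, K.predim n 1 (insert p Y) + ν = H.predim n 1 Y + n ∧
        (ν < n ∨ ν = n ∧ L ⊆ Y) ∧ (L ⊆ Y → ν = n) ∧ (ν = 0 ∨ ∃ x ∈ L, x ∈ Y) := by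
  have hpL : p ∉ L := fun h => hp (hL h)
  -- N consists of exactly n hyperedges, which cancel the weight n of the new point: a single one if
  -- n = 1, and two ordinary edges if n = r = 2.
  obtain ⟨N, hN1, hN2, hN3, hN4⟩ : ∃ N : Finset (Finset V),
      (∀ e ∈ N, p ∈ e ∧ e ⊆ insert p L ∧ e.card = r) ∧ N.card = n ∧
      (∀ Y, (∀ e ∈ N, e ⊆ Y) → L ⊆ Y) ∧ ∀ e ∈ N, ∃ x ∈ L, x ∈ e := by
    rcases hcard with ⟨rfl, h1, h2⟩ | ⟨rfl, rfl, h1⟩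
    · refine ⟨{insert p L}, ?_, Finset.card_singleton _, ?_, ?_⟩
      · intro e he
        rw [Finset.mem_singleton.1 he]
        exact ⟨Finset.mem_insert_self _ _, subset_rfl, by
          rw [Finset.card_insert_of_notMem hpL, h1]⟩
      · intro Y hY
        exact (Finset.subset_insert _ _).trans (hY _ (Finset.mem_singleton_self _))
      · intro e he
        obtain ⟨x, hx⟩ := Finset.card_pos.1 h2
        rw [Finset.mem_singleton.1 he]
        exact ⟨x, hx, Finset.mem_insert_of_mem hx⟩
    · have hne : ∀ x ∈ L, p ≠ x := fun x hx h => hpL (h ▸ hx)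
      refine ⟨L.image fun x => {p, x}, ?_, ?_, ?_, ?_⟩
      · intro e he
        obtain ⟨x, hx, rfl⟩ := Finset.mem_image.1 he
        exact ⟨by simp, by grind, Finset.card_pair (hne x hx)⟩
      · rw [Finset.card_image_of_injOn, h1]
        intro x hx y hy hxy
        have h2 : x ∈ ({p, y} : Finset V) := by
          rw [← show ({p, x} : Finset V) = {p, y} from hxy]
          simp
        simp only [Finset.mem_insert, Finset.mem_singleton] at h2
        exact h2.resolve_left (hne x hx).symm
      · intro Y hY x hx
        exact hY _ (Finset.mem_image_of_mem _ hx) (by simp)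
      · intro e he
        obtain ⟨x, hx, rfl⟩ := Finset.mem_image.1 he
        exact ⟨x, hx, by simp⟩
  have hpe : ∀ e ∈ N, ¬ e ⊆ U := fun e he h => hp (h (hN1 e he).1)
  let K : UniformHypergraph r V :=
    { edges := {e | (e ⊆ U ∧ e ∈ H.edges) ∨ e ∈ N}
      card_of_mem := by
        rintro e (he | he)
        · exact H.card_of_mem e he.2
        · exact (hN1 e he).2.2 }
  refine ⟨K, fun e he => ⟨?_, fun h => Or.inl ⟨he, h⟩⟩, fun Y hY => ?_⟩
  · rintro (h | h)
    · exact h.2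
    · exact absurd he (hpe e h)
  have hpY : p ∉ Y := fun h => hp (hY h)
  have hedges : K.edgesIn (insert p Y) = H.edgesIn Y ∪ N.filter (· ⊆ insert p Y) := by
    ext e
    rw [Finset.mem_union, mem_edgesIn, mem_edgesIn, Finset.mem_filter]
    constructor
    · rintro ⟨h1, h2 | h2⟩
      · refine Or.inl ⟨fun x hx => ?_, h2.2⟩
        rcases Finset.mem_insert.1 (h1 hx) with rfl | h3
        · exact absurd (h2.1 hx) hp
        · exact h3
      · exact Or.inr ⟨h2, h1⟩
    · rintro (h1 | h1)
      · exact ⟨h1.1.trans (Finset.subset_insert _ _), Or.inl ⟨h1.1.trans hY, h1.2⟩⟩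
      · exact ⟨h1.2, Or.inr h1.1⟩
  have hdisj : Disjoint (H.edgesIn Y) (N.filter (· ⊆ insert p Y)) := by
    rw [Finset.disjoint_left]
    intro e h1 h2
    exact hpe e (Finset.mem_filter.1 h2).1 ((mem_edgesIn.1 h1).1.trans hY)
  have hLY : ∀ Z, L ⊆ insert p Z → L ⊆ Z := fun Z h x hx =>
    (Finset.mem_insert.1 (h hx)).resolve_left fun h' => hpL (h' ▸ hx)
  refine ⟨(N.filter (· ⊆ insert p Y)).card, ?_, ?_, ?_, ?_⟩
  · rw [predim_eq, predim_eq, hedges, Finset.card_union_of_disjoint hdisj,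
      Finset.card_insert_of_notMem hpY]
    push_cast
    ring
  · rcases (Finset.card_filter_le N (· ⊆ insert p Y)).lt_or_eq with h | h
    · exact Or.inl (hN2 ▸ h)
    · right
      refine ⟨by rw [h, hN2], hLY Y (hN3 _ ?_)⟩
      exact Finset.card_filter_eq_iff.1 h
  · intro h
    rw [Finset.filter_true_of_mem, hN2]
    intro e he
    exact (hN1 e he).2.1.trans (Finset.insert_subset_insert _ h)
  · rcases Finset.eq_empty_or_nonempty (N.filter (· ⊆ insert p Y)) with h | ⟨e, he⟩
    · exact Or.inl (by rw [h, Finset.card_empty])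
    · right
      rw [Finset.mem_filter] at he
      obtain ⟨x, hx, hxe⟩ := hN4 e he.1
      exact ⟨x, hx, (Finset.mem_insert.1 (he.2 hxe)).resolve_left fun h' => hpL (h' ▸ hx)⟩

/-- The growth estimate for attaching a point to a free amalgam. -/
theorem Control.le_of_amalgam (hf : Control r n f) (hr : f r ≤ n * r - 1) {k k₀ k₁ k₂ : ℕ}
    {d d₀ d₁ d₂ : ℤ} (h1 : f k₁ ≤ d₁) (h2 : f k₂ ≤ d₂) (hk : k + k₀ = k₁ + k₂)
    (hd : d + d₀ = d₁ + d₂) (hd1 : d₀ + 1 ≤ d₁) (hd2 : d₀ + 1 ≤ d₂) (hk2 : 1 ≤ k₂)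
    (h21 : k₂ ≤ k₁) (h0 : k₀ = 0 → d₀ = 0) (hn : n = 1 → r ≤ k + 1) :
    f (k + 1 : ℕ) ≤ d := by
  have hadd : f (k₁ + k₂ : ℕ) ≤ f k₁ + 1 := hf.add_le _ _ h21
  have hd' : (d : ℝ) + d₀ = d₁ + d₂ := mod_cast hd
  have hd2' : (d₀ : ℝ) + 1 ≤ d₂ := mod_cast hd2
  have hd1' : (d₀ : ℝ) + 1 ≤ d₁ := mod_cast hd1
  -- The attached point adds to the size but not to δ, so one unit of size must be absorbed. A
  -- common point of the two sides does this; if there is none, k₂ < k₁ leaves room in the doubling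
  -- bound, and d₂ ≥ 2 leaves a spare unit of δ.
  rcases Nat.eq_zero_or_pos k₀ with hk0 | hk0
  swap
  · have := hf.mono (k + 1) (k₁ + k₂) (by omega)
    linarith
  obtain rfl : k = k₁ + k₂ := by omega
  have hz : (d₀ : ℝ) = 0 := by rw [h0 hk0]; simp
  rcases h21.lt_or_eq with h3 | h3
  · have := hf.add_le k₁ (k₂ + 1) h3
    rw [← add_assoc] at this
    linarith
  · by_cases h4 : 2 ≤ d₂
    · have h5 := hf.succ_le (k₁ + k₂) (by omega)
      have h6 : (2 : ℝ) ≤ d₂ := mod_cast h4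
      linarith
    · have h5 : (d₂ : ℝ) ≤ 1 := by
        have : d₂ ≤ 1 := by omega
        exact_mod_cast this
      have h6 := hf.le_of_one_le k₂ hk2
      -- There remains n = 1, r = 3 and k₁ = k₂ = 1, where the required bound is exactly that a
      -- single hyperedge is allowed.
      have h7 : n ≤ 1 := by
        have : (n : ℝ) ≤ 1 := by linarith
        exact_mod_cast this
      have hn1 : n = 1 := by have := hf.pos; omega
      subst hn1
      have h8 : k₂ = 1 := by
        by_contra hne
        have := hf.lt_of_two_le k₂ (by omega)
        push_cast at this
        linarith
      have h9 := hn rfl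
      obtain rfl : r = 3 := by
        rcases hf.param with h | h <;> omega
      subst h8
      rw [← h3]
      norm_num at hr ⊢
      linarith

end UniformHypergraph

namespace UniformHypergraph

variable {r n : ℕ} {f : ℝ → ℝ} {V : Type*} [DecidableEq V]
  {H K : UniformHypergraph r V} {A D L R U W X Y Z : Finset V} {a b c p t : V}
  {σ τ g : Equiv.Perm V}

/-- `K` arises from `H` on `U` by attaching the point `p` by `n` hyperedges through `L`. -/
structure IsAttached (n : ℕ) (H K : UniformHypergraph r V) (U L : Finset V) (p : V) : Prop where
  notMem : p ∉ U
  agree : ∀ e ⊆ U, e ∈ K.edges ↔ e ∈ H.edges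
  predim : ∀ Y ⊆ U, ∃ ν : ℕ, K.predim n 1 (insert p Y) + ν = H.predim n 1 Y + n ∧
    (ν < n ∨ ν = n ∧ L ⊆ Y) ∧ (L ⊆ Y → ν = n) ∧ (ν = 0 ∨ ∃ x ∈ L, x ∈ Y)
  card_le : n = 1 → r ≤ L.card + 1

theorem IsAttached.predim_of_subset (h : IsAttached n H K U L p) (hY : Y ⊆ U) :
    K.predim n 1 Y = H.predim n 1 Y := by
  have := (Embeds.of_agree h.agree).predim_image (n := n) hY
  rw [Finset.image_id] at this
  exact this.symm

theorem exists_eq_insert_of_subset_insert (hY : Y ⊆ insert p U) :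
    Y ⊆ U ∨ ∃ Y' ⊆ U, Y = insert p Y' := by
  by_cases hpY : p ∈ Y
  · exact Or.inr ⟨Y.erase p, Finset.subset_insert_iff.1 hY, (Finset.insert_erase hpY).symm⟩
  · exact Or.inl fun x hx => (Finset.mem_insert.1 (hY hx)).resolve_left fun h => hpY (h ▸ hx)

/-- The point p is free of charge only over sets containing L, and such a set properly extends D and
therefore already has larger δ. -/
theorem IsAttached.strong (h : IsAttached n H K U L p) (hDU : D ⊆ U) (hD : H.Closed n D)
    (hLD : ¬ L ⊆ D) : K.Strong n D (insert p U) := by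
  intro Y h1 h2
  rw [h.predim_of_subset hDU]
  rcases exists_eq_insert_of_subset_insert h2 with h3 | ⟨Y, h3, rfl⟩
  · rw [h.predim_of_subset h3]
    exact hD Y Y h1 subset_rfl
  · have h4 : D ⊆ Y := fun x hx => (Finset.mem_insert.1 (h1.subset hx)).resolve_left fun h' =>
      h.notMem (hDU (h' ▸ hx))
    obtain ⟨ν, e1, e2, -, -⟩ := h.predim Y h3
    rcases e2 with e2 | ⟨rfl, e2⟩
    · have := (hD Y).le h4 subset_rfl
      omega
    · have := hD Y Y (Finset.ssubset_iff_subset_ne.2 ⟨h4, fun h' => hLD (h' ▸ e2)⟩) subset_rfl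
      omega

/-- Unless L ⊆ Y, adding p to a nonempty Y raises δ by at least 1. If L ⊆ Y, the points b and t put
Y properly on both sides of the amalgam, and `Control.le_of_amalgam` absorbs the extra point. -/
theorem IsAttached.good (hf : Control r n f) (hr : f r ≤ n * r - 1) (hH : H.InClass n 1 f)
    (h : IsAttached n H K (W ∪ R) L p) (hnc : H.NoCross W R) (hA : H.Closed n (W ∩ R))
    (hb : b ∈ L) (hbW : b ∈ W) (hbR : b ∉ R) (ht : t ∈ L) (htR : t ∈ R) (htW : t ∉ W) :
    K.Good n f (insert p (W ∪ R)) := by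
  intro Y hY
  rcases exists_eq_insert_of_subset_insert hY with h3 | ⟨Y, h3, rfl⟩
  · rw [h.predim_of_subset h3]
    exact (hH Y).2
  rw [Finset.card_insert_of_notMem fun h' => h.notMem (h3 h')]
  obtain ⟨ν, e1, e2, -, e4⟩ := h.predim Y h3
  have hg := hH.good Y Y subset_rfl
  rcases e2 with e2 | ⟨rfl, e2⟩
  · rcases Finset.eq_empty_or_nonempty Y with rfl | hY'
    · obtain rfl : ν = 0 := by
        rcases e4 with e4 | ⟨x, -, hx⟩
        · exact e4
        · exact absurd hx (Finset.notMem_empty x)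
      have h5 := (hH ∅).1
      have h6 : (n : ℤ) ≤ K.predim n 1 (insert p ∅) := by
        push_cast at e1
        omega
      have h7 : (n : ℝ) ≤ K.predim n 1 (insert p ∅) := mod_cast h6
      rw [Finset.card_empty, zero_add, Nat.cast_one, hf.one]
      exact h7
    · have h5 := hf.succ_le Y.card (Finset.card_pos.2 hY')
      have h6 : H.predim n 1 Y + 1 ≤ K.predim n 1 (insert p Y) := by omega
      have h7 : (H.predim n 1 Y : ℝ) + 1 ≤ K.predim n 1 (insert p Y) := mod_cast h6
      linarith
  · have e5 : K.predim ν 1 (insert p Y) = H.predim ν 1 Y := by omega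
    rw [e5]
    have m1 := hnc.predim_inter (n := ν) h3
    have hcard : Y.card + (Y ∩ W ∩ R).card = (Y ∩ W).card + (Y ∩ R).card := by
      rw [← Finset.card_union_add_card_inter (Y ∩ W) (Y ∩ R), ← Finset.inter_union_distrib_left,
        Finset.inter_eq_left.2 h3]
      congr 2
      grind
    have bY : b ∈ Y ∩ W := Finset.mem_inter.2 ⟨e2 hb, hbW⟩
    have tY : t ∈ Y ∩ R := Finset.mem_inter.2 ⟨e2 ht, htR⟩
    have s1 : H.predim ν 1 (Y ∩ W ∩ R) + 1 ≤ H.predim ν 1 (Y ∩ W) := by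
      have := (hA (W ∪ R)).inter (X := Y ∩ W) (by grind) (by grind) (Y ∩ W)
        (Finset.ssubset_iff_subset_ne.2 ⟨Finset.inter_subset_right, fun he => hbR ?_⟩) subset_rfl
      · rw [show W ∩ R ∩ (Y ∩ W) = Y ∩ W ∩ R by grind] at this
        omega
      · rw [← he] at bY
        grind
    have s2 : H.predim ν 1 (Y ∩ W ∩ R) + 1 ≤ H.predim ν 1 (Y ∩ R) := by
      have := (hA (W ∪ R)).inter (X := Y ∩ R) (by grind) (by grind) (Y ∩ R)
        (Finset.ssubset_iff_subset_ne.2 ⟨Finset.inter_subset_right, fun he => htW ?_⟩) subset_rfl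
      · rw [show W ∩ R ∩ (Y ∩ R) = Y ∩ W ∩ R by grind] at this
        omega
      · rw [← he] at tY
        grind
    have hk0 : (Y ∩ W ∩ R).card = 0 → H.predim ν 1 (Y ∩ W ∩ R) = 0 := by
      intro h0
      rw [predim_of_card_lt (by have := hf.two_le; omega), h0]
      simp
    have hkn : ν = 1 → r ≤ Y.card + 1 := fun h1 =>
      (h.card_le h1).trans (Nat.succ_le_succ (Finset.card_le_card e2))
    have c1 : 1 ≤ (Y ∩ W).card := Finset.card_pos.2 ⟨b, bY⟩
    have c2 : 1 ≤ (Y ∩ R).card := Finset.card_pos.2 ⟨t, tY⟩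
    rcases le_total (Y ∩ R).card (Y ∩ W).card with hle | hle
    · exact hf.le_of_amalgam hr (hH _).2 (hH _).2 hcard m1 s1 s2 c2 hle hk0 hkn
    · exact hf.le_of_amalgam hr (hH _).2 (hH _).2 (by rw [hcard, add_comm])
        (by rw [m1, add_comm]) s2 s1 c1 hle hk0 hkn

section

variable (hf : Control r n f) (hH : H.IsGeneric n 1 f)
include hf hH

theorem IsGeneric.exists_copies (hb : b ∉ (hH.inClass.geometry hf).cl A) (k : ℕ) :
    ∃ T : Finset V, T.card = k ∧ ∀ x ∈ T, ∃ σ ∈ (hH.inClass.geometry hf).fix A, σ b = x := by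
  induction k with
  | zero => exact ⟨∅, rfl, by simp⟩
  | succ k ih =>
    obtain ⟨T, hT, hT'⟩ := ih
    obtain ⟨σ, h1, h2⟩ := hH.exists_ind hf {b} A T
    rw [DimGeometry.smul_singleton_apply] at h2
    have hσb : σ b ∉ T := by
      intro h
      have h3 : σ b ∈ (hH.inClass.geometry hf).cl A := by
        rw [← h2.inter]
        exact Finset.mem_inter.2 ⟨DimGeometry.subset_cl (by simp), DimGeometry.subset_cl (by simp [h])⟩
      have h4 := h1.2 _ h3
      exact hb (by rwa [← σ.injective h4])
    refine ⟨insert (σ b) T, by rw [Finset.card_insert_of_notMem hσb, hT], ?_⟩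
    intro x hx
    rcases Finset.mem_insert.1 hx with rfl | hx
    · exact ⟨σ, h1, rfl⟩
    · exact hT' x hx

theorem IsGeneric.dim_insert_of_fix (hσ : σ ∈ (hH.inClass.geometry hf).fix A) :
    H.dim n 1 (insert (σ b) A) = H.dim n 1 (insert b A) := by
  have h1 := (hH.inClass.geometry hf).smul_d σ hσ.1 (insert b A)
  rw [Finset.smul_finset_insert, DimGeometry.smul_of_mem_fix' hσ subset_rfl] at h1
  exact h1

/-- The closure of an orbit contains a point of full dimension over the base, which is even free
if the points of the orbit have full dimension. -/
theorem IsGeneric.exists_point_over_orbit (hr : f r ≤ n * r - 1) (hA : H.Closed n A)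
    (hb : b ∉ A) :
    ∃ q, (∃ Y : Finset V, (∀ x ∈ Y, x ∈ A ∨ ∃ σ ∈ (hH.inClass.geometry hf).fix A, σ b = x) ∧
      q ∈ (hH.inClass.geometry hf).cl Y) ∧ H.dim n 1 (insert q A) = H.dim n 1 A + n ∧
      (H.dim n 1 (insert b A) = H.dim n 1 A + n →
        (hH.inClass.geometry hf).FreePoint A q) := by
  have := hH.infinite hf
  set S := hH.inClass.geometry hf with hS
  have hAcl : S.cl A = A := (hH.inClass.cl_eq_iff hf).2 hA
  have hb' : b ∉ S.cl A := by rwa [hAcl]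
  -- With b₁ this gives r − 1 points for the single hyperedge through p when n = 1, and two
  -- neighbours of p when n = 2.
  obtain ⟨T, hT1, hT2⟩ := hH.exists_copies hf hb' (if n = 1 then r - 2 else 1)
  obtain ⟨σ, hσ, hi⟩ := hH.exists_ind hf {b} A T
  rw [DimGeometry.smul_singleton_apply, ← hS] at hi
  set b₁ := σ b with hb₁
  have horb : ∀ x ∈ insert b₁ T, ∃ σ ∈ S.fix A, σ b = x := by
    intro x hx
    rcases Finset.mem_insert.1 hx with rfl | hx
    · exact ⟨σ, hσ, rfl⟩
    · exact hT2 x hx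
  have horbA : ∀ x ∈ insert b₁ T, x ∉ A := by
    intro x hx hxA
    obtain ⟨τ, h1, rfl⟩ := horb x hx
    have h2 := h1.2 _ (DimGeometry.subset_cl hxA)
    exact hb (by rwa [← τ.injective h2])
  have hnc := hH.inClass.noCross_of_ind hf hi
  rw [← hS] at hnc
  have hint := hi.inter
  rw [hAcl] at hint
  have hWc : H.Closed n (S.cl ({b₁} ∪ A)) := hH.inClass.closed_cl hf
  have hRc : H.Closed n (S.cl (T ∪ A)) := hH.inClass.closed_cl hf
  have hbW : b₁ ∈ S.cl ({b₁} ∪ A) := DimGeometry.subset_cl (by simp)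
  have hTR : T ⊆ S.cl (T ∪ A) := DimGeometry.subset_cl_of Finset.subset_union_left
  have hAW : A ⊆ S.cl ({b₁} ∪ A) := DimGeometry.subset_cl_of Finset.subset_union_right
  have hAR : A ⊆ S.cl (T ∪ A) := DimGeometry.subset_cl_of Finset.subset_union_right
  set W := S.cl ({b₁} ∪ A) with hW
  set R := S.cl (T ∪ A) with hR
  have hbR : b₁ ∉ R := fun h => horbA b₁ (Finset.mem_insert_self _ _)
    (hint ▸ Finset.mem_inter.2 ⟨hbW, h⟩)
  have hTW : ∀ t ∈ T, t ∉ W := fun t ht h => horbA t (Finset.mem_insert_of_mem ht)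
    (hint ▸ Finset.mem_inter.2 ⟨h, hTR ht⟩)
  have hbT : b₁ ∉ T := fun h => hbR (hTR h)
  set L := insert b₁ T with hL
  have hLU : L ⊆ W ∪ R := Finset.insert_subset (Finset.mem_union_left _ hbW)
    (hTR.trans Finset.subset_union_right)
  have hLcard : n = 1 ∧ L.card + 1 = r ∧ 1 ≤ L.card ∨ n = 2 ∧ r = 2 ∧ L.card = 2 := by
    rw [hL, Finset.card_insert_of_notMem hbT, hT1]
    rcases hf.param with ⟨rfl, h⟩ | ⟨rfl, rfl⟩
    · left
      rw [if_pos rfl]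
      omega
    · right
      simp
  obtain ⟨t, ht⟩ : T.Nonempty := by
    rw [← Finset.card_pos, hT1]
    rcases hf.param with ⟨rfl, h⟩ | ⟨rfl, rfl⟩
    · rw [if_pos rfl]
      omega
    · simp
  obtain ⟨p, hp⟩ := Infinite.exists_notMem_finset (W ∪ R)
  obtain ⟨K, hK1, hK2⟩ := exists_attach H hp hLU hLcard
  have hat : IsAttached n H K (W ∪ R) L p := ⟨hp, hK1, hK2, by
    rintro rfl
    rcases hLcard with h | h <;> omega⟩
  have hbL : b₁ ∈ L := Finset.mem_insert_self _ _
  have htL : t ∈ L := Finset.mem_insert_of_mem ht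
  have hgood := hat.good hf hr hH.inClass hnc (by rwa [hint]) hbL hbW hbR htL (hTR ht) (hTW t ht)
  have hAU : A ⊆ W ∪ R := hAW.trans Finset.subset_union_left
  have hstr : ∀ D, D ⊆ W ∪ R → H.Closed n D → ¬ L ⊆ D → K.Strong n D (insert p (W ∪ R)) :=
    fun D h1 h2 h3 => hat.strong h1 h2 h3
  have hLA : ¬ L ⊆ A := fun h => horbA b₁ hbL (h hbL)
  have hLW : ¬ L ⊆ W := fun h => hTW t ht (h htL)
  have hLR : ¬ L ⊆ R := fun h => hbR (h hbL)
  have hUp : W ∪ R ⊆ insert p (W ∪ R) := Finset.subset_insert _ _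
  -- W ∪ R is not strong in its extension by p, so it cannot be kept in place and everything is
  -- realized anew over A. W and R separately stay strong, so their images are conjugates over A and
  -- φ maps L into the orbit of b.
  obtain ⟨φ, p1, p2, p3⟩ := hH.realize hf hgood (hAU.trans hUp) (hstr A hAU hA hLA)
    (g := id) (Embeds.of_agree fun e he => hK1 e (he.trans hAU)) (by rwa [Finset.image_id])
  have hEU : Embeds H H (W ∪ R) φ := by
    refine ⟨p1.1.mono (Finset.coe_subset.2 hUp), fun e he => ?_⟩
    rw [← hK1 e he, p1.2 e (he.trans hUp)]
  have haut : ∀ D, D ⊆ W ∪ R → A ⊆ D → H.Closed n D → ¬ L ⊆ D →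
      ∃ τ ∈ S.fix A, ∀ x ∈ D, τ x = φ x := by
    intro D h1 hAD h2 h3
    obtain ⟨τ, q1, q2⟩ := hH.exists_aut hf (hEU.mono h1) h2
      (p3.of_strong ((p1.strong (h1.trans hUp) subset_rfl).2 (hstr D h1 h2 h3))
        (Finset.image_subset_image (h1.trans hUp)))
    refine ⟨τ, ⟨q1, fun x hx => ?_⟩, q2⟩
    rw [hAcl] at hx
    rw [q2 x (hAD hx)]
    exact p2 x hx
  obtain ⟨τW, hτW, hτWφ⟩ := haut W Finset.subset_union_left hAW hWc hLW
  obtain ⟨τR, hτR, hτRφ⟩ := haut R Finset.subset_union_right hAR hRc hLR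
  have hWim : W.image φ = S.cl ({φ b₁} ∪ A) := by
    rw [← hτWφ b₁ hbW, ← DimGeometry.smul_singleton_apply]
    conv_rhs => rw [← DimGeometry.smul_of_mem_fix' hτW (subset_refl A)]
    rw [← Finset.smul_finset_union, DimGeometry.smul_cl hτW.1]
    exact Finset.image_congr fun x hx => (hτWφ x hx).symm
  have hRim : R.image φ = S.cl (T.image φ ∪ A) := by
    have h1 : T.image φ = τR • T := Finset.image_congr fun x hx => (hτRφ x (hTR hx)).symm
    rw [h1]
    conv_rhs => rw [← DimGeometry.smul_of_mem_fix' hτR (subset_refl A)]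
    rw [← Finset.smul_finset_union, DimGeometry.smul_cl hτR.1]
    exact Finset.image_congr fun x hx => (hτRφ x hx).symm
  have hφL : ∀ x ∈ L, ∃ σ ∈ S.fix A, σ b = φ x := by
    intro x hx
    obtain ⟨σ', h1, rfl⟩ := horb x hx
    rcases Finset.mem_union.1 (hLU hx) with h2 | h2
    · exact ⟨τW * σ', (S.fix A).mul_mem hτW h1, hτWφ _ h2⟩
    · exact ⟨τR * σ', (S.fix A).mul_mem hτR h1, hτRφ _ h2⟩
  have hinsim : (insert p (W ∪ R)).image φ = insert (φ p) ((W ∪ R).image φ) :=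
    Finset.image_insert _ _ _
  -- Adding p leaves δ(W ∪ R) unchanged, so the image of W ∪ R is not closed, and φ p is the only
  -- point its closure can gain.
  have hqU : φ p ∈ S.cl ((W ∪ R).image φ) := by
    have h1 : S.cl ((W ∪ R).image φ) ⊆ insert (φ p) ((W ∪ R).image φ) := by
      rw [hinsim] at p3
      conv_rhs => rw [← (hH.inClass.cl_eq_iff hf).2 p3]
      exact DimGeometry.cl_mono (Finset.subset_insert _ _)
    by_contra hc
    have h2 : S.cl ((W ∪ R).image φ) = (W ∪ R).image φ := by
      refine Finset.Subset.antisymm (fun x hx => ?_) DimGeometry.subset_cl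
      exact (Finset.mem_insert.1 (h1 hx)).resolve_left fun h => hc (h ▸ hx)
    have h3 := (hH.inClass.cl_eq_iff hf).1 h2
    have h4 := h3 (insert (φ p) ((W ∪ R).image φ)) (insert (φ p) ((W ∪ R).image φ))
      (Finset.ssubset_insert fun h => hc (h2.symm ▸ h)) subset_rfl
    rw [← hinsim, p1.predim_image subset_rfl, hEU.predim_image subset_rfl] at h4
    obtain ⟨ν, e1, -, e3, -⟩ := hK2 (W ∪ R) subset_rfl
    have := e3 hLU
    omega
  have hdA := Closed.dim_eq hH.inClass hA
  have hbd : H.dim n 1 A + 1 ≤ H.dim n 1 (insert b A) := DimGeometry.d_insert_of_notMem hb'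
  have hbig : ∀ D, A ⊆ D → ∀ x ∈ L, x ∈ D → H.dim n 1 (insert b A) ≤ H.predim n 1 D := by
    intro D h1 x hx hxD
    obtain ⟨τ, h2, rfl⟩ := horb x hx
    rw [← hH.dim_insert_of_fix hf h2]
    exact hH.inClass.dim_le (Finset.insert_subset hxD h1)
  have hn := hf.pos
  have hn2 : n ≤ 2 := by rcases hf.param with h | h <;> omega
  -- With no hyperedge at p present, p costs n. With all of them present, Y meets the orbit on both
  -- independent sides and costs at least 2d(b/A) ≥ 2 ≥ n. In the mixed case n = 2, and Y and p cost
  -- at least 1 each.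
  have hlow : ∀ Y, A ⊆ Y → Y ⊆ W ∪ R → H.predim n 1 A + n ≤ K.predim n 1 (insert p Y) ∧
      (H.dim n 1 (insert b A) = H.dim n 1 A + n →
        K.predim n 1 (insert p Y) ≤ H.predim n 1 A + n → Y = A) := by
    intro Y h1 h2
    obtain ⟨ν, e1, e2, -, e4⟩ := hK2 Y h2
    have h3 := (hA Y).le h1 subset_rfl
    rcases e2 with e2 | ⟨e2, e3⟩
    · rcases e4 with rfl | ⟨x, hx, hxY⟩
      · push_cast at e1
        refine ⟨by omega, fun _ h4 => ?_⟩
        by_contra hne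
        have := hA Y Y (Finset.ssubset_iff_subset_ne.2 ⟨h1, fun h => hne h.symm⟩) subset_rfl
        omega
      · have h4 := hbig Y h1 x hx hxY
        refine ⟨by omega, fun h5 h6 => ?_⟩
        omega
    · have h4 := hnc.predim_inter (n := n) h2
      rw [Finset.inter_assoc, hint, Finset.inter_eq_right.2 h1] at h4
      have h5 := hbig (Y ∩ W) (Finset.subset_inter h1 hAW) b₁ hbL
        (Finset.mem_inter.2 ⟨e3 hbL, hbW⟩)
      have h6 := hbig (Y ∩ R) (Finset.subset_inter h1 hAR) t htL
        (Finset.mem_inter.2 ⟨e3 htL, hTR ht⟩)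
      refine ⟨by omega, fun h5 h6 => ?_⟩
      omega
  have hAim : A.image φ = A := (Finset.image_congr fun x hx => p2 x hx).trans Finset.image_id
  obtain ⟨Y, hAY, hYU, hYim⟩ : ∃ Y, A ⊆ Y ∧ Y ⊆ W ∪ R ∧
      S.cl (insert (φ p) A) = (insert p Y).image φ := by
    have h1 : S.cl (insert (φ p) A) ⊆ (insert p (W ∪ R)).image φ := by
      rw [← (hH.inClass.cl_eq_iff hf).2 p3]
      apply DimGeometry.cl_mono
      rw [hinsim]
      conv_lhs => rw [← hAim]
      exact Finset.insert_subset_insert _ (Finset.image_subset_image hAU)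
    obtain ⟨Y₀, h2, h3⟩ := Finset.subset_image_iff.1 h1
    have h2 : Y₀ ⊆ insert p (W ∪ R) := mod_cast h2
    have h4 : insert p A ⊆ Y₀ := by
      apply (p1.image_subset_image (Finset.insert_subset_insert _ hAU) h2).1
      rw [h3, Finset.image_insert, hAim]
      exact DimGeometry.subset_cl
    rcases exists_eq_insert_of_subset_insert h2 with h5 | ⟨Y, h5, rfl⟩
    · exact absurd (h5 (h4 (Finset.mem_insert_self _ _))) hp
    · refine ⟨Y, fun x hx => ?_, h5, h3.symm⟩
      exact (Finset.mem_insert.1 (h4 (Finset.mem_insert_of_mem hx))).resolve_left fun h =>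
        hp (hAU (h ▸ hx))
  have hYd : H.dim n 1 (insert (φ p) A) = K.predim n 1 (insert p Y) := by
    rw [← hH.inClass.predim_cl hf, ← hS, hYim,
      p1.predim_image (Finset.insert_subset_insert _ hYU)]
  obtain ⟨l1, l2⟩ := hlow Y hAY hYU
  have hle := hH.inClass.dim_insert_le (φ p) A
  have hdq : H.dim n 1 (insert (φ p) A) = H.dim n 1 A + n := by omega
  refine ⟨φ p, ⟨A ∪ L.image φ, ?_, ?_⟩, hdq, ?_⟩
  · intro x hx
    rcases Finset.mem_union.1 hx with h | h
    · exact Or.inl h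
    · right
      obtain ⟨y, hy, rfl⟩ := Finset.mem_image.1 h
      exact hφL y hy
  · refine DimGeometry.cl_subset_cl ?_ hqU
    rw [Finset.image_union, hWim, hRim]
    apply Finset.union_subset
    · apply DimGeometry.cl_mono
      have := Finset.mem_image_of_mem φ hbL
      grind
    · apply DimGeometry.cl_mono
      have := Finset.image_subset_image (f := φ) (Finset.subset_insert b₁ T)
      grind
  · intro h1
    apply hH.inClass.freePoint hf hdq
    rw [← hS, hYim, l2 h1 (by omega), Finset.image_insert, hAim, hAcl]

end

end UniformHypergraph

/-! ### Generating orbits, simplicity and monodimensionality -/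

namespace UniformHypergraph

variable {r n : ℕ} {f : ℝ → ℝ} {V : Type*} [DecidableEq V]
  {H : UniformHypergraph r V} {A X Y Z : Finset V} {a b c p : V} {σ τ g : Equiv.Perm V}

theorem InClass.mem_dcl_of_mem_cl (hf : Control r n f) (h : H.InClass n 1 f) {M : Set V}
    (ha : a ∈ (h.geometry hf).cl Y) (hY : ∀ y ∈ Y, y ∈ H.dcl n 1 M) : a ∈ H.dcl n 1 M := by
  simp only [h.mem_dcl hf] at hY ⊢
  choose! F hF1 hF2 using hY
  refine ⟨Y.biUnion F, ?_, ?_⟩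
  · intro x hx
    simp only [Finset.coe_biUnion, Set.mem_iUnion] at hx
    obtain ⟨y, hy, hx⟩ := hx
    exact hF1 y hy hx
  · refine DimGeometry.cl_subset_cl (fun y hy => ?_) ha
    exact DimGeometry.cl_mono (Finset.subset_biUnion_of_mem F hy) (hF2 y hy)

theorem InClass.subset_dcl (hf : Control r n f) (h : H.InClass n 1 f) (M : Set V) :
    M ⊆ H.dcl n 1 M := fun x hx =>
  (h.mem_dcl hf).2 ⟨{x}, by simpa using hx, DimGeometry.subset_cl (Finset.mem_singleton_self x)⟩

section

variable (hf : Control r n f) (hH : H.IsGeneric n 1 f)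
include hf hH

theorem IsGeneric.mem_orb_iff (hA : H.Closed n A) :
    a ∈ H.orb b A ↔ ∃ σ ∈ (hH.inClass.geometry hf).fix A, σ b = a := by
  have hAcl : (hH.inClass.geometry hf).cl A = A := (hH.inClass.cl_eq_iff hf).2 hA
  constructor
  · rintro ⟨σ, h1, h2, h3⟩
    exact ⟨σ, ⟨h1, by rw [hAcl]; exact h2⟩, h3⟩
  · rintro ⟨σ, ⟨h1, h2⟩, h3⟩
    exact ⟨σ, h1, by rwa [hAcl] at h2, h3⟩

theorem IsGeneric.apply_mem_dcl_orb (hA : H.Closed n A)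
    (hσ : σ ∈ (hH.inClass.geometry hf).fix A) (ha : a ∈ H.dcl n 1 (A ∪ H.orb b A)) :
    σ a ∈ H.dcl n 1 (A ∪ H.orb b A) := by
  obtain ⟨Y, h1, h2⟩ := (hH.inClass.mem_dcl hf).1 ha
  refine (hH.inClass.mem_dcl hf).2 ⟨σ • Y, ?_, ?_⟩
  · intro x hx
    obtain ⟨y, hy, rfl⟩ := Finset.mem_smul_finset.1 hx
    rcases h1 hy with h3 | h3
    · left
      change σ y ∈ _
      rw [hσ.2 y (DimGeometry.subset_cl h3)]
      exact h3
    · right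
      obtain ⟨τ, h4, rfl⟩ := (hH.mem_orb_iff hf hA).1 h3
      exact (hH.mem_orb_iff hf hA).2 ⟨σ * τ, ((hH.inClass.geometry hf).fix A).mul_mem hσ h4, rfl⟩
  · rw [DimGeometry.smul_cl hσ.1]
    exact Finset.smul_mem_smul_finset h2

/-- The orbit of any point outside a closed finite set generates everything. -/
theorem IsGeneric.dcl_orb_eq_univ (hr : f r ≤ n * r - 1) (hA : H.Closed n A) (hb : b ∉ A) :
    H.dcl n 1 (A ∪ H.orb b A) = univ := by
  set S := hH.inClass.geometry hf with hS
  set M := H.dcl n 1 (A ∪ H.orb b A) with hM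
  have hAcl : S.cl A = A := (hH.inClass.cl_eq_iff hf).2 hA
  have hsub : (A : Set V) ∪ H.orb b A ⊆ M := hH.inClass.subset_dcl hf _
  -- The first round produces a point of full dimension over A; the second, started from that point,
  -- produces a free one.
  obtain ⟨q, ⟨Y, hY, hqY⟩, hqd, -⟩ := hH.exists_point_over_orbit hf hr hA hb
  have hqM : q ∈ M := hH.inClass.mem_dcl_of_mem_cl hf hqY fun y hy => by
    rcases hY y hy with h | h
    · exact hsub (Or.inl h)
    · exact hsub (Or.inr ((hH.mem_orb_iff hf hA).2 h))
  have hqA : q ∉ A := by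
    intro h
    rw [Finset.insert_eq_of_mem h] at hqd
    have := hf.pos
    omega
  obtain ⟨q', ⟨Y', hY', hqY'⟩, -, hfree⟩ := hH.exists_point_over_orbit hf hr hA hqA
  have hqM' : q' ∈ M := hH.inClass.mem_dcl_of_mem_cl hf hqY' fun y hy => by
    rcases hY' y hy with h | ⟨σ, h, rfl⟩
    · exact hsub (Or.inl h)
    · exact hH.apply_mem_dcl_orb hf hA h hqM
  rw [Set.eq_univ_iff_forall]
  apply hH.forall_mem_of_freePoint hf hr hA
  · intro p hp
    obtain ⟨σ, h1, rfl⟩ := hH.exists_fix_of_freePoint hf (hfree hqd) hp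
    exact hH.apply_mem_dcl_orb hf hA h1 hqM'
  · intro c hc
    -- Pendant edges are attached at c one after another, with their new points in M. Each lowers by
    -- 1 the contribution of c to δ over those points; after n edges it is zero, so c lies in their
    -- closure.
    have key : ∀ j : ℕ, ∃ Q : Finset V, ↑Q ⊆ M ∧ c ∉ Q ∧ H.Closed n (insert c Q) ∧
        H.predim n 1 (insert c Q) + j = H.predim n 1 Q + n := by
      intro j
      induction j with
      | zero =>
        refine ⟨∅, by simp, by simp, hH.inClass.closed_singleton hf c, ?_⟩
        have := hf.two_le
        rw [predim_of_card_lt (by simp; omega), predim_of_card_lt (by simp; omega)]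
        simp
      | succ j ih =>
        obtain ⟨Q, h1, h2, h3, h4⟩ := ih
        obtain ⟨P, hP, hPM⟩ := hc _ h3 (Finset.mem_insert_self _ _)
        have e1 := hP.predim_union
        have e2 := hP.predim_eq (Y := Q ∪ P) (by grind)
        have hcQ : c ∉ Q ∪ P := by
          rw [Finset.mem_union]
          exact fun h => h.elim h2 hP.notMem
        have e3 : (Q ∪ P) ∩ insert c Q = Q := by
          have := Finset.disjoint_left.1 hP.disjoint
          grind
        rw [if_neg (fun h => hcQ (h (Finset.mem_insert_self _ _))), e3,
          Finset.inter_eq_right.2 Finset.subset_union_right] at e2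
        rw [Finset.insert_union] at e1
        refine ⟨Q ∪ P, by rw [Finset.coe_union]; exact Set.union_subset h1 hPM, hcQ, ?_, ?_⟩
        · rw [← Finset.insert_union]
          exact hP.closed
        · push_cast
          omega
    obtain ⟨Q, h1, h2, h3, h4⟩ := key n
    have hQM : ∀ y ∈ Q, y ∈ H.dcl n 1 (A ∪ H.orb b A) := fun y hy => h1 hy
    refine hH.inClass.mem_dcl_of_mem_cl hf (Y := Q) ?_ hQM
    by_contra hcQ
    have h5 : S.cl Q ⊆ insert c Q := by
      conv_rhs => rw [← (hH.inClass.cl_eq_iff hf).2 h3]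
      exact DimGeometry.cl_mono (Finset.subset_insert _ _)
    have h6 : S.cl Q = Q := by
      refine Finset.Subset.antisymm (fun x hx => ?_) DimGeometry.subset_cl
      exact (Finset.mem_insert.1 (h5 hx)).resolve_left fun h => hcQ (h ▸ hx)
    have h7 := (hH.inClass.cl_eq_iff hf).1 h6 _ _ (Finset.ssubset_insert h2) subset_rfl
    omega

/-- A nontrivial automorphism moves some conjugate of every point out of its closure. -/
theorem IsGeneric.exists_fix_apply_notMem_cl (hr : f r ≤ n * r - 1) (hg : g ∈ H.aut)
    (hg1 : g ≠ 1) (hb : b ∉ (hH.inClass.geometry hf).cl Z) :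
    ∃ σ ∈ (hH.inClass.geometry hf).fix Z,
      g (σ b) ∉ (hH.inClass.geometry hf).cl ({σ b} ∪ Z) := by
  by_contra! hcon
  set S := hH.inClass.geometry hf with hS
  have hgS : g ∈ S.G := hg
  have hA : H.Closed n (S.cl Z) := hH.inClass.closed_cl hf
  set Z' := S.cl Z ∪ g • S.cl Z with hZ'
  have hfixcl : ∀ σ ∈ S.fix (S.cl Z), σ ∈ S.fix Z := fun σ hσ =>
    DimGeometry.fix_mono' DimGeometry.subset_cl hσ
  -- The point a lies in the closure of a finite part Y of cl Z and the orbit, and g maps Y into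
  -- cl(Y, Z'); hence g a ∈ cl(Y, a, Z'). The same holds for a copy of Y independent from Y over a
  -- and Z', and the two closures meet in cl(a, Z').
  have hbound : ∀ a, g a ∈ S.cl ({a} ∪ Z') := by
    intro a
    have ha : a ∈ H.dcl n 1 (S.cl Z ∪ H.orb b (S.cl Z)) := by
      rw [hH.dcl_orb_eq_univ hf hr hA hb]
      trivial
    obtain ⟨Y, h1, h2⟩ := (hH.inClass.mem_dcl hf).1 ha
    have hmove : ∀ ρ ∈ S.fix Z, g • ρ • Y ⊆ S.cl (ρ • Y ∪ ({a} ∪ Z')) := by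
      intro ρ hρ x hx
      obtain ⟨y', hy', rfl⟩ := Finset.mem_smul_finset.1 hx
      obtain ⟨y, hy, rfl⟩ := Finset.mem_smul_finset.1 hy'
      rcases h1 hy with h3 | h3
      · have h4 : ρ • y = y := hρ.2 y h3
        rw [h4]
        apply DimGeometry.subset_cl
        have := Finset.smul_mem_smul_finset (a := g) (Finset.mem_coe.1 h3)
        grind
      · obtain ⟨σ, h4, rfl⟩ := (hH.mem_orb_iff hf hA).1 h3
        have h5 := hcon (ρ * σ) ((S.fix Z).mul_mem hρ (hfixcl σ h4))
        refine DimGeometry.cl_subset_cl (Finset.union_subset ?_ ?_) h5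
        · rw [Finset.singleton_subset_iff]
          exact DimGeometry.subset_cl (Finset.mem_union_left _ hy')
        · have := DimGeometry.subset_cl (S := S) (X := Z)
          exact DimGeometry.subset_cl_of (by grind)
    obtain ⟨ρ, hρ, hi⟩ := hH.exists_ind hf Y ({a} ∪ Z') Y
    rw [← hS] at hρ hi
    have hρZ : ρ ∈ S.fix Z := DimGeometry.fix_mono' (by
      have := DimGeometry.subset_cl (S := S) (X := Z)
      grind) hρ
    have hρa : ρ a = a := hρ.2 a (DimGeometry.subset_cl (by simp))
    rw [← hi.inter, Finset.mem_inter]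
    have h3 : ∀ ρ ∈ S.fix Z, ρ a = a → g a ∈ S.cl (ρ • Y ∪ ({a} ∪ Z')) := by
      intro ρ hρ hρa
      refine DimGeometry.cl_subset_cl (hmove ρ hρ) ?_
      rw [DimGeometry.smul_cl hgS, DimGeometry.smul_cl hρ.1]
      apply Finset.smul_mem_smul_finset (a := g)
      rw [← hρa]
      exact Finset.smul_mem_smul_finset (a := ρ) h2
    refine ⟨h3 ρ hρZ hρa, ?_⟩
    have := h3 1 (S.fix Z).one_mem rfl
    rwa [one_smul] at this
  apply hg1
  -- For p free over cl Z' the closure cl(p, Z') is {p} ∪ cl Z', so the bound leaves only two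
  -- possibilities for g p.
  refine hH.eq_one_of_freePoint hf hr hg (Z := S.cl Z') fun p hp => ?_
  have h1 := hp.2.1
  have h2 : g p ∈ S.cl ({p} ∪ S.cl Z' ∪ ∅) := by
    refine DimGeometry.cl_mono ?_ (hbound p)
    have := DimGeometry.subset_cl (S := S) (X := Z')
    grind
  have h3 := h1 h2
  rw [Finset.union_empty, Finset.union_empty, DimGeometry.cl_cl, Finset.mem_union] at h3
  rcases h3 with h3 | h3
  · right
    have h4 : S.cl {p} = {p} := (hH.inClass.cl_eq_iff hf).2 (hH.inClass.closed_singleton hf p)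
    have h5 : g p ∈ S.cl {p} := h3
    rwa [h4, Finset.mem_singleton] at h5
  · exact Or.inl h3

theorem IsGeneric.isSimpleGroup_aut (hr : f r ≤ n * r - 1) : IsSimpleGroup H.aut := by
  have := hH.countable
  have := hH.infinite hf
  have hnt : Nontrivial H.aut := by
    obtain ⟨p, q, hpq⟩ := exists_pair_ne V
    obtain ⟨σ, h1, h2⟩ := hH.exists_aut_apply hf p q
    refine ⟨⟨σ, h1⟩, 1, fun h => hpq ?_⟩
    have h3 : σ = 1 := congrArg Subtype.val h
    rw [← h2, h3]
    rfl
  refine { hnt with eq_bot_or_eq_top_of_normal := fun N hN => ?_ }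
  rw [or_iff_not_imp_left, ← ne_eq, Subgroup.ne_bot_iff_exists_ne_one]
  rintro ⟨⟨g, hgN⟩, hg1⟩
  rw [eq_top_iff]
  rintro k -
  have hg1' : (g : Equiv.Perm V) ≠ 1 := fun h => hg1 (Subtype.ext (Subtype.ext h))
  have hk := FreeGeometry.mem_of_ne_one (F := hH.freeGeometry hf) (g := g) (k := k) g.2
    (fun Z b hb => hH.exists_fix_apply_notMem_cl hf hr g.2 hg1' hb)
    (fun X b hb => hH.special_or hf hr hb) k.2 (N.map H.aut.subtype)
    (Subgroup.mem_map_of_mem _ hgN) (by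
      rintro a ha _ ⟨x, hx, rfl⟩
      exact ⟨⟨a, ha⟩ * x * ⟨a, ha⟩⁻¹, hN.conj_mem x hx ⟨a, ha⟩, rfl⟩)
  obtain ⟨x, hx, he⟩ := hk
  rwa [← Subtype.ext he]

theorem IsGeneric.monodimensional : H.Monodimensional n 1 := by
  rintro A ⟨X, rfl⟩ b ⟨hb, -⟩
  -- No enlargement of A is needed: B = A works.
  refine ⟨_, ⟨X, rfl⟩, subset_rfl, ?_⟩
  by_cases hr : f r ≤ n * r - 1
  · rw [hH.inClass.dcl_coe hf] at hb ⊢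
    exact hH.dcl_orb_eq_univ hf hr (hH.inClass.closed_cl hf) hb
  -- If a single hyperedge is forbidden there are no hyperedges at all, every permutation is an
  -- automorphism, and the orbit is the whole complement of A.
  · have hE : ∀ e, e ∉ H.edges := by
      intro e he
      apply hr
      have h1 := (hH.inClass e).2
      have h2 : 1 ≤ (H.edgesIn e).card := Finset.card_pos.2 ⟨e, mem_edgesIn.2 ⟨subset_rfl, he⟩⟩
      have h3 : (1 : ℝ) ≤ (H.edgesIn e).card := mod_cast h2
      rw [H.card_of_mem e he, predim_eq, H.card_of_mem e he] at h1
      push_cast at h1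
      linarith
    rw [Set.eq_univ_iff_forall]
    intro c
    apply hH.inClass.subset_dcl hf
    by_cases hc : c ∈ H.dcl n 1 X
    · exact Or.inl hc
    · right
      refine ⟨Equiv.swap b c, mem_aut_iff.2 fun e => iff_of_false (hE _) (hE _), ?_, by simp⟩
      intro a ha
      exact Equiv.swap_apply_of_ne_of_ne (fun h => hb (h ▸ ha)) (fun h => hc (h ▸ ha))

end

end UniformHypergraph

theorem mainTheorem12 :
    (∀ (r : ℕ) (f : ℝ → ℝ), 3 ≤ r → IsLogControl f 1 → f 1 = 1 →
      (∃ H : UniformHypergraph r ℕ, H.IsGeneric 1 1 f) ∧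
      ∀ (V : Type*) (H : UniformHypergraph r V), H.IsGeneric 1 1 f →
        H.Monodimensional 1 1 ∧ (f r ≤ r - 1 → IsSimpleGroup H.aut)) ∧
    (∀ f : ℝ → ℝ, IsLogControl f 2 → f 1 = 2 → f 2 = 3 →
      (∃ H : UniformHypergraph 2 ℕ, H.IsGeneric 2 1 f) ∧
      ∀ (V : Type*) (H : UniformHypergraph 2 V), H.IsGeneric 2 1 f →
        H.Monodimensional 2 1 ∧ IsSimpleGroup H.aut) := by
  classical
  refine ⟨fun r f hr hf h1 => ?_, fun f hf h1 h2 => ?_⟩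
  · have hc := hf.control_one hr h1
    refine ⟨hc.exists_isGeneric, fun V H hH => ⟨hH.monodimensional hc, fun hfr => ?_⟩⟩
    exact hH.isSimpleGroup_aut hc (by simpa using hfr)
  · have hc := hf.control_two h1 h2
    refine ⟨hc.exists_isGeneric, fun V H hH => ⟨hH.monodimensional hc, ?_⟩⟩
    -- For n = r = 2 the single-edge condition reads f(2) ≤ 3.
    exact hH.isSimpleGroup_aut hc (by push_cast; rw [h2]; norm_num)
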